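/- Let $f : X \to Y$ be a continuous map of topological spaces, where $X$ is Hausdorff, $X$ and $Y$ are paracompact, and every subspace of $X$ is paracompact. Let $\mathbb{Z}$, $\underline{\mathbb{C}}$, $\underline{\mathbb{C}}^*$ denote the sheaves on $X$ of continuous functions with values in $\mathbb{Z}$ (discrete), $\mathbb{C}$ and $\mathbb{C}^* = \mathbb{C}\setminus\{0\}$, and let $\delta : H^n(X,\underline{\mathbb{C}}^*) \to H^{n+1}(X,\mathbb{Z})$ be the coboundary of the exponential sequence $0 \to \mathbb{Z} \to \underline{\mathbb{C}} \xrightarrow{\exp(2\pi i\,\cdot)} \underline{\mathbb{C}}^* \to 0$. For a sheaf $A$ of abelian groups on $X$, the Leray filtration $F^{p,n}(A) \subseteq H^n(X,A)$ is defined as follows. Let $M^*$ be an injective resolution of $A$, let $0 \to f_*M^* \to I^{0,*} \to I^{1,*} \to \cdots$ be a Cartan–Eilenberg resolution of $f_*M^*$, let $R^{p,q} = \Gamma(Y, I^{p,q})$ with associated single complex $R^*$, and let $F^pR^n = \bigoplus_{a+b=n,\ a \ge p} R^{a,b}$. The augmentation $\Gamma(X,M^*) = \Gamma(Y,f_*M^*)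 \to R^*$ identifies $H^n(X,A)$ with $H^n(R^*)$, and $F^{p,n}(A)$ is the image of $H^n(F^pR^*) \to H^n(R^*)$. Write $E_\infty^{p,q}(A) = F^{p,p+q}(A)/F^{p+1,p+q}(A)$ for the limit term of the Leray spectral sequence. Then, for every choice of these resolutions for $\mathbb{Z}$ and for $\underline{\mathbb{C}}^*$: 1. $\delta$ maps $F^{p,n}(\underline{\mathbb{C}}^*)$ into $F^{p,n+1}(\mathbb{Z})$ for all $p,n \ge 0$. For $p,q \ge 0$ the restricted map $\delta : F^{p,p+q}(\underline{\mathbb{C}}^*) \to F^{p,p+q+1}(\mathbb{Z})$ is an isomorphism whenever $p+q \ge 1$, and it is surjective for $p=q=0$. 2. For $p,q \ge 0$ the induced map of quotients $E_\infty^{p,q}(\underline{\mathbb{C}}^*) \to E_\infty^{p,q+1}(\mathbb{Z})$ is an isomorphism for $q \ge 1$ and surjective for $q=0$. -/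

import Mathlib

open CategoryTheory Opposite TopologicalSpace

universe u

namespace Leray

/-! ### Sheaves of continuous functions and the exponential sequence -/

/-- The presheaf `U ↦ C(U, A)` of continuous functions with values in a topological abelian
group `A`. For discrete `A`, such as `ℤ`, these are the locally constant functions. -/
def contPresheaf (X : TopCat.{u}) (A : Type) [AddCommGroup A] [TopologicalSpace A]
    [IsTopologicalAddGroup A] : TopCat.Presheaf AddCommGrpCat.{u} X where
  obj U := AddCommGrpCat.of C(U.unop, A)
  map {U V} i := AddCommGrpCat.ofHom
    { toFun := fun g => g.comp ⟨Set.inclusion (leOfHom i.unop), continuous_inclusion _⟩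
      map_zero' := rfl
      map_add' := fun _ _ => rfl }

theorem contPresheaf_isSheaf (X : TopCat.{u}) (A : Type) [AddCommGroup A] [TopologicalSpace A]
    [IsTopologicalAddGroup A] : (contPresheaf X A).IsSheaf := by
  rw [TopCat.Presheaf.isSheaf_iff_isSheafUniqueGluing]
  intro ι U sf hsf
  change ∀ i, C(U i, A) at sf
  have hc : ∀ (i j : ι) (x : X) (hi : x ∈ U i) (hj : x ∈ U j), sf i ⟨x, hi⟩ = sf j ⟨x, hj⟩ := by
    intro i j x hi hj
    exact DFunLike.congr_fun (F := C((U i ⊓ U j : Opens X), A)) (hsf i j) ⟨x, hi, hj⟩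
  choose k hk using fun x : (iSup U : Opens X) => Opens.mem_iSup.mp x.2
  have hcont : Continuous (fun x : (iSup U : Opens X) => sf (k x) ⟨x.1, hk x⟩) := by
    rw [continuous_iff_continuousAt]
    intro x
    have ho : IsOpen {y : (iSup U : Opens X) | y.1 ∈ U (k x)} :=
      (U (k x)).isOpen.preimage continuous_subtype_val
    apply ContinuousOn.continuousAt (s := {y : (iSup U : Opens X) | y.1 ∈ U (k x)}) _
      (ho.mem_nhds (hk x))
    rw [continuousOn_iff_continuous_domRestrict]
    have : Continuous (fun y : {y : (iSup U : Opens X) | y.1 ∈ U (k x)} =>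
        sf (k x) ⟨y.1.1, y.2⟩) :=
      (sf (k x)).continuous.comp (by fun_prop)
    convert this using 2 with y
    exact hc _ _ _ _ _
  refine ⟨(⟨_, hcont⟩ : C((iSup U : Opens X), A)), ?_, ?_⟩
  · intro i
    refine ContinuousMap.ext (fun y => ?_)
    exact hc _ _ _ _ _
  · intro t ht
    change C((iSup U : Opens X), A) at t
    refine ContinuousMap.ext (fun y => ?_)
    exact DFunLike.congr_fun (F := C(U (k y), A)) (ht (k y)) ⟨y.1, hk y⟩

/-- The sheaf of continuous functions on `X` with values in `A`. -/
def contSheaf (X : TopCat.{u}) (A : Type) [AddCommGroup A] [TopologicalSpace A]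
    [IsTopologicalAddGroup A] : TopCat.Sheaf AddCommGrpCat.{u} X :=
  ⟨contPresheaf X A, contPresheaf_isSheaf X A⟩

/-- The morphism of sheaves given by composition with a continuous homomorphism `A → B`. -/
def contSheafMap (X : TopCat.{u}) {A B : Type} [AddCommGroup A] [TopologicalSpace A]
    [IsTopologicalAddGroup A] [AddCommGroup B] [TopologicalSpace B]
    [IsTopologicalAddGroup B] (φ : A →ₜ+ B) : contSheaf X A ⟶ contSheaf X B :=
  ⟨{ app := fun U => AddCommGrpCat.ofHom
      { toFun := fun g : C(U.unop, A) => (φ : C(A, B)).comp g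
        map_zero' := ContinuousMap.ext fun _ => map_zero φ
        map_add' := fun _ _ => ContinuousMap.ext fun _ => map_add φ _ _ } }⟩

/-- The inclusion `ℤ → ℂ`. -/
noncomputable def intToComplex : ℤ →ₜ+ ℂ where
  toAddMonoidHom := Int.castAddHom ℂ
  continuous_toFun := continuous_of_discreteTopology

/-- The homomorphism `z ↦ exp (2πiz)` from `ℂ` to `ℂˣ`, the latter written additively. -/
noncomputable def expHom : ℂ →ₜ+ Additive ℂˣ where
  toFun z := Additive.ofMul
    (Units.mk0 (Complex.exp (2 * Real.pi * Complex.I * z)) (Complex.exp_ne_zero _))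
  map_zero' := by
    apply Additive.toMul.injective; ext; simp
  map_add' z w := by
    apply Additive.toMul.injective; ext; simp [mul_add, Complex.exp_add]
  continuous_toFun := by
    refine continuous_ofMul.comp ?_
    rw [Units.continuous_iff]
    refine ⟨?_, ?_⟩
    · simp [Function.comp_def]; fun_prop
    · simp [← Complex.exp_neg]; fun_prop


theorem expSeq_zero (X : TopCat.{u}) :
    contSheafMap X intToComplex ≫ contSheafMap X expHom = 0 := by
  apply ObjectProperty.hom_ext
  apply NatTrans.ext
  funext U
  apply AddCommGrpCat.hom_ext
  apply AddMonoidHom.ext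
  intro g
  refine ContinuousMap.ext fun x => ?_
  change C(U.unop, ℤ) at g
  change expHom (g x : ℂ) = 0
  apply Additive.toMul.injective
  ext
  change Complex.exp (2 * Real.pi * Complex.I * (g x : ℂ)) = 1
  rw [Complex.exp_eq_one_iff]
  exact ⟨g x, by ring⟩

/-- The exponential sequence `0 → ℤ → ℂ → ℂˣ → 0` of sheaves of continuous functions. -/
noncomputable def expSeq (X : TopCat.{u}) : ShortComplex (TopCat.Sheaf AddCommGrpCat.{u} X) where
  X₁ := contSheaf X ℤ
  X₂ := contSheaf X ℂ
  X₃ := contSheaf X (Additive ℂˣ)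
  f := contSheafMap X intToComplex
  g := contSheafMap X expHom
  zero := expSeq_zero X

theorem exists_int_lift {U : Type*} [TopologicalSpace U] (g : C(U, ℂ))
    (hg : ∀ x, expHom (g x) = 0) : ∃ n : C(U, ℤ), ∀ x, (n x : ℂ) = g x := by
  have h : ∀ x, ∃ n : ℤ, (n : ℂ) = g x := by
    intro x
    have h1 : Complex.exp (2 * Real.pi * Complex.I * g x) = 1 :=
      congrArg (fun a : Additive ℂˣ => ((Additive.toMul a : ℂˣ) : ℂ)) (hg x)
    obtain ⟨n, hn⟩ := Complex.exp_eq_one_iff.mp h1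
    refine ⟨n, ?_⟩
    have h2 : (2 * Real.pi * Complex.I : ℂ) ≠ 0 := Complex.two_pi_I_ne_zero
    apply mul_left_cancel₀ h2
    rw [hn]; ring
  choose n hn using h
  refine ⟨⟨n, ?_⟩, hn⟩
  have : Topology.IsClosedEmbedding (fun m : ℤ => (m : ℂ)) := Complex.isClosedEmbedding_intCast
  rw [this.isInducing.continuous_iff]
  exact g.continuous.congr fun x => (hn x).symm

theorem exists_local_log {U : Type*} [TopologicalSpace U] (g : C(U, Additive ℂˣ)) (x : U) :
    ∃ V : Set U, IsOpen V ∧ x ∈ V ∧ ∃ l : C(V, ℂ), ∀ y : V, expHom (l y) = g y := by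
  let c : U → ℂ := fun y => ((Additive.toMul (g y) : ℂˣ) : ℂ)
  have hc : Continuous c := Units.continuous_val.comp (continuous_toMul.comp g.continuous)
  have hc0 : ∀ y, c y ≠ 0 := fun y => Units.ne_zero _
  let V : Set U := {y | c y / c x ∈ Complex.slitPlane}
  have hcd : Continuous fun y => c y / c x := hc.div_const _
  refine ⟨V, Complex.isOpen_slitPlane.preimage hcd, ?_, ?_⟩
  · simp [V, hc0 x]
  · have h2 : (2 * Real.pi * Complex.I : ℂ) ≠ 0 := Complex.two_pi_I_ne_zero
    refine ⟨⟨fun y => (Complex.log (c y / c x) + Complex.log (c x)) / (2 * Real.pi * Complex.I),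
      ?_⟩, ?_⟩
    · refine Continuous.div_const (Continuous.add ?_ continuous_const) _
      exact Continuous.clog (hcd.comp continuous_subtype_val) (fun y => y.2)
    · intro y
      apply Additive.toMul.injective
      ext
      change Complex.exp (2 * Real.pi * Complex.I * ((Complex.log (c y / c x) +
        Complex.log (c x)) / (2 * Real.pi * Complex.I))) = c y
      rw [mul_div_cancel₀ _ h2, Complex.exp_add, Complex.exp_log, Complex.exp_log (hc0 x),
        div_mul_cancel₀ _ (hc0 x)]
      exact div_ne_zero (hc0 _) (hc0 x)

/-- The exponential sequence is exact. -/
theorem expSeq_shortExact (X : TopCat.{u}) : (expSeq X).ShortExact where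
  exact := by
    rw [TopCat.Sheaf.exact_iff_stalkFunctor_map_exact]
    intro x
    rw [ShortComplex.ab_exact_iff]
    intro t ht
    obtain ⟨U, hxU, s, rfl⟩ := TopCat.Presheaf.exists_germ_eq (contPresheaf X ℂ) t
    have h0 : (contPresheaf X (Additive ℂˣ)).germ U x hxU ((expSeq X).g.hom.app (op U) s) =
        (contPresheaf X (Additive ℂˣ)).germ U x hxU 0 := by
      refine Eq.trans (Eq.trans ?_ ht)
        (map_zero ((contPresheaf X (Additive ℂˣ)).germ U x hxU).hom).symm
      exact (TopCat.Presheaf.stalkFunctor_map_germ_apply U x hxU (expSeq X).g.hom s).symm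
    obtain ⟨W, hxW, i, j, hW⟩ := TopCat.Presheaf.germ_eq _ x hxU hxU _ _ h0
    change C(U, ℂ) at s
    obtain ⟨n, hn⟩ := exists_int_lift (s.comp ⟨Set.inclusion (leOfHom i), continuous_inclusion _⟩)
      (fun y => DFunLike.congr_fun (F := C(W, Additive ℂˣ)) hW y)
    refine ⟨(contPresheaf X ℤ).germ W x hxW n, ?_⟩
    refine (TopCat.Presheaf.stalkFunctor_map_germ_apply W x hxW (expSeq X).f.hom n).trans ?_
    have : (expSeq X).f.hom.app (op W) n = (contPresheaf X ℂ).map i.op s :=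
      ContinuousMap.ext hn
    rw [this]
    exact TopCat.Presheaf.germ_res_apply (contPresheaf X ℂ) i x hxW s
  mono_f := by
    have : Mono (expSeq X).f.hom := by
      have : ∀ U, Mono ((expSeq X).f.hom.app U) := by
        intro U
        rw [AddCommGrpCat.mono_iff_injective]
        intro a b hab
        change C(U.unop, ℤ) at a b
        refine ContinuousMap.ext fun x => ?_
        exact Int.cast_injective (α := ℂ) (DFunLike.congr_fun (F := C(U.unop, ℂ)) hab x)
      exact NatTrans.mono_of_mono_app _
    exact (TopCat.Sheaf.forget AddCommGrpCat X).mono_of_mono_map this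
  epi_g := by
    rw [← TopCat.Sheaf.isLocallySurjective_iff_epi, TopCat.Presheaf.isLocallySurjective_iff]
    intro U t x hx
    change C(U, Additive ℂˣ) at t
    obtain ⟨V, hV, hxV, l, hl⟩ := exists_local_log t ⟨x, hx⟩
    let W : Opens X := ⟨Subtype.val '' V, U.isOpen.isOpenMap_subtype_val _ hV⟩
    have hWU : W ≤ U := by rintro _ ⟨y, _, rfl⟩; exact y.2
    have hWV : ∀ y : W, (⟨y.1, hWU y.2⟩ : U) ∈ V := by
      rintro ⟨_, y, hy, rfl⟩; exact hy
    let l' : C(W, ℂ) := ⟨fun y => l ⟨⟨y.1, hWU y.2⟩, hWV y⟩, by fun_prop⟩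
    refine ⟨W, hWU, ⟨l', ?_⟩, ⟨_, hxV, rfl⟩⟩
    exact ContinuousMap.ext fun y => hl _

/-! ### Cartan-Eilenberg resolutions -/

/-- After applying `Φ`, the sequence `0 → K → I⁰ → I¹ → ⋯` is an injective resolution of `Φ K`:
the `Φ Iᵖ` are injective and `0 → Φ K → Φ I⁰ → Φ I¹ → ⋯` is exact. -/
def IsInjectiveResolutionUnder {C D : Type*} [Category C] [Category D] [Limits.HasZeroMorphisms C]
    [Limits.HasZeroMorphisms D] (Φ : C ⥤ D) {K : C} (I : CochainComplex C ℕ) (ι : K ⟶ I.X 0) :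
    Prop :=
  (∀ p, Injective (Φ.obj (I.X p))) ∧ Mono (Φ.map ι) ∧
  (∃ w : Φ.map ι ≫ Φ.map (I.d 0 1) = 0, (ShortComplex.mk _ _ w).Exact) ∧
  ∀ p, ∃ w : Φ.map (I.d p (p + 1)) ≫ Φ.map (I.d (p + 1) (p + 2)) = 0,
    (ShortComplex.mk _ _ w).Exact

/-- The functor `K ↦ (d : K^q → K^(q+1))`. -/
def differentialFunctor (C : Type*) [Category C] [Abelian C] (q : ℕ) :
    CochainComplex C ℕ ⥤ Arrow C where
  obj K := Arrow.mk (K.d q (q + 1))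
  map φ := Arrow.homMk (φ.f q) (φ.f (q + 1)) (φ.comm q (q + 1))

/-- The functor sending `K` to its coboundaries in degree `q + 1`, the image of
`d : K^q → K^(q+1)`. (In degree `0` the coboundaries vanish.) -/
noncomputable def boundariesFunctor (C : Type*) [Category C] [Abelian C] (q : ℕ) :
    CochainComplex C ℕ ⥤ C :=
  differentialFunctor C q ⋙ Limits.im

/-- A Cartan-Eilenberg resolution `0 → K → I^{0,*} → I^{1,*} → ⋯` of the complex `K = K^*`: a
sequence of complexes such that in each degree `q` the induced sequences of objects, of cocycles,
of coboundaries and of cohomology objects are injective resolutions. Here `(I.X p).X q` is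
`I^{p,q}`. -/
structure CartanEilenbergResolution {C : Type*} [Category C] [Abelian C]
    (K : CochainComplex C ℕ) where
  /-- the sequence of complexes `I^{0,*} → I^{1,*} → ⋯` -/
  I : CochainComplex (CochainComplex C ℕ) ℕ
  /-- the augmentation -/
  ι : K ⟶ I.X 0
  objects : ∀ q, IsInjectiveResolutionUnder (HomologicalComplex.eval C _ q) I ι
  cycles : ∀ q, IsInjectiveResolutionUnder (HomologicalComplex.cyclesFunctor C _ q) I ι
  boundaries : ∀ q, IsInjectiveResolutionUnder (boundariesFunctor C q) I ι
  homology : ∀ q, IsInjectiveResolutionUnder (HomologicalComplex.homologyFunctor C _ q) I ι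

/-! ### The single complex of a first-quadrant double complex -/

section Total

variable (R : CochainComplex (CochainComplex AddCommGrpCat.{u} ℕ) ℕ)

/-- Families `c = (c^{p,q})` with `c^{p,q}` in `R^{p,q} = (R.X p).X q`. The group of `n`-cochains
of the single complex, `⨁_{p+q=n} R^{p,q}`, is the subgroup `totalDegree R n` below. -/
abbrev Bigraded : Type u := ∀ p q : ℕ, (R.X p).X q

/-- The differential `D = d' + (-1)^p d''` of the single complex, where `d'` raises `p` and `d''`
raises `q`. For `p = 0` the first term is `R.d 0 0 = 0`, and for `q = 0` the second one is
`(R.X p).d 0 0 = 0`. -/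
def totalD : Bigraded R →+ Bigraded R where
  toFun c p q := (R.d (p - 1) p).f q (c (p - 1) q) + (-1 : ℤ) ^ p • (R.X p).d (q - 1) q (c p (q - 1))
  map_zero' := by
    funext p q
    simp
  map_add' a b := by
    funext p q
    simp only [Pi.add_apply, map_add, smul_add]
    abel

/-- The cochains of degree `n`: families supported on `p + q = n`. -/
def totalDegree (n : ℕ) : AddSubgroup (Bigraded R) where
  carrier := {c | ∀ p q, p + q ≠ n → c p q = 0}
  zero_mem' := fun _ _ _ => rfl
  add_mem' ha hb p q h := by simp [ha p q h, hb p q h]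
  neg_mem' ha p q h := by simp [ha p q h]

/-- The filtration by `p`-degree, `F^k = ⨁_{p ≥ k} R^{p,q}`. -/
def totalFiltration (k : ℕ) : AddSubgroup (Bigraded R) where
  carrier := {c | ∀ p q, p < k → c p q = 0}
  zero_mem' := fun _ _ _ => rfl
  add_mem' ha hb p q h := by simp [ha p q h, hb p q h]
  neg_mem' ha p q h := by simp [ha p q h]

/-- The coboundaries of degree `n`: the `D w` with `w` of degree `n - 1` (zero if `n = 0`). -/
def totalCoboundaries (n : ℕ) : AddSubgroup (Bigraded R) where
  carrier := {c | ∃ w : Bigraded R, (∀ p q, p + q + 1 ≠ n → w p q = 0) ∧ totalD R w = c}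
  zero_mem' := ⟨0, fun _ _ _ => rfl, map_zero _⟩
  add_mem' := by
    rintro _ _ ⟨v, hv, rfl⟩ ⟨w, hw, rfl⟩
    exact ⟨v + w, fun p q h => by simp [hv p q h, hw p q h], map_add _ _ _⟩
  neg_mem' := by
    rintro _ ⟨v, hv, rfl⟩
    exact ⟨-v, fun p q h => by simp [hv p q h], map_neg _ _⟩

theorem totalD_totalD (c : Bigraded R) : totalD R (totalD R c) = 0 := by
  have key : ∀ (i j k q) (x : (R.X i).X q), (R.d j k).f q ((R.d i j).f q x) = 0 := by
    intro i j k q x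
    rw [← ConcreteCategory.comp_apply, ← HomologicalComplex.comp_f, R.d_comp_d]; rfl
  have key2 : ∀ (p i j k) (x : (R.X p).X i), (R.X p).d j k ((R.X p).d i j x) = 0 := by
    intro p i j k x
    rw [← ConcreteCategory.comp_apply, HomologicalComplex.d_comp_d]; rfl
  have key3 : ∀ (p p' i j) (x : (R.X p).X i), (R.d p p').f j ((R.X p).d i j x) =
      (R.X p').d i j ((R.d p p').f i x) := by
    intro p p' i j x
    rw [← ConcreteCategory.comp_apply, ← ConcreteCategory.comp_apply, HomologicalComplex.Hom.comm]
  funext p q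
  change (R.d (p - 1) p).f q ((R.d (p - 1 - 1) (p - 1)).f q _ + (-1 : ℤ) ^ (p - 1) • _) +
    (-1 : ℤ) ^ p • (R.X p).d (q - 1) q ((R.d (p - 1) p).f (q - 1) _ + (-1 : ℤ) ^ p • _) = 0
  rcases p with _ | p
  · simp [key2]
  · simp only [map_add, map_zsmul, key, key2, key3, Nat.add_sub_cancel, pow_succ]
    simp

end Total

/-! ### Sheaf cohomology and the Leray filtration -/

instance pushforward_additive {X Y : TopCat.{u}} (f : X ⟶ Y) :
    (TopCat.Sheaf.pushforward AddCommGrpCat.{u} f).Additive where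
  map_add := rfl

/-- The functor `Γ(Y, -)`. -/
noncomputable def globalSections (Y : TopCat.{u}) :
    TopCat.Sheaf AddCommGrpCat.{u} Y ⥤ AddCommGrpCat.{u} :=
  TopCat.Sheaf.forget _ Y ⋙ (evaluation _ _).obj (op ⊤)

instance globalSections_additive (Y : TopCat.{u}) : (globalSections Y).Additive where
  map_add := rfl

/-- The constant sheaf with value `ℤ`. -/
noncomputable def constZ (X : TopCat.{u}) : TopCat.Sheaf AddCommGrpCat.{u} X :=
  (constantSheaf (Opens.grothendieckTopology X) AddCommGrpCat.{u}).obj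
    (AddCommGrpCat.of (ULift.{u} ℤ))

/-- The sheaf cohomology `H^n(X, A) = Ext^n(ℤ, A)`. This is `CategoryTheory.Sheaf.H`. -/
abbrev Cohomology {X : TopCat.{u}} (A : TopCat.Sheaf AddCommGrpCat.{u} X) (n : ℕ) : Type u :=
  Abelian.Ext.{u} (constZ X) A n
theorem cohomology_eq {X : TopCat.{u}} (A : TopCat.Sheaf AddCommGrpCat.{u} X) (n : ℕ) :
    Cohomology A n = CategoryTheory.Sheaf.H.{u} A n := rfl

/-- Auxiliary form of `homEquivSections`. -/
noncomputable def homEquivSectionsAux {X : TopCat.{u}}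
    (F : CategoryTheory.Sheaf (Opens.grothendieckTopology X) AddCommGrpCat.{u}) :
    ((constantSheaf (Opens.grothendieckTopology X) AddCommGrpCat.{u}).obj
      (AddCommGrpCat.of (ULift.{u} ℤ)) ⟶ F) ≃+ F.obj.obj (op ⊤) :=
  ((constantSheafAdj (Opens.grothendieckTopology X) AddCommGrpCat.{u}
    Limits.isTerminalTop).homAddEquiv _ F).trans (AddCommGrpCat.uliftZMultiplesAddEquiv _)

/-- Morphisms from the constant sheaf `ℤ` to `F` are the global sections of `F`. -/
noncomputable def homEquivSections {X : TopCat.{u}} (F : TopCat.Sheaf AddCommGrpCat.{u} X) :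
    (constZ X ⟶ F) ≃+ (globalSections X).obj F :=
  homEquivSectionsAux F

/-- The identification `Γ(X, F) = Γ(Y, f_* F)`. -/
noncomputable def sectionsPushforward {X Y : TopCat.{u}} (f : X ⟶ Y)
    (F : TopCat.Sheaf AddCommGrpCat.{u} X) :
    (globalSections X).obj F →+
      (globalSections Y).obj ((TopCat.Sheaf.pushforward AddCommGrpCat.{u} f).obj F) :=
  AddMonoidHom.id ((globalSections X).obj F)

/-- The choices from which the Leray spectral sequence of `A` is built: an injective resolution
`M^*` of `A` and a Cartan-Eilenberg resolution of the complex `f_* M^*`. -/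
structure LerayResolution {X Y : TopCat.{u}} (f : X ⟶ Y) (A : TopCat.Sheaf AddCommGrpCat.{u} X)
    where
  /-- an injective resolution of `A` -/
  M : InjectiveResolution A
  /-- a Cartan-Eilenberg resolution of its push-forward -/
  CE : CartanEilenbergResolution
    (((TopCat.Sheaf.pushforward AddCommGrpCat.{u} f).mapHomologicalComplex _).obj M.cocomplex)

namespace LerayResolution

variable {X Y : TopCat.{u}} {f : X ⟶ Y} {A : TopCat.Sheaf AddCommGrpCat.{u} X}
  (L : LerayResolution f A)

/-- The double complex `R^{p,q} = Γ(Y, I^{p,q})`. -/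
noncomputable def doubleComplex : CochainComplex (CochainComplex AddCommGrpCat.{u} ℕ) ℕ :=
  (((globalSections Y).mapHomologicalComplex _).mapHomologicalComplex _).obj L.CE.I

/-- The map `Γ(X, M^n) = Γ(Y, f_* M^n) → Γ(Y, I^{0,n})` into the single complex of `R^{*,*}`.
These maps induce the isomorphism of `H^n(X, A)` with the cohomology of the single complex. -/
noncomputable def augmentation (n : ℕ) :
    (globalSections X).obj (L.M.cocomplex.X n) →+ Bigraded L.doubleComplex :=
  (AddMonoidHom.single (fun p => ∀ q, (L.doubleComplex.X p).X q) 0).comp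
    ((AddMonoidHom.single (fun q => (L.doubleComplex.X 0).X q) n).comp
      (AddMonoidHom.comp ((globalSections Y).map (L.CE.ι.f n)).hom
        (sectionsPushforward f (L.M.cocomplex.X n))))

/-- The Leray filtration `F^{p,n}(A) ⊆ H^n(X, A)`: the classes whose image in the cohomology of the
single complex `R^*` lies in the image of `H^n(F^p R^*)`. In detail, a class `x` represented by a
cocycle `φ` in `Γ(X, M^n)` belongs to it if the image of `φ` in `R^n` is cohomologous to a
cocycle `z` in `F^p R^n`. -/
def filtration (p n : ℕ) : AddSubgroup (Cohomology A n) where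
  carrier := {x | ∃ (φ : constZ X ⟶ L.M.cocomplex.X n)
    (hφ : φ ≫ L.M.cocomplex.d n (n + 1) = 0) (z : Bigraded L.doubleComplex),
    L.M.extMk φ (n + 1) rfl hφ = x ∧
    z ∈ totalDegree L.doubleComplex n ∧ z ∈ totalFiltration L.doubleComplex p ∧
    totalD L.doubleComplex z = 0 ∧
    z - L.augmentation n (homEquivSections _ φ) ∈ totalCoboundaries L.doubleComplex n}
  zero_mem' := ⟨0, by simp, 0, by simp, zero_mem _, zero_mem _, map_zero _, by
    simp only [map_zero, sub_zero]; exact zero_mem _⟩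
  add_mem' := by
    rintro _ _ ⟨φ, hφ, z, rfl, h1, h2, h3, h4⟩ ⟨φ', hφ', z', rfl, h1', h2', h3', h4'⟩
    refine ⟨φ + φ', by simp [hφ, hφ'], z + z', (L.M.add_extMk ..).symm, add_mem h1 h1',
      add_mem h2 h2', by rw [map_add, h3, h3', add_zero], ?_⟩
    rw [map_add, map_add, add_sub_add_comm]
    exact add_mem h4 h4'
  neg_mem' := by
    rintro _ ⟨φ, hφ, z, rfl, h1, h2, h3, h4⟩
    refine ⟨-φ, by simp [hφ], -z, (L.M.neg_extMk ..).symm, neg_mem h1, neg_mem h2,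
      by rw [map_neg, h3, neg_zero], ?_⟩
    rw [map_neg, map_neg, ← neg_sub']
    exact neg_mem h4

theorem filtration_succ_le (p n : ℕ) : L.filtration (p + 1) n ≤ L.filtration p n := by
  rintro x ⟨φ, hφ, z, h1, h2, h3, h4⟩
  exact ⟨φ, hφ, z, h1, h2, fun a b hab => h3 a b (Nat.lt_succ_of_lt hab), h4⟩

/-- The term `E_∞^{p,q}(A)` of the Leray spectral sequence, as the graded piece
`F^{p,p+q}(A) / F^{p+1,p+q}(A)`. -/
abbrev EInfty (p q : ℕ) : Type u :=
  L.filtration p (p + q) ⧸ (L.filtration (p + 1) (p + q)).addSubgroupOf (L.filtration p (p + q))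

end LerayResolution

/-- The coboundary `δ : H^n(X, ℂˣ) → H^{n+1}(X, ℤ)` of the exponential sequence: the product with
its extension class. -/
noncomputable def expCoboundary (X : TopCat.{u}) (n : ℕ) :
    Cohomology (contSheaf X (Additive ℂˣ)) n →+ Cohomology (contSheaf X ℤ) (n + 1) :=
  (expSeq_shortExact X).extClass.postcomp (constZ X) rfl

/-- The restriction `F → F'` of a homomorphism `δ` with `δ(F) ⊆ F'`. -/
def restrictHom {H H' : Type*} [AddCommGroup H] [AddCommGroup H'] (δ : H →+ H')
    {F : AddSubgroup H} {F' : AddSubgroup H'} (h : F ≤ F'.comap δ) : F →+ F' :=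
  (δ.comp F.subtype).codRestrict F' fun x => h x.2

/-- The map `F / F₁ → F' / F₁'` of quotients induced by a homomorphism `δ` with `δ(F) ⊆ F'` and
`δ(F₁) ⊆ F₁'`. -/
def quotientHom {H H' : Type*} [AddCommGroup H] [AddCommGroup H'] (δ : H →+ H')
    {F F₁ : AddSubgroup H} {F' F₁' : AddSubgroup H'} (h : F ≤ F'.comap δ)
    (h₁ : F₁ ≤ F₁'.comap δ) : F ⧸ F₁.addSubgroupOf F →+ F' ⧸ F₁'.addSubgroupOf F' :=
  QuotientAddGroup.map _ _ (restrictHom δ h) fun _ hx => h₁ hx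

section EInftyMap

variable {X Y : TopCat.{u}} {f : X ⟶ Y} (K : LerayResolution f (contSheaf X (Additive ℂˣ)))
  (L : LerayResolution f (contSheaf X ℤ))

/-- The coboundary of the exponential sequence maps `F^{p,n}(ℂˣ)` into `F^{p,n+1}(ℤ)` for all `p`
and `n`. -/
def CoboundaryPreservesFiltration : Prop :=
  ∀ p n : ℕ, K.filtration p n ≤ (L.filtration p (n + 1)).comap (expCoboundary X n)

variable {K L}

/-- The restriction `F^{p,n}(ℂˣ) → F^{p,n+1}(ℤ)` of the coboundary. -/
noncomputable def filtrationCoboundary (h : CoboundaryPreservesFiltration K L) (p n : ℕ) :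
    K.filtration p n →+ L.filtration p (n + 1) :=
  restrictHom (expCoboundary X n) (h p n)

/-- The map `E_∞^{p,q}(ℂˣ) → E_∞^{p,q+1}(ℤ)` induced by the coboundary. -/
noncomputable def eInftyCoboundary (h : CoboundaryPreservesFiltration K L) (p q : ℕ) :
    K.EInfty p q →+ L.EInfty p (q + 1) :=
  quotientHom (expCoboundary X (p + q)) (h p (p + q)) (h (p + 1) (p + q))

end EInftyMap

end Leray

/-! Let `M`, `J`, `N` be injective resolutions of ℤ, ℂ, ℂˣ on X. The key is a description of the
Leray filtration that does not mention the Cartan–Eilenberg resolution: a class in H^n(X, A), seen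
as a morphism ℤ → Rf_*A[n] in the derived category of Y, lies in F^k with k ≤ n if and only if it
factors through an object of the t-structure part ≤ n-k mapping to Rf_*A
(`MemFiltration.exists_factor`, `memFiltration_of_factor`). Indeed, truncating each complex I^{p,*}
canonically at m = n-k gives an injective resolution of τ_{≤m} f_*M^*, because a Cartan–Eilenberg
resolution also resolves the cocycles. A total cocycle of degree n in F^k lives in rows q ≤ m, and
its entry in row m is a d''-cocycle, so it lies in the truncated single complex. Conversely,
everything of degree n there has p ≥ k.

The exponential sequence gives a distinguished triangle M → J → N → M[1] already in the homotopy
category (`exists_resolution_triangle`), so f_* may be applied to it, and δ becomes composition with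
f_*N → f_*M[1]. If a class factors through A ≤ n-k, its image under δ factors through A[-1] ≤
(n+1)-k; hence δ preserves the filtration (for k > n the class is zero).

For the converse, ℂ is acyclic on every open subset of X, since open subspaces are paracompact
Hausdorff and partitions of unity split continuous cocycles. Thus f_*J is concentrated in degree 0
and Hom(ℤ, f_*J[n]) = 0 for n ≥ 1. If δx factors through L[n+1] with L ≤ m+1, then x factors through
P[n], with P the cone of L → f_*M → f_*J; and P ≤ m because both L[1] and f_*J are
(`exists_factor_of_comp_factor`). So for n ≥ 1 and p ≤ n, δx in F^p forces x in F^p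
(`mem_of_expCoboundary_mem`).

Vanishing of H^n(X, ℂ) for n ≥ 1 makes δ surjective in all degrees and injective for n ≥ 1; with
strictness this gives both statements. Injectivity on E_∞ uses strictness for F^{p+1} in degree p+q,
whence q ≥ 1. -/

namespace Leray

/-! ### The single complex of a double complex, handled through families of morphisms -/

section TotalComplex

open Limits

universe v w

variable {C : Type w} [Category.{v} C] [Abelian C]

/-- Families of morphisms `c p q : A ⟶ I^{p,q}`. -/
abbrev Family (I : CochainComplex (CochainComplex C ℕ) ℕ) (A : C) : Type v :=
  ∀ p q : ℕ, A ⟶ (I.X p).X q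

namespace Family

variable {I J : CochainComplex (CochainComplex C ℕ) ℕ} {A B : C}

/-- The family `c` is concentrated in total degree `n`. -/
def HasDegree (c : Family I A) (n : ℕ) : Prop := ∀ p q, p + q ≠ n → c p q = 0

/-- The differential of the single complex, on families. -/
def D (c : Family I A) : Family I A := fun p q =>
  c (p - 1) q ≫ (I.d (p - 1) p).f q + (-1 : ℤ) ^ p • (c p (q - 1) ≫ (I.X p).d (q - 1) q)

/-- Precomposition with a morphism. -/
def precomp (g : B ⟶ A) (c : Family I A) : Family I B := fun p q => g ≫ c p q

/-- Postcomposition with a morphism of double complexes. -/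
def postcomp (c : Family I A) (φ : I ⟶ J) : Family J A := fun p q => c p q ≫ (φ.f p).f q

@[simp] lemma precomp_apply (g : B ⟶ A) (c : Family I A) (p q : ℕ) :
    precomp g c p q = g ≫ c p q := rfl

@[simp] lemma postcomp_apply (c : Family I A) (φ : I ⟶ J) (p q : ℕ) :
    postcomp c φ p q = c p q ≫ (φ.f p).f q := rfl

lemma D_apply (c : Family I A) (p q : ℕ) : D c p q =
    c (p - 1) q ≫ (I.d (p - 1) p).f q + (-1 : ℤ) ^ p • (c p (q - 1) ≫ (I.X p).d (q - 1) q) := rfl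

lemma D_zero : D (0 : Family I A) = 0 := by
  funext p q; simp [D_apply]

lemma D_add (c c' : Family I A) : D (c + c') = D c + D c' := by
  funext p q
  simp only [D_apply, Pi.add_apply, Preadditive.add_comp, smul_add]
  abel

lemma D_sub (c c' : Family I A) : D (c - c') = D c - D c' := by
  funext p q
  simp only [D_apply, Pi.sub_apply, Preadditive.sub_comp, smul_sub]
  abel

lemma D_precomp (g : B ⟶ A) (c : Family I A) : D (precomp g c) = precomp g (D c) := by
  funext p q
  simp [D_apply]

lemma D_postcomp (c : Family I A) (φ : I ⟶ J) : D (postcomp c φ) = postcomp (D c) φ := by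
  funext p q
  have h := congr_arg (fun ψ => HomologicalComplex.Hom.f ψ q) (φ.comm (p - 1) p)
  dsimp at h
  simp only [D_apply, postcomp_apply, Category.assoc, Preadditive.add_comp, h,
    HomologicalComplex.Hom.comm, Preadditive.zsmul_comp]

lemma D_D (c : Family I A) : D (D c) = 0 := by
  have key : ∀ i j k q, (I.d i j).f q ≫ (I.d j k).f q = 0 := by
    intro i j k q
    rw [← HomologicalComplex.comp_f, I.d_comp_d]; rfl
  funext p q
  change D (D c) p q = 0
  rcases p with _ | p
  · simp [D_apply]
  · rw [D_apply, D_apply, D_apply]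
    simp only [Nat.add_sub_cancel, pow_succ, Preadditive.add_comp, Category.assoc, key, comp_zero,
      Preadditive.zsmul_comp, HomologicalComplex.d_comp_d, HomologicalComplex.Hom.comm]
    simp

lemma HasDegree.D {c : Family I A} {n : ℕ} (hc : c.HasDegree n) : c.D.HasDegree (n + 1) := by
  intro p q h
  rw [D_apply]
  -- For p = 0 truncated subtraction makes the differential `I.d 0 0`, which is zero; likewise in
  -- the other direction for q = 0.
  have h1 : c (p - 1) q ≫ (I.d (p - 1) p).f q = 0 := by
    rcases p with _ | p
    · simp
    · rw [hc _ _ (by simp; lia), zero_comp]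
  have h2 : c p (q - 1) ≫ (I.X p).d (q - 1) q = 0 := by
    rcases q with _ | q
    · simp
    · rw [hc _ _ (by simp; lia), zero_comp]
  rw [h1, h2, smul_zero, add_zero]

lemma HasDegree.precomp {c : Family I A} {n : ℕ} (hc : c.HasDegree n) (g : B ⟶ A) :
    (precomp g c).HasDegree n := fun p q h => by simp [hc p q h]

lemma HasDegree.postcomp {c : Family I A} {n : ℕ} (hc : c.HasDegree n) (φ : I ⟶ J) :
    (postcomp c φ).HasDegree n := fun p q h => by simp [hc p q h]

lemma HasDegree.sub {c c' : Family I A} {n : ℕ} (hc : c.HasDegree n) (hc' : c'.HasDegree n) :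
    (c - c').HasDegree n := fun p q h => by simp [hc p q h, hc' p q h]

/-- The family with a single nonzero entry. -/
def single (i j : ℕ) (x : A ⟶ (I.X i).X j) : Family I A :=
  fun p q => if h : i = p ∧ j = q then
    x ≫ eqToHom (by rw [h.1, h.2]) else 0

lemma single_self (i j : ℕ) (x : A ⟶ (I.X i).X j) : single i j x i j = x := by
  simp [single]

lemma single_of_ne {i j : ℕ} (x : A ⟶ (I.X i).X j) {p q : ℕ} (h : ¬ (i = p ∧ j = q)) :
    single i j x p q = 0 := by
  simp [single, h]

lemma hasDegree_single (i j : ℕ) (x : A ⟶ (I.X i).X j) : (single i j x).HasDegree (i + j) :=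
  fun p q h => single_of_ne x (by lia)

lemma ext_single {c : Family I A} {i j : ℕ} {x : A ⟶ (I.X i).X j} (h : c i j = x)
    (h' : ∀ p q, ¬ (i = p ∧ j = q) → c p q = 0) : c = single i j x := by
  funext p q
  by_cases hpq : i = p ∧ j = q
  · obtain ⟨rfl, rfl⟩ := hpq
    rw [single_self, h]
  · rw [single_of_ne x hpq, h' p q hpq]

lemma precomp_single (g : B ⟶ A) (i j : ℕ) (x : A ⟶ (I.X i).X j) :
    precomp g (single i j x) = single i j (g ≫ x) := by
  apply ext_single
  · simp [single_self]
  · intro p q h; simp [single_of_ne x h]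

end Family

open Family

variable (I : CochainComplex (CochainComplex C ℕ) ℕ) {A B : C}

/-- The object of degree `n` of the single complex. -/
noncomputable def totalX (n : ℕ) : C :=
  ∏ᶜ fun i : Finset.HasAntidiagonal.antidiagonal n => (I.X i.1.1).X i.1.2

instance (n : ℕ) [∀ p q, Injective ((I.X p).X q)] : Injective (totalX I n) := by
  dsimp only [totalX]; infer_instance

variable {I}

/-- The morphism to the single complex given by a family. -/
noncomputable def toTotalX (n : ℕ) (c : Family I A) : A ⟶ totalX I n :=
  Pi.lift fun i => c i.1.1 i.1.2

/-- The projection of the single complex to a summand. -/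
noncomputable def totalProj {n p q : ℕ} (h : p + q = n) : totalX I n ⟶ (I.X p).X q :=
  Pi.π (fun i : Finset.HasAntidiagonal.antidiagonal n => (I.X i.1.1).X i.1.2)
    ⟨(p, q), by simpa using h⟩

lemma toTotalX_proj {n p q : ℕ} (h : p + q = n) (c : Family I A) :
    toTotalX n c ≫ totalProj h = c p q := by
  dsimp only [toTotalX, totalProj, totalX]
  exact Pi.lift_π _ _

/-- The family given by a morphism to the single complex. -/
noncomputable def ofTotalX {n : ℕ} (g : A ⟶ totalX I n) : Family I A := fun p q =>
  if h : p + q = n then g ≫ totalProj h else 0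

lemma hasDegree_ofTotalX {n : ℕ} (g : A ⟶ totalX I n) : (ofTotalX g).HasDegree n :=
  fun p q h => by simp [ofTotalX, h]

lemma ofTotalX_toTotalX {n : ℕ} {c : Family I A} (hc : c.HasDegree n) :
    ofTotalX (toTotalX n c) = c := by
  funext p q
  by_cases h : p + q = n
  · simp [ofTotalX, toTotalX_proj, h]
  · rw [hasDegree_ofTotalX _ p q h, hc p q h]

/-- Together with `ofTotalX_toTotalX` this identifies morphisms into the single complex with
families of the right degree, so that identities of such morphisms can be checked entrywise. -/
lemma ofTotalX_injective {n : ℕ} {g g' : A ⟶ totalX I n} (h : ofTotalX g = ofTotalX g') :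
    g = g' := by
  apply Limits.Pi.hom_ext
  rintro ⟨⟨p, q⟩, hpq⟩
  have := congr_fun (congr_fun h p) q
  have hpq' : p + q = n := by simpa using hpq
  simp only [ofTotalX, hpq', ↓reduceDIte] at this
  exact this

lemma ofTotalX_comp {n : ℕ} (f : B ⟶ A) (g : A ⟶ totalX I n) :
    ofTotalX (f ≫ g) = precomp f (ofTotalX g) := by
  funext p q
  by_cases h : p + q = n <;> simp [ofTotalX, h]

lemma ofTotalX_zero {n : ℕ} : ofTotalX (0 : A ⟶ totalX I n) = 0 := by
  funext p q
  by_cases h : p + q = n <;> simp [ofTotalX, h]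

lemma ofTotalX_add {n : ℕ} (g g' : A ⟶ totalX I n) :
    ofTotalX (g + g') = ofTotalX g + ofTotalX g' := by
  funext p q
  by_cases h : p + q = n <;> simp [ofTotalX, h]

lemma ofTotalX_sub {n : ℕ} (g g' : A ⟶ totalX I n) :
    ofTotalX (g - g') = ofTotalX g - ofTotalX g' := by
  funext p q
  by_cases h : p + q = n <;> simp [ofTotalX, h]

variable (I) in
/-- The differential of the single complex. -/
noncomputable def totalXd (n : ℕ) : totalX I n ⟶ totalX I (n + 1) :=
  toTotalX (n + 1) (ofTotalX (𝟙 (totalX I n))).D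

/-- The differential is `D` of the universal family `ofTotalX (𝟙 _)`, and `D` commutes with
precomposition; so the formula passes from the universal family to all others. -/
lemma ofTotalX_totalXd {n : ℕ} (g : A ⟶ totalX I n) :
    ofTotalX (g ≫ totalXd I n) = (ofTotalX g).D := by
  rw [ofTotalX_comp, totalXd, ofTotalX_toTotalX (hasDegree_ofTotalX _).D, ← D_precomp,
    ← ofTotalX_comp, Category.comp_id]

variable (I) in
/-- The single complex of a double complex. -/
noncomputable def total : CochainComplex C ℕ :=
  CochainComplex.of (totalX I) (totalXd I) fun n => by
    apply ofTotalX_injective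
    rw [ofTotalX_totalXd, ← Category.id_comp (totalXd I n), ofTotalX_totalXd, D_D, ofTotalX_zero]

lemma total_d (n : ℕ) : (total I).d n (n + 1) = totalXd I n :=
  CochainComplex.of_d _ _ _

instance (n : ℕ) [∀ p q, Injective ((I.X p).X q)] : Injective ((total I).X n) :=
  inferInstanceAs (Injective (totalX I n))

/-- The morphism to the single complex given by a family. -/
noncomputable def toTotal (n : ℕ) (c : Family I A) : A ⟶ (total I).X n := toTotalX n c

/-- The family given by a morphism to the single complex. -/
noncomputable def ofTotal {n : ℕ} (g : A ⟶ (total I).X n) : Family I A :=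
  ofTotalX (n := n) g

lemma hasDegree_ofTotal {n : ℕ} (g : A ⟶ (total I).X n) : (ofTotal g).HasDegree n :=
  hasDegree_ofTotalX _

lemma ofTotal_toTotal {n : ℕ} {c : Family I A} (hc : c.HasDegree n) :
    ofTotal (toTotal n c) = c :=
  ofTotalX_toTotalX hc

lemma ofTotal_injective {n : ℕ} {g g' : A ⟶ (total I).X n} (h : ofTotal g = ofTotal g') :
    g = g' :=
  ofTotalX_injective (n := n) h

lemma ofTotal_comp {n : ℕ} (f : B ⟶ A) (g : A ⟶ (total I).X n) :
    ofTotal (f ≫ g) = precomp f (ofTotal g) :=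
  ofTotalX_comp (n := n) f g

lemma ofTotal_zero {n : ℕ} : ofTotal (0 : A ⟶ (total I).X n) = 0 :=
  ofTotalX_zero (n := n)

lemma ofTotal_add {n : ℕ} (g g' : A ⟶ (total I).X n) :
    ofTotal (g + g') = ofTotal g + ofTotal g' :=
  ofTotalX_add (n := n) g g'

lemma ofTotal_sub {n : ℕ} (g g' : A ⟶ (total I).X n) :
    ofTotal (g - g') = ofTotal g - ofTotal g' :=
  ofTotalX_sub (n := n) g g'

lemma ofTotal_d {n : ℕ} (g : A ⟶ (total I).X n) :
    ofTotal (g ≫ (total I).d n (n + 1)) = (ofTotal g).D := by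
  rw [total_d]
  exact ofTotalX_totalXd (n := n) g

lemma toTotalX_postcomp_comm {J : CochainComplex (CochainComplex C ℕ) ℕ} (φ : I ⟶ J) (n : ℕ) :
    toTotalX n ((ofTotalX (𝟙 (totalX I n))).postcomp φ) ≫ totalXd J n =
      totalXd I n ≫ toTotalX (n + 1) ((ofTotalX (𝟙 (totalX I (n + 1)))).postcomp φ) := by
  apply ofTotalX_injective
  rw [ofTotalX_totalXd, ofTotalX_toTotalX ((hasDegree_ofTotalX _).postcomp _), ofTotalX_comp,
    ofTotalX_toTotalX ((hasDegree_ofTotalX _).postcomp _), D_postcomp]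
  funext p q
  rw [← ofTotalX_totalXd, Category.id_comp]
  simp only [precomp_apply, postcomp_apply, ← Category.assoc]
  rw [← precomp_apply, ← ofTotalX_comp, Category.comp_id]

/-- The functoriality of the single complex. -/
noncomputable def totalMap {J : CochainComplex (CochainComplex C ℕ) ℕ} (φ : I ⟶ J) :
    total I ⟶ total J :=
  CochainComplex.ofHom (fun n => toTotalX n ((ofTotalX (𝟙 (totalX I n))).postcomp φ))
    fun n => by
      rw [total_d, total_d]
      exact toTotalX_postcomp_comm φ n

lemma ofTotalX_comp_postcomp {J : CochainComplex (CochainComplex C ℕ) ℕ} (φ : I ⟶ J) {n : ℕ}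
    (g : A ⟶ totalX I n) :
    ofTotalX (g ≫ toTotalX n ((ofTotalX (𝟙 (totalX I n))).postcomp φ)) =
      (ofTotalX g).postcomp φ := by
  rw [ofTotalX_comp, ofTotalX_toTotalX ((hasDegree_ofTotalX _).postcomp _)]
  funext p q
  simp only [precomp_apply, postcomp_apply, ← Category.assoc]
  rw [← precomp_apply, ← ofTotalX_comp, Category.comp_id]

lemma ofTotal_totalMap {J : CochainComplex (CochainComplex C ℕ) ℕ} (φ : I ⟶ J) {n : ℕ}
    (g : A ⟶ (total I).X n) :
    ofTotal (g ≫ (totalMap φ).f n) = (ofTotal g).postcomp φ :=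
  ofTotalX_comp_postcomp (n := n) φ g

section Augmentation

variable {K : CochainComplex C ℕ} (ι : K ⟶ I.X 0)

/-- The family attached to a morphism to the augmenting complex. -/
def augmentFamily {n : ℕ} (x : A ⟶ K.X n) : Family I A := single 0 n (x ≫ ι.f n)

lemma hasDegree_augmentFamily {n : ℕ} (x : A ⟶ K.X n) : (augmentFamily ι x).HasDegree n := by
  have := hasDegree_single (I := I) 0 n (x ≫ ι.f n)
  rwa [zero_add] at this

lemma precomp_augmentFamily {n : ℕ} (g : B ⟶ A) (x : A ⟶ K.X n) :
    precomp g (augmentFamily ι x) = augmentFamily ι (g ≫ x) := by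
  simp [augmentFamily, precomp_single]

variable {ι} in
-- A family at (0, n) has differential at (0, n+1), with sign (-1)^0 = 1, and at (1, n), where `hι`
-- kills it.
lemma D_augmentFamily (hι : ι ≫ I.d 0 1 = 0) {n : ℕ} (x : A ⟶ K.X n) :
    (augmentFamily ι x).D = augmentFamily ι (x ≫ K.d n (n + 1)) := by
  apply ext_single
  · rw [D_apply]
    simp [augmentFamily, single_self]
  · intro p q h
    by_cases hp : p = 1 ∧ q = n
    · obtain ⟨rfl, rfl⟩ := hp
      have := congr_arg (fun ψ => HomologicalComplex.Hom.f ψ q) hι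
      dsimp at this
      rw [D_apply]
      simp only [augmentFamily, single_self, Category.assoc, this, comp_zero]
      rw [single_of_ne _ (by lia)]
      simp
    · rw [D_apply]
      have h1 : augmentFamily ι x (p - 1) q ≫ (I.d (p - 1) p).f q = 0 := by
        rcases p with _ | p
        · simp
        · rw [augmentFamily, single_of_ne _ (by simp; lia), zero_comp]
      have h2 : augmentFamily ι x p (q - 1) ≫ (I.X p).d (q - 1) q = 0 := by
        rcases q with _ | q
        · simp
        · rw [augmentFamily, single_of_ne _ (by simp; lia), zero_comp]
      rw [h1, h2, smul_zero, add_zero]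

variable {ι} in
lemma toTotalX_augmentFamily_comm (hι : ι ≫ I.d 0 1 = 0) (n : ℕ) :
    toTotalX n (augmentFamily ι (𝟙 (K.X n))) ≫ totalXd I n =
      K.d n (n + 1) ≫ toTotalX (n + 1) (augmentFamily ι (𝟙 (K.X (n + 1)))) := by
  apply ofTotalX_injective
  rw [ofTotalX_totalXd, ofTotalX_comp, ofTotalX_toTotalX (hasDegree_augmentFamily _ _),
    ofTotalX_toTotalX (hasDegree_augmentFamily _ _), precomp_augmentFamily,
    D_augmentFamily hι, Category.id_comp, Category.comp_id]

variable {ι} in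
/-- The augmentation of the single complex. -/
noncomputable def totalAugment (hι : ι ≫ I.d 0 1 = 0) : K ⟶ total I where
  f n := toTotalX n (augmentFamily ι (𝟙 (K.X n)))
  comm' n m h := by
    obtain rfl : n + 1 = m := h
    rw [total_d]
    exact toTotalX_augmentFamily_comm hι n

lemma ofTotalX_comp_augmentFamily {n : ℕ} (x : A ⟶ K.X n) :
    ofTotalX (x ≫ toTotalX n (augmentFamily ι (𝟙 (K.X n)))) = augmentFamily ι x := by
  rw [ofTotalX_comp, ofTotalX_toTotalX (hasDegree_augmentFamily _ _), precomp_augmentFamily,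
    Category.comp_id]

variable {ι} in
lemma ofTotal_totalAugment (hι : ι ≫ I.d 0 1 = 0) {n : ℕ} (x : A ⟶ K.X n) :
    ofTotal (x ≫ (totalAugment hι).f n) = augmentFamily ι x :=
  ofTotalX_comp_augmentFamily ι x

end Augmentation

end TotalComplex

/-! ### A row-exact augmented double complex has single complex quasi-isomorphic to K -/

section TotalQuasiIso

open Limits Family

universe v w

variable {C : Type w} [Category.{v} C] [Abelian C]
  {I : CochainComplex (CochainComplex C ℕ) ℕ} {A : C}

/-- The vertical part of the differential lands in row j+1. A correction supported at (i, j)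
therefore leaves the rows below j alone and changes row j only at (i+1, j). -/
lemma Family.D_single_of_le {i j : ℕ} (x : A ⟶ (I.X i).X j) {p q : ℕ} (hq : q ≤ j)
    (h : ¬ (i + 1 = p ∧ j = q)) : (single i j x).D p q = 0 := by
  rw [D_apply]
  have h1 : single i j x (p - 1) q ≫ (I.d (p - 1) p).f q = 0 := by
    rcases p with _ | p
    · simp
    · rw [single_of_ne _ (by simp; lia), zero_comp]
  have h2 : single i j x p (q - 1) ≫ (I.X p).d (q - 1) q = 0 := by
    rcases q with _ | q
    · simp
    · rw [single_of_ne _ (by simp; lia), zero_comp]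
  rw [h1, h2, smul_zero, add_zero]

lemma Family.D_single_self (i j : ℕ) (x : A ⟶ (I.X i).X j) :
    (single i j x).D (i + 1) j = x ≫ (I.d i (i + 1)).f j := by
  rw [D_apply, single_of_ne x (p := i + 1) (by lia)]
  simp [single_self]

/-- The family `c` is concentrated in total degree `n - 1`. -/
def Family.HasPredDegree (c : Family I A) (n : ℕ) : Prop := ∀ p q, p + q + 1 ≠ n → c p q = 0

lemma Family.HasPredDegree.hasDegree {c : Family I A} {n : ℕ} (hc : c.HasPredDegree (n + 1)) :
    c.HasDegree n := fun p q h => hc p q (by lia)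

lemma Family.HasPredDegree.eq_zero {c : Family I A} (hc : c.HasPredDegree 0) : c = 0 := by
  funext p q; exact hc p q (by lia)

lemma Family.HasPredDegree.D {c : Family I A} {n : ℕ} (hc : c.HasPredDegree n) :
    c.D.HasDegree n := by
  rcases n with _ | n
  · rw [hc.eq_zero, D_zero]; exact fun _ _ _ => rfl
  · exact hc.hasDegree.D

/-- The data of an augmented double complex which is exact in the first direction. -/
structure RowExact {K : CochainComplex C ℕ} (ι : K ⟶ I.X 0) : Prop where
  zero : ι ≫ I.d 0 1 = 0
  mono : ∀ q, Mono (ι.f q)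
  exact₀ : ∀ q ⦃B : C⦄ (y : B ⟶ (I.X 0).X q), y ≫ (I.d 0 1).f q = 0 →
    ∃ (B' : C) (π : B' ⟶ B) (_ : Epi π) (x : B' ⟶ K.X q), π ≫ y = x ≫ ι.f q
  exact : ∀ p q ⦃B : C⦄ (y : B ⟶ (I.X (p + 1)).X q), y ≫ (I.d (p + 1) (p + 2)).f q = 0 →
    ∃ (B' : C) (π : B' ⟶ B) (_ : Epi π) (x : B' ⟶ (I.X p).X q),
      π ≫ y = x ≫ (I.d p (p + 1)).f q

variable {K : CochainComplex C ℕ} {ι : K ⟶ I.X 0}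

lemma rowExact_of_isInjectiveResolutionUnder
    (h : ∀ q, IsInjectiveResolutionUnder (HomologicalComplex.eval C _ q) I ι) : RowExact ι where
  zero := by
    ext q
    exact (h q).2.2.1.choose
  mono q := (h q).2.1
  exact₀ q B y hy := by
    obtain ⟨w, hw⟩ := (h q).2.2.1
    exact (ShortComplex.exact_iff_exact_up_to_refinements _).1 hw y hy
  exact p q B y hy := by
    obtain ⟨w, hw⟩ := (h q).2.2.2 p
    exact (ShortComplex.exact_iff_exact_up_to_refinements _).1 hw y hy

namespace RowExact

variable (h : RowExact ι)
include h

/-- Induction on rows. Once the rows below k vanish, the only entry in row k is at p = n-k > 0;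
vanishing of `D c` makes it a d'-cocycle, row exactness writes it as d'v after a refinement, and
subtracting Dv clears it. Vanishing of `D c` is asked only in positive columns, so that c may also
be a primitive of an augmented element. -/
lemma exists_refinement_lt {n : ℕ} (c : Family I A) (hc : c.HasDegree n)
    (hD : ∀ p q, c.D (p + 1) q = 0) (k : ℕ) (hk : k ≤ n) :
    ∃ (A' : C) (π : A' ⟶ A) (_ : Epi π) (w : Family I A'), w.HasPredDegree n ∧
      ∀ p q, q < k → (precomp π c - w.D) p q = 0 := by
  induction k with
  | zero => exact ⟨A, 𝟙 A, inferInstance, 0, fun _ _ _ => rfl, fun p q hq => by lia⟩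
  | succ k ih =>
    obtain ⟨A', π, _, w, hw, hcw⟩ := ih (by lia)
    set c' := precomp π c - w.D with hc'
    have hdeg : c'.HasDegree n := (hc.precomp π).sub hw.D
    have hD' : ∀ p q, c'.D (p + 1) q = 0 := by
      intro p q
      rw [hc', D_sub, D_D, D_precomp, sub_zero, precomp_apply, hD, comp_zero]
    -- As k < n, the entry of row k sits in a positive column p+1, and exactness at `I.X (p + 1)`
    -- applies.
    obtain ⟨p, rfl⟩ : ∃ p, n = p + 1 + k := ⟨n - k - 1, by lia⟩
    have hz : c' (p + 1) k ≫ (I.d (p + 1) (p + 2)).f k = 0 := by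
      have := hD' (p + 1) k
      rw [D_apply] at this
      have h2 : c' (p + 1 + 1) (k - 1) ≫ (I.X (p + 1 + 1)).d (k - 1) k = 0 := by
        rcases k with _ | k
        · simp
        · rw [hcw _ _ (by simp), zero_comp]
      rwa [h2, smul_zero, add_zero] at this
    obtain ⟨A'', π', _, v, hv⟩ := h.exact p k _ hz
    refine ⟨A'', π' ≫ π, epi_comp _ _, precomp π' w + single p k v, ?_, ?_⟩
    · intro a b hab
      rw [Pi.add_apply, Pi.add_apply, precomp_apply, hw a b hab, single_of_ne _ (by lia)]
      simp
    · intro a b hb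
      have e : precomp (π' ≫ π) c - (precomp π' w + single p k v).D =
          precomp π' c' - (single p k v).D := by
        rw [D_add, D_precomp, hc']
        funext a b
        simp only [Pi.sub_apply, Pi.add_apply, precomp_apply, Preadditive.comp_sub, Category.assoc]
        abel
      rw [e, Pi.sub_apply, Pi.sub_apply, precomp_apply]
      by_cases hab : p + 1 = a ∧ k = b
      · obtain ⟨rfl, rfl⟩ := hab
        rw [D_single_self, hv, sub_self]
      · rw [D_single_of_le _ (by lia) hab, sub_zero]
        by_cases hbk : b < k
        · rw [hcw a b hbk, comp_zero]
        · rw [hdeg a b (by lia), comp_zero]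

/-- When the rows below n are cleared only the entry at (0, n) remains. It is a d'-cocycle, so
exactness at `I.X 0` brings it from K. -/
lemma exists_refinement {n : ℕ} (c : Family I A) (hc : c.HasDegree n)
    (hD : ∀ p q, c.D (p + 1) q = 0) :
    ∃ (A' : C) (π : A' ⟶ A) (_ : Epi π) (w : Family I A') (_ : w.HasPredDegree n)
      (x : A' ⟶ K.X n), precomp π c = augmentFamily ι x + w.D := by
  obtain ⟨A', π, _, w, hw, hcw⟩ := h.exists_refinement_lt c hc hD n le_rfl
  set c' := precomp π c - w.D with hc'
  have hdeg : c'.HasDegree n := (hc.precomp π).sub hw.D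
  have hD' : c'.D 1 n = 0 := by
    rw [hc', D_sub, D_D, D_precomp, sub_zero, precomp_apply, hD, comp_zero]
  have hz : c' 0 n ≫ (I.d 0 1).f n = 0 := by
    rw [D_apply] at hD'
    have h2 : c' 1 (n - 1) ≫ (I.X 1).d (n - 1) n = 0 := by
      rcases n with _ | n
      · simp
      · rw [hcw _ _ (by simp), zero_comp]
    rwa [h2, smul_zero, add_zero] at hD'
  obtain ⟨A'', π', _, x, hx⟩ := h.exact₀ n _ hz
  refine ⟨A'', π' ≫ π, epi_comp _ _, precomp π' w, fun p q hpq => by simp [hw p q hpq], x, ?_⟩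
  have e : precomp (π' ≫ π) c = precomp π' c' + (precomp π' w).D := by
    rw [D_precomp, hc']
    funext a b
    simp
  rw [e]
  congr 1
  apply ext_single
  · exact hx
  · intro p q hpq
    by_cases hq : q < n
    · rw [precomp_apply, hcw p q hq, comp_zero]
    · rw [precomp_apply, hdeg p q (by lia), comp_zero]

lemma augmentFamily_injective {n : ℕ} {x y : A ⟶ K.X n}
    (hxy : augmentFamily ι x = augmentFamily ι y) : x = y := by
  have := congr_fun (congr_fun hxy 0) n
  rw [augmentFamily, augmentFamily, single_self, single_self] at this
  have := h.mono n
  rwa [cancel_mono] at *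

/-- The single complex of a resolution of `K` is quasi-isomorphic to `K`. -/
lemma quasiIso_totalAugment : QuasiIso (totalAugment h.zero) where
  quasiIsoAt n := by
    rw [quasiIsoAt_iff_isIso_homologyMap]
    have hnext : (ComplexShape.up ℕ).next n = n + 1 := by simp
    have hm : Mono (HomologicalComplex.homologyMap (totalAugment h.zero) n) := by
      -- In degree 0 the previous index is again 0, with zero differential, so there are no
      -- coboundaries and the case is separate.
      rcases n with _ | n
      · rw [HomologicalComplex.mono_homologyMap_iff_up_to_refinements _ 0 0 1 (by simp) hnext]
        intro A x hx y hy
        have hx0 : x = 0 := by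
          apply h.augmentFamily_injective
          rw [← ofTotal_totalAugment h.zero, ← ofTotal_totalAugment h.zero, hy]
          simp
        exact ⟨A, 𝟙 A, inferInstance, 0, by simp [hx0]⟩
      · rw [HomologicalComplex.mono_homologyMap_iff_up_to_refinements _ n (n + 1) (n + 2)
          (by simp) hnext]
        intro A x hx y hy
        have e : augmentFamily ι x = (ofTotal y).D := by
          rw [← ofTotal_totalAugment h.zero, hy, ofTotal_d]
        -- Here y is not a cocycle, but its differential is the augmentation of x and hence vanishes
        -- in positive columns. Replacing y by an augmented element z changes it by a coboundary
        -- only, so dz = x up to refinement.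
        obtain ⟨A', π, hπ, w, hw, z, hz⟩ := h.exists_refinement (ofTotal y)
          (hasDegree_ofTotal _) (fun p q => by
            rw [← e, augmentFamily, single_of_ne _ (by lia)])
        refine ⟨A', π, hπ, z, ?_⟩
        apply h.augmentFamily_injective
        rw [← precomp_augmentFamily, e, ← D_precomp, hz, D_add, D_D, add_zero,
          D_augmentFamily h.zero]
    have he : Epi (HomologicalComplex.homologyMap (totalAugment h.zero) n) := by
      have key : ∀ ⦃A : C⦄ (y : A ⟶ (total I).X n), y ≫ (total I).d n (n + 1) = 0 →
          ∃ (A' : C) (π : A' ⟶ A) (_ : Epi π) (w : Family I A') (_ : w.HasPredDegree n)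
            (x : A' ⟶ K.X n), x ≫ K.d n (n + 1) = 0 ∧
            precomp π (ofTotal y) = augmentFamily ι x + w.D := by
        intro A y hy
        have e : (ofTotal y).D = 0 := by rw [← ofTotal_d, hy, ofTotal_zero]
        obtain ⟨A', π, hπ, w, hw, x, hx⟩ := h.exists_refinement (ofTotal y)
          (hasDegree_ofTotal _) (fun p q => by rw [e]; rfl)
        refine ⟨A', π, hπ, w, hw, x, ?_, hx⟩
        apply h.augmentFamily_injective
        have := congr_arg Family.D hx
        rw [D_precomp, e, D_add, D_D, add_zero, D_augmentFamily h.zero] at this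
        rw [← this, augmentFamily, zero_comp]
        exact ext_single (by simp) (fun p q _ => by simp)
      rcases n with _ | n
      · rw [HomologicalComplex.epi_homologyMap_iff_up_to_refinements _ 0 0 1 (by simp) hnext]
        intro A y hy
        obtain ⟨A', π, hπ, w, hw, x, hx', hx⟩ := key y hy
        refine ⟨A', π, hπ, x, hx', 0, ?_⟩
        apply ofTotal_injective
        rw [ofTotal_comp, hx, zero_comp, add_zero, ofTotal_totalAugment, hw.eq_zero, D_zero,
          add_zero]
      · rw [HomologicalComplex.epi_homologyMap_iff_up_to_refinements _ n (n + 1) (n + 2)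
          (by simp) hnext]
        intro A y hy
        obtain ⟨A', π, hπ, w, hw, x, hx', hx⟩ := key y hy
        refine ⟨A', π, hπ, x, hx', toTotal n w, ?_⟩
        apply ofTotal_injective
        rw [ofTotal_comp, hx, ofTotal_add, ofTotal_totalAugment, ofTotal_d,
          ofTotal_toTotal hw.hasDegree]
    exact isIso_of_mono_of_epi _

end RowExact

end TotalQuasiIso

/-! ### Canonical truncation and its effect on Cartan–Eilenberg resolutions -/

section Truncation

open Limits

universe v w

variable {C : Type w} [Category.{v} C] [Abelian C] (m : ℕ)

/-- The morphism whose kernel is the canonical truncation in degrees `≤ m`. -/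
noncomputable def truncRel (K : CochainComplex C ℕ) (q : ℕ) : K.X q ⟶ K.X q ⊞ K.X (q + 1) :=
  -- The kernel is K^q for q < m, the cocycles for q = m, and zero for q > m. Putting the cases into
  -- the morphism avoids a case distinction in the definition of the objects.
  biprod.lift (if m < q then 𝟙 _ else 0) (if m ≤ q then K.d q (q + 1) else 0)

variable {m} in
lemma comp_truncRel_eq_zero {K : CochainComplex C ℕ} {q : ℕ} {A : C} (g : A ⟶ K.X q)
    (h₁ : m < q → g = 0) (h₂ : m ≤ q → g ≫ K.d q (q + 1) = 0) : g ≫ truncRel m K q = 0 := by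
  dsimp only [truncRel]
  ext
  · simp only [Category.assoc, biprod.lift_fst, zero_comp]
    split_ifs with h
    · rw [h₁ h, zero_comp]
    · rw [comp_zero]
  · simp only [Category.assoc, biprod.lift_snd, zero_comp]
    split_ifs with h
    · rw [h₂ h]
    · rw [comp_zero]

/-- The inclusion of the canonical truncation, in degree `q`. -/
noncomputable def truncIncl (K : CochainComplex C ℕ) (q : ℕ) : kernel (truncRel m K q) ⟶ K.X q :=
  kernel.ι _

instance (K : CochainComplex C ℕ) (q : ℕ) : Mono (truncIncl m K q) := by
  dsimp only [truncIncl]; infer_instance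

lemma truncIncl_truncRel (K : CochainComplex C ℕ) (q : ℕ) :
    truncIncl m K q ≫ truncRel m K q = 0 :=
  kernel.condition _

lemma truncIncl_eq_zero (K : CochainComplex C ℕ) {q : ℕ} (h : m < q) : truncIncl m K q = 0 := by
  have h₁ : truncRel m K q ≫ biprod.fst = 𝟙 _ := by simp [truncRel, h]
  rw [← Category.comp_id (truncIncl m K q), ← h₁, ← Category.assoc, truncIncl_truncRel, zero_comp]

lemma truncIncl_d (K : CochainComplex C ℕ) {q : ℕ} (h : m ≤ q) :
    truncIncl m K q ≫ K.d q (q + 1) = 0 := by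
  have h₁ : truncRel m K q ≫ biprod.snd = K.d q (q + 1) := by simp [truncRel, h]
  rw [← h₁, ← Category.assoc, truncIncl_truncRel, zero_comp]

variable {m} in
/-- The universal property of the canonical truncation. -/
noncomputable def truncLift {K : CochainComplex C ℕ} {q : ℕ} {A : C} (g : A ⟶ K.X q)
    (h₁ : m < q → g = 0) (h₂ : m ≤ q → g ≫ K.d q (q + 1) = 0) : A ⟶ kernel (truncRel m K q) :=
  kernel.lift _ g (comp_truncRel_eq_zero g h₁ h₂)

variable {m} in
lemma truncLift_incl {K : CochainComplex C ℕ} {q : ℕ} {A : C} (g : A ⟶ K.X q)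
    (h₁ : m < q → g = 0) (h₂ : m ≤ q → g ≫ K.d q (q + 1) = 0) :
    truncLift g h₁ h₂ ≫ truncIncl m K q = g :=
  kernel.lift_ι _ _ _

/-- The differential of the canonical truncation. -/
noncomputable def truncD (K : CochainComplex C ℕ) (q : ℕ) :
    kernel (truncRel m K q) ⟶ kernel (truncRel m K (q + 1)) :=
  truncLift (truncIncl m K q ≫ K.d q (q + 1)) (fun h => truncIncl_d m K (by lia))
    (fun _ => by simp)

lemma truncD_incl (K : CochainComplex C ℕ) (q : ℕ) :
    truncD m K q ≫ truncIncl m K (q + 1) = truncIncl m K q ≫ K.d q (q + 1) :=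
  truncLift_incl _ _ _

/-- The canonical truncation of a complex in degrees `≤ m`. -/
noncomputable def truncObj (K : CochainComplex C ℕ) : CochainComplex C ℕ :=
  CochainComplex.of (fun q => kernel (truncRel m K q)) (truncD m K) fun q => by
    rw [← cancel_mono (truncIncl m K (q + 2)), Category.assoc, truncD_incl, ← Category.assoc,
      truncD_incl]
    simp

lemma truncObj_d (K : CochainComplex C ℕ) (q : ℕ) :
    (truncObj m K).d q (q + 1) = truncD m K q := by
  dsimp only [truncObj]
  exact CochainComplex.of_d _ _ _

/-- The inclusion of the canonical truncation. -/
noncomputable def truncι (K : CochainComplex C ℕ) : truncObj m K ⟶ K where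
  f q := truncIncl m K q
  comm' q q' h := by
    obtain rfl : q + 1 = q' := h
    rw [truncObj_d]
    exact (truncD_incl m K q).symm

instance (K : CochainComplex C ℕ) (q : ℕ) : Mono ((truncι m K).f q) :=
  inferInstanceAs (Mono (truncIncl m K q))

lemma truncι_eq_zero (K : CochainComplex C ℕ) {q : ℕ} (h : m < q) : (truncι m K).f q = 0 :=
  truncIncl_eq_zero m K h

lemma truncι_d (K : CochainComplex C ℕ) {q : ℕ} (h : m ≤ q) :
    (truncι m K).f q ≫ K.d q (q + 1) = 0 :=
  truncIncl_d m K h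

variable {m} in
/-- The universal property of the canonical truncation. -/
noncomputable def truncObjLift {K : CochainComplex C ℕ} {q : ℕ} {A : C} (g : A ⟶ K.X q)
    (h₁ : m < q → g = 0) (h₂ : m ≤ q → g ≫ K.d q (q + 1) = 0) : A ⟶ (truncObj m K).X q :=
  truncLift g h₁ h₂

variable {m} in
@[simp]
lemma truncObjLift_ι {K : CochainComplex C ℕ} {q : ℕ} {A : C} (g : A ⟶ K.X q)
    (h₁ : m < q → g = 0) (h₂ : m ≤ q → g ≫ K.d q (q + 1) = 0) :
    truncObjLift g h₁ h₂ ≫ (truncι m K).f q = g :=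
  truncLift_incl _ _ _

variable {m} in
@[simp]
lemma truncObjLift_ι_assoc {K : CochainComplex C ℕ} {q : ℕ} {A : C} (g : A ⟶ K.X q)
    (h₁ : m < q → g = 0) (h₂ : m ≤ q → g ≫ K.d q (q + 1) = 0) {B : C} (k : K.X q ⟶ B) :
    truncObjLift g h₁ h₂ ≫ (truncι m K).f q ≫ k = g ≫ k := by
  rw [← Category.assoc, truncObjLift_ι]

lemma isZero_truncObj_X (K : CochainComplex C ℕ) {q : ℕ} (h : m < q) :
    IsZero ((truncObj m K).X q) := by
  rw [IsZero.iff_id_eq_zero, ← cancel_mono ((truncι m K).f q)]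
  simp [truncι_eq_zero m K h]

/-- The functoriality of the canonical truncation. -/
noncomputable def truncMapHom {K L : CochainComplex C ℕ} (φ : K ⟶ L) :
    truncObj m K ⟶ truncObj m L where
  f q := truncObjLift ((truncι m K).f q ≫ φ.f q) (fun h => by simp [truncι_eq_zero m K h])
    (fun h => by rw [Category.assoc, φ.comm, ← Category.assoc, truncι_d m K h, zero_comp])
  comm' q q' h := by
    obtain rfl : q + 1 = q' := h
    rw [← cancel_mono ((truncι m L).f (q + 1))]
    simp only [Category.assoc, ← (truncι m L).comm, truncObjLift_ι_assoc, truncObjLift_ι]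
    rw [φ.comm, (truncι m K).comm_assoc]

lemma truncMapHom_ι {K L : CochainComplex C ℕ} (φ : K ⟶ L) :
    truncMapHom m φ ≫ truncι m L = truncι m K ≫ φ := by
  ext q
  simp [truncMapHom]

instance (K : CochainComplex C ℕ) : Mono (truncι m K) :=
  HomologicalComplex.mono_of_mono_f _ inferInstance

variable (C) in
/-- The canonical truncation functor. -/
@[simps]
noncomputable def truncFunctor : CochainComplex C ℕ ⥤ CochainComplex C ℕ where
  obj := truncObj m
  map := truncMapHom m
  map_id K := by rw [← cancel_mono (truncι m K), truncMapHom_ι]; simp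
  map_comp f g := by
    rw [← cancel_mono (truncι m _), truncMapHom_ι, Category.assoc, truncMapHom_ι,
      ← Category.assoc, ← Category.assoc, truncMapHom_ι]

variable (C) in
/-- The inclusion of the canonical truncation, as a natural transformation. -/
@[simps]
noncomputable def truncNatTrans : truncFunctor C m ⟶ 𝟭 (CochainComplex C ℕ) where
  app := truncι m
  naturality _ _ f := truncMapHom_ι m f

instance : (truncFunctor C m).Additive where
  map_add {K L f g} := by
    change truncMapHom m (f + g) = truncMapHom m f + truncMapHom m g
    rw [← cancel_mono (truncι m _), Preadditive.add_comp]
    simp only [truncMapHom_ι, Preadditive.comp_add]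

/-- Below degree `m` the truncation is the identity. -/
noncomputable def truncXIso (K : CochainComplex C ℕ) {q : ℕ} (h : q < m) :
    K.X q ≅ (truncObj m K).X q where
  hom := truncObjLift (𝟙 (K.X q)) (by lia) (by lia)
  inv := (truncι m K).f q
  hom_inv_id := by simp
  inv_hom_id := by rw [← cancel_mono ((truncι m K).f q)]; simp

/-- In degree `m` the truncation is given by the cocycles. -/
noncomputable def truncXIsoCycles (K : CochainComplex C ℕ) :
    K.cycles m ≅ (truncObj m K).X m where
  hom := truncObjLift (K.iCycles m) (by lia) (by simp)
  inv := K.liftCycles ((truncι m K).f m) (m + 1) (by simp) (truncι_d m K le_rfl)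
  hom_inv_id := by rw [← cancel_mono (K.iCycles m)]; simp
  inv_hom_id := by rw [← cancel_mono ((truncι m K).f m)]; simp

lemma truncMapHom_f_ι {K L : CochainComplex C ℕ} (φ : K ⟶ L) (q : ℕ) :
    (truncMapHom m φ).f q ≫ (truncι m L).f q = (truncι m K).f q ≫ φ.f q := by
  simp [truncMapHom]

variable (C) in
/-- Below degree `m` the truncation functor is the identity. -/
noncomputable def truncEvalIso {q : ℕ} (h : q < m) :
    HomologicalComplex.eval C (ComplexShape.up ℕ) q ≅
      truncFunctor C m ⋙ HomologicalComplex.eval C (ComplexShape.up ℕ) q :=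
  NatIso.ofComponents (fun K => truncXIso m K h) (fun {K L} f => by
    change f.f q ≫ (truncXIso m L h).hom = (truncXIso m K h).hom ≫ (truncMapHom m f).f q
    rw [← cancel_mono ((truncι m L).f q)]
    simp [truncXIso, truncMapHom_f_ι])

variable (C) in
/-- In degree `m` the truncation functor is given by the cocycles. -/
noncomputable def truncEvalIsoCycles :
    HomologicalComplex.cyclesFunctor C (ComplexShape.up ℕ) m ≅
      truncFunctor C m ⋙ HomologicalComplex.eval C (ComplexShape.up ℕ) m :=
  NatIso.ofComponents (fun K => truncXIsoCycles m K) (fun {K L} f => by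
    change HomologicalComplex.cyclesMap f m ≫ (truncXIsoCycles m L).hom =
      (truncXIsoCycles m K).hom ≫ (truncMapHom m f).f m
    rw [← cancel_mono ((truncι m L).f m)]
    simp [truncXIsoCycles, truncMapHom_f_ι])

section Resolution

variable {D : Type*} [Category D] [HasZeroMorphisms D] {E : Type*} [Category E]
  [HasZeroMorphisms E]

lemma IsInjectiveResolutionUnder.of_iso {Φ Ψ : D ⥤ E} (e : Φ ≅ Ψ) {K : D}
    {I : CochainComplex D ℕ} {ι : K ⟶ I.X 0} (h : IsInjectiveResolutionUnder Φ I ι) :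
    IsInjectiveResolutionUnder Ψ I ι := by
  have key : ∀ {X₁ X₂ X₃ : D} (f : X₁ ⟶ X₂) (g : X₂ ⟶ X₃),
      (∃ w : Φ.map f ≫ Φ.map g = 0, (ShortComplex.mk _ _ w).Exact) →
      (∃ w : Ψ.map f ≫ Ψ.map g = 0, (ShortComplex.mk _ _ w).Exact) := by
    rintro X₁ X₂ X₃ f g ⟨w, hw⟩
    have w' : Ψ.map f ≫ Ψ.map g = 0 := by
      rw [← cancel_epi (e.hom.app X₁), ← e.hom.naturality_assoc, ← e.hom.naturality,
        reassoc_of% w]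
      simp
    refine ⟨w', ShortComplex.exact_of_iso ?_ hw⟩
    exact ShortComplex.isoMk (e.app _) (e.app _) (e.app _) (by simp) (by simp)
  refine ⟨fun p => ?_, ?_, key _ _ h.2.2.1, fun p => key _ _ (h.2.2.2 p)⟩
  · have := h.1 p
    exact Injective.of_iso (e.app _) inferInstance
  · have := h.2.1
    have e' : Ψ.map ι = e.inv.app _ ≫ Φ.map ι ≫ e.hom.app _ := by simp
    rw [e']
    infer_instance

lemma IsInjectiveResolutionUnder.of_isZero {C D : Type*} [Category C] [Category D]
    [HasZeroMorphisms C] [Abelian D] {Φ : C ⥤ D} {K : C}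
    {I : CochainComplex C ℕ} {ι : K ⟶ I.X 0} (h : ∀ X, IsZero (Φ.obj X)) :
    IsInjectiveResolutionUnder Φ I ι := by
  refine ⟨fun p => (h _).injective, ⟨fun _ _ _ => (h _).eq_of_tgt _ _⟩,
    ⟨(h _).eq_of_src _ _, ShortComplex.exact_of_isZero_X₂ _ (h _)⟩,
    fun p => ⟨(h _).eq_of_src _ _, ShortComplex.exact_of_isZero_X₂ _ (h _)⟩⟩

end Resolution

/-- The canonical truncation, in the second direction, of the members of a Cartan-Eilenberg
resolution is a resolution. -/
lemma CartanEilenbergResolution.isInjectiveResolutionUnder_trunc {K : CochainComplex C ℕ}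
    (R : CartanEilenbergResolution K) (q : ℕ) :
    IsInjectiveResolutionUnder (HomologicalComplex.eval C _ q)
      (((truncFunctor C m).mapHomologicalComplex _).obj R.I) ((truncFunctor C m).map R.ι) := by
  suffices h : IsInjectiveResolutionUnder
      (truncFunctor C m ⋙ HomologicalComplex.eval C (ComplexShape.up ℕ) q) R.I R.ι from h
  -- The truncated row q consists of the objects below m, of the cocycles at m, and of zero above.
  -- This is where the resolution of cocycles is needed besides that of objects.
  rcases lt_trichotomy q m with h | rfl | h
  · exact (R.objects q).of_iso (truncEvalIso C m h)
  · exact (R.cycles q).of_iso (truncEvalIsoCycles C q)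
  · exact .of_isZero fun K => isZero_truncObj_X m K h

/-- The map of cohomology induced by the inclusion of the truncation. -/
lemma quasiIsoAt_truncι (K : CochainComplex C ℕ) {q : ℕ} (hq : q ≤ m) :
    QuasiIsoAt (truncι m K) q := by
  rw [quasiIsoAt_iff_isIso_homologyMap]
  have hnext : (ComplexShape.up ℕ).next q = q + 1 := by simp
  have he : Epi (HomologicalComplex.homologyMap (truncι m K) q) := by
    rw [HomologicalComplex.epi_homologyMap_iff_up_to_refinements _ _ q (q + 1) rfl hnext]
    intro A y hy
    obtain ⟨y', rfl⟩ : ∃ y', y' ≫ (truncι m K).f q = y :=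
      ⟨truncObjLift y (by lia) (fun _ => hy), by simp⟩
    refine ⟨A, 𝟙 A, inferInstance, y', ?_, 0, by simp⟩
    rw [← cancel_mono ((truncι m K).f (q + 1)), Category.assoc, ← HomologicalComplex.Hom.comm,
      ← Category.assoc, hy, zero_comp]
  have hm : Mono (HomologicalComplex.homologyMap (truncι m K) q) := by
    rcases q with _ | q
    · rw [HomologicalComplex.mono_homologyMap_iff_up_to_refinements _ 0 0 1 (by simp) hnext]
      intro A x hx y hy
      refine ⟨A, 𝟙 A, inferInstance, 0, ?_⟩
      rw [← cancel_mono ((truncι m K).f 0)]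
      simpa using hy
    · rw [HomologicalComplex.mono_homologyMap_iff_up_to_refinements _ q (q + 1) (q + 2)
        (by simp) hnext]
      intro A x hx y hy
      obtain ⟨y', rfl⟩ : ∃ y', y' ≫ (truncι m K).f q = y :=
        ⟨truncObjLift y (by lia) (by lia), by simp⟩
      refine ⟨A, 𝟙 A, inferInstance, y', ?_⟩
      rw [← cancel_mono ((truncι m K).f (q + 1))]
      simpa using hy
  exact isIso_of_mono_of_epi _

end Truncation

/-! ### Cocycles Z → K^n as morphisms in the homotopy and derived categories -/

section CohomologyClasses

open CochainComplex HomComplex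

universe v w

variable {C : Type u} [Category.{v} C] [Abelian C]

/-- The cochain complex indexed by `ℤ` which extends `K` by zero. -/
noncomputable abbrev extendInt (K : CochainComplex C ℕ) : CochainComplex C ℤ :=
  K.extend ComplexShape.embeddingUpNat

/-- The isomorphism in degree `n : ℕ` between `K` and its extension by zero. -/
noncomputable def extendIntXIso (K : CochainComplex C ℕ) (n : ℕ) :
    (extendInt K).X (n : ℤ) ≅ K.X n :=
  K.extendXIso ComplexShape.embeddingUpNat (i := n) rfl

theorem extendInt_d (K : CochainComplex C ℕ) (n m : ℕ) :
    (extendInt K).d (n : ℤ) (m : ℤ) =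
      (extendIntXIso K n).hom ≫ K.d n m ≫ (extendIntXIso K m).inv :=
  K.extend_d_eq ComplexShape.embeddingUpNat rfl rfl

/-- The action of the extension by zero on morphisms. -/
noncomputable abbrev extendIntMap {K L : CochainComplex C ℕ} (φ : K ⟶ L) :
    extendInt K ⟶ extendInt L :=
  HomologicalComplex.extendMap φ ComplexShape.embeddingUpNat

theorem extendIntMap_f {K L : CochainComplex C ℕ} (φ : K ⟶ L) (n : ℕ) :
    (extendIntMap φ).f (n : ℤ) =
      (extendIntXIso K n).hom ≫ φ.f n ≫ (extendIntXIso L n).inv :=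
  HomologicalComplex.extendMap_f φ ComplexShape.embeddingUpNat rfl

theorem extendIntXIso_inv_naturality {K L : CochainComplex C ℕ} (φ : K ⟶ L) (n : ℕ) :
    (extendIntXIso K n).inv ≫ (extendIntMap φ).f (n : ℤ) = φ.f n ≫ (extendIntXIso L n).inv := by
  rw [extendIntMap_f, Iso.inv_hom_id_assoc]

/-- The complex `K`, extended by zero, in the homotopy category. -/
noncomputable abbrev htpy (K : CochainComplex C ℕ) : HomotopyCategory C (ComplexShape.up ℤ) :=
  (HomotopyCategory.quotient C (ComplexShape.up ℤ)).obj (extendInt K)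

/-- The object `Z` in degree zero, in the homotopy category. -/
noncomputable abbrev htpySingle (Z : C) : HomotopyCategory C (ComplexShape.up ℤ) :=
  (HomotopyCategory.quotient C (ComplexShape.up ℤ)).obj ((CochainComplex.singleFunctor C 0).obj Z)

/-- The map induced by `φ` in the homotopy category. -/
noncomputable abbrev htpyMap {K L : CochainComplex C ℕ} (φ : K ⟶ L) : htpy K ⟶ htpy L :=
  (HomotopyCategory.quotient C (ComplexShape.up ℤ)).map (extendIntMap φ)

variable {Z : C} {K L : CochainComplex C ℕ} {n : ℕ}

/-- The cocycle of the Hom-complex attached to `f : Z ⟶ K^n` with `d f = 0`. -/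
noncomputable def singleCocycle (f : Z ⟶ K.X n) (hf : f ≫ K.d n (n + 1) = 0) :
    Cocycle ((CochainComplex.singleFunctor C 0).obj Z) (extendInt K) (n : ℤ) :=
  Cocycle.fromSingleMk (f ≫ (extendIntXIso K n).inv) (zero_add _) ((n + 1 : ℕ) : ℤ) (by simp)
    (by rw [extendInt_d, Category.assoc, Iso.inv_hom_id_assoc, reassoc_of% hf,
      Limits.zero_comp])

/-- The class in the homotopy category of a cocycle `f : Z ⟶ K^n`. -/
noncomputable def htpyClass (f : Z ⟶ K.X n) (hf : f ≫ K.d n (n + 1) = 0) :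
    ShiftedHom (htpySingle Z) (htpy K) (n : ℤ) :=
  ShiftedHom.map (Cocycle.equivHomShift.symm (singleCocycle f hf))
    (HomotopyCategory.quotient C (ComplexShape.up ℤ))

theorem htpyClass_eq (f : Z ⟶ K.X n) (hf : f ≫ K.d n (n + 1) = 0) :
    htpyClass f hf = CohomologyClass.toHom (CohomologyClass.mk (singleCocycle f hf)) ≫
      ((HomotopyCategory.quotient C (ComplexShape.up ℤ)).commShiftIso (n : ℤ)).hom.app _ := rfl

theorem htpyClass_sub (f g : Z ⟶ K.X n) (hf : f ≫ K.d n (n + 1) = 0)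
    (hg : g ≫ K.d n (n + 1) = 0) (hfg : (f - g) ≫ K.d n (n + 1) = 0) :
    htpyClass (f - g) hfg = htpyClass f hf - htpyClass g hg := by
  have : singleCocycle (f - g) hfg = singleCocycle f hf - singleCocycle g hg := by
    ext : 1
    simp [singleCocycle, Cocycle.fromSingleMk]
  rw [htpyClass_eq, htpyClass_eq, htpyClass_eq, this, CohomologyClass.mk_sub, map_sub,
    Preadditive.sub_comp]

theorem htpyClass_surjective (x : ShiftedHom (htpySingle Z) (htpy K) (n : ℤ)) :
    ∃ (f : Z ⟶ K.X n) (hf : f ≫ K.d n (n + 1) = 0), htpyClass f hf = x := by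
  obtain ⟨y, hy⟩ := (CohomologyClass.toHom_bijective _ _ _).surjective
    (x ≫ ((HomotopyCategory.quotient C (ComplexShape.up ℤ)).commShiftIso (n : ℤ)).inv.app _)
  obtain ⟨y, rfl⟩ := CohomologyClass.mk_surjective y
  obtain ⟨g, hg, rfl⟩ := Cocycle.fromSingleMk_surjective y (n : ℤ) (by simp)
    ((n + 1 : ℕ) : ℤ) (by simp)
  have hf : (g ≫ (extendIntXIso K n).hom) ≫ K.d n (n + 1) = 0 := by
    rw [extendInt_d] at hg
    rw [← cancel_mono (extendIntXIso K (n + 1)).inv]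
    simpa using hg
  refine ⟨g ≫ (extendIntXIso K n).hom, hf, ?_⟩
  have : singleCocycle (g ≫ (extendIntXIso K n).hom) hf =
      Cocycle.fromSingleMk g (zero_add _) ((n + 1 : ℕ) : ℤ) (by simp) hg := by
    ext : 1
    simp [singleCocycle]
  rw [htpyClass_eq, this, hy, Category.assoc]
  exact (congrArg (x ≫ ·) (Iso.inv_hom_id_app
    ((HomotopyCategory.quotient C (ComplexShape.up ℤ)).commShiftIso (n : ℤ)) (extendInt K))).trans
    (Category.comp_id _)

theorem htpyClass_eq_zero_iff (f : Z ⟶ K.X n) (hf : f ≫ K.d n (n + 1) = 0) :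
    htpyClass f hf = 0 ↔ ∃ g : Z ⟶ K.X (n - 1), g ≫ K.d (n - 1) n = f := by
  have h1 : htpyClass f hf = 0 ↔ CohomologyClass.mk (singleCocycle f hf) = 0 := by
    rw [htpyClass_eq, Preadditive.IsIso.comp_right_eq_zero]
    constructor
    · intro h
      exact (CohomologyClass.toHom_bijective _ _ _).injective (h.trans (map_zero _).symm)
    · intro h
      rw [h, map_zero]
  rw [h1, CohomologyClass.mk_eq_zero_iff, singleCocycle]
  rw [Cocycle.fromSingleMk_mem_coboundaries_iff _ _ _ _ _ ((n : ℤ) - 1) (by lia)]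
  -- For n = 0 both sides say f = 0: `K.d (0 - 1) 0` is `K.d 0 0 = 0`, and the extension by zero
  -- vanishes in degree -1.
  rcases n with _ | n
  · have hz : Limits.IsZero ((extendInt K).X (((0 : ℕ) : ℤ) - 1)) :=
      K.isZero_extend_X _ _ (fun i hi => by simp at hi)
    constructor
    · rintro ⟨g, hg⟩
      refine ⟨0, ?_⟩
      rw [← cancel_mono (extendIntXIso K 0).inv, ← hg, hz.eq_of_tgt g 0]
      simp
    · rintro ⟨g, hg⟩
      refine ⟨0, ?_⟩
      rw [← hg]
      simp
  · have h2 : (((n + 1 : ℕ) : ℤ) - 1) = (n : ℤ) := by simp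
    rw [h2]
    change (∃ g : Z ⟶ (extendInt K).X (n : ℤ), g ≫ (extendInt K).d (n : ℤ) ((n + 1 : ℕ) : ℤ) =
      f ≫ (extendIntXIso K (n + 1)).inv) ↔ ∃ g : Z ⟶ K.X n, g ≫ K.d n (n + 1) = f
    rw [extendInt_d]
    constructor
    · rintro ⟨g, hg⟩
      exact ⟨g ≫ (extendIntXIso K n).hom, by
        rw [← cancel_mono (extendIntXIso K (n + 1)).inv, ← hg]; simp⟩
    · rintro ⟨g, hg⟩
      exact ⟨g ≫ (extendIntXIso K n).inv, by simp [← hg]⟩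

theorem htpyClass_postcomp (f : Z ⟶ K.X n) (hf : f ≫ K.d n (n + 1) = 0) (φ : K ⟶ L)
    (hf' : (f ≫ φ.f n) ≫ L.d n (n + 1) = 0) :
    (htpyClass f hf).comp (.mk₀ 0 rfl (htpyMap φ)) (zero_add _) = htpyClass (f ≫ φ.f n) hf' := by
  have h1 : singleCocycle (f ≫ φ.f n) hf' = (singleCocycle f hf).postcomp (extendIntMap φ) := by
    refine Eq.trans ?_ (Cocycle.fromSingleMk_postcomp _ _ _ _ _ _)
    ext : 1
    simp [singleCocycle, extendIntXIso_inv_naturality]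
  rw [htpyClass, htpyClass, h1, Cocycle.equivHomShift_symm_postcomp,
    ← ShiftedHom.comp_mk₀ _ 0 rfl, ShiftedHom.map_comp, ShiftedHom.map_mk₀]

theorem htpyClass_precomp {Z' : C} (g : Z' ⟶ Z) (f : Z ⟶ K.X n) (hf : f ≫ K.d n (n + 1) = 0)
    (hf' : (g ≫ f) ≫ K.d n (n + 1) = 0) :
    (ShiftedHom.mk₀ 0 rfl ((HomotopyCategory.quotient C (ComplexShape.up ℤ)).map
      ((CochainComplex.singleFunctor C 0).map g))).comp (htpyClass f hf) (add_zero _) =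
      htpyClass (g ≫ f) hf' := by
  have h1 : singleCocycle (g ≫ f) hf' =
      (singleCocycle f hf).precomp ((CochainComplex.singleFunctor C 0).map g) := by
    refine Eq.trans ?_ (Cocycle.fromSingleMk_precomp _ _ _ _ _ _)
    ext : 1
    simp [singleCocycle]
  rw [htpyClass, htpyClass, h1, Cocycle.equivHomShift_symm_precomp,
    ← ShiftedHom.mk₀_comp 0 rfl, ShiftedHom.map_comp, ShiftedHom.map_mk₀]

variable [HasDerivedCategory.{w} C]

/-- The class in the derived category of a cocycle `f : Z ⟶ K^n`. -/
noncomputable def derClass (f : Z ⟶ K.X n) (hf : f ≫ K.d n (n + 1) = 0) :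
    ShiftedHom (DerivedCategory.Qh.obj (htpySingle Z)) (DerivedCategory.Qh.obj (htpy K)) (n : ℤ) :=
  (htpyClass f hf).map DerivedCategory.Qh

/-- The complex `K`, extended by zero, in the derived category. -/
noncomputable abbrev der (K : CochainComplex C ℕ) : DerivedCategory C :=
  DerivedCategory.Qh.obj (htpy K)

/-- The object `Z` in degree zero, in the derived category. -/
noncomputable abbrev derSingle (Z : C) : DerivedCategory C :=
  DerivedCategory.Qh.obj (htpySingle Z)

/-- The map induced by `φ` in the derived category. -/
noncomputable abbrev derMap {K L : CochainComplex C ℕ} (φ : K ⟶ L) : der K ⟶ der L :=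
  DerivedCategory.Qh.map (htpyMap φ)

theorem derClass_postcomp (f : Z ⟶ K.X n) (hf : f ≫ K.d n (n + 1) = 0) (φ : K ⟶ L)
    (hf' : (f ≫ φ.f n) ≫ L.d n (n + 1) = 0) :
    derClass f hf ≫ (derMap φ)⟦(n : ℤ)⟧' = derClass (f ≫ φ.f n) hf' := by
  rw [derClass, derClass, ← htpyClass_postcomp f hf φ hf', ShiftedHom.map_comp,
    ShiftedHom.map_mk₀, ShiftedHom.comp_mk₀]

theorem derClass_sub (f g : Z ⟶ K.X n) (hf : f ≫ K.d n (n + 1) = 0)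
    (hg : g ≫ K.d n (n + 1) = 0) (hfg : (f - g) ≫ K.d n (n + 1) = 0) :
    derClass (f - g) hfg = derClass f hf - derClass g hg := by
  rw [derClass, htpyClass_sub f g hf hg]
  rw [derClass, derClass, ShiftedHom.map, ShiftedHom.map, ShiftedHom.map, Functor.map_sub,
    Preadditive.sub_comp]

theorem derClass_eq_zero (f : Z ⟶ K.X n) (hf : f ≫ K.d n (n + 1) = 0)
    (h : ∃ g : Z ⟶ K.X (n - 1), g ≫ K.d (n - 1) n = f) : derClass f hf = 0 := by
  rw [derClass, (htpyClass_eq_zero_iff f hf).mpr h, ShiftedHom.map_zero]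

/-- Morphisms into the K-injective complex L⟦n⟧ agree in the homotopy and derived categories; the
rest compares the shift with the two functors. -/
theorem map_Qh_bijective (A : HomotopyCategory C (ComplexShape.up ℤ)) (L : CochainComplex C ℤ)
    [L.IsKInjective] (n : ℤ) :
    Function.Bijective (fun x : ShiftedHom A ((HomotopyCategory.quotient C _).obj L) n =>
      x.map DerivedCategory.Qh) := by
  let e : (HomotopyCategory.quotient C (ComplexShape.up ℤ)).obj (L⟦n⟧) ≅
      ((HomotopyCategory.quotient C (ComplexShape.up ℤ)).obj L)⟦n⟧ :=
    ((HomotopyCategory.quotient C (ComplexShape.up ℤ)).commShiftIso n).app L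
  let e' := (DerivedCategory.Qh.commShiftIso n).app
    ((HomotopyCategory.quotient C (ComplexShape.up ℤ)).obj L)
  have hb := CochainComplex.IsKInjective.Qh_map_bijective A (L⟦n⟧)
  constructor
  · intro x y hxy
    have h1 : DerivedCategory.Qh.map x = DerivedCategory.Qh.map y :=
      (cancel_mono e'.hom).mp hxy
    rw [← cancel_mono e.inv]
    apply hb.injective
    rw [Functor.map_comp, Functor.map_comp, h1]
  · intro z
    obtain ⟨x, hx⟩ := hb.surjective (z ≫ e'.inv ≫ DerivedCategory.Qh.map e.inv)
    refine ⟨x ≫ e.hom, ?_⟩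
    change DerivedCategory.Qh.map (x ≫ e.hom) ≫ e'.hom = z
    rw [Functor.map_comp, hx]
    simp

section

variable [∀ q, Injective (K.X q)]

/-- A bounded below complex of injectives is K-injective, so derived morphisms into it are
represented by genuine cocycles. -/
theorem derClass_surjective (x : ShiftedHom (derSingle Z) (der K) (n : ℤ)) :
    ∃ (f : Z ⟶ K.X n) (hf : f ≫ K.d n (n + 1) = 0), derClass f hf = x := by
  obtain ⟨y, rfl⟩ := (map_Qh_bijective _ (extendInt K) _).surjective x
  obtain ⟨f, hf, rfl⟩ := htpyClass_surjective y
  exact ⟨f, hf, rfl⟩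

theorem derClass_eq_zero_iff (f : Z ⟶ K.X n) (hf : f ≫ K.d n (n + 1) = 0) :
    derClass f hf = 0 ↔ ∃ g : Z ⟶ K.X (n - 1), g ≫ K.d (n - 1) n = f := by
  rw [← htpyClass_eq_zero_iff f hf]
  constructor
  · intro h
    apply (map_Qh_bijective _ (extendInt K) _).injective
    exact h.trans (ShiftedHom.map_zero _).symm
  · intro h
    rw [derClass, h, ShiftedHom.map_zero]

end

theorem isIso_derMap (φ : K ⟶ L) [QuasiIso φ] : IsIso (derMap φ) := by
  have : QuasiIso (extendIntMap φ) :=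
    (HomologicalComplex.quasiIso_extendMap_iff φ ComplexShape.embeddingUpNat).mpr inferInstance
  have h := (DerivedCategory.quotientCompQhIso C).hom.naturality (extendIntMap φ)
  have h2 : derMap φ = (DerivedCategory.quotientCompQhIso C).hom.app _ ≫
      DerivedCategory.Q.map (extendIntMap φ) ≫
        (DerivedCategory.quotientCompQhIso C).inv.app _ := by
    rw [← Category.assoc, ← h]
    simp
  rw [h2]
  infer_instance

end CohomologyClasses

/-! ### The universal property of the truncation in the derived category -/

section TruncationInDerivedCategory

open CochainComplex DerivedCategory Pretriangulated Limits

universe v w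

variable {C : Type u} [Category.{v} C] [Abelian C] [HasDerivedCategory.{w} C]

/-- The comparison of the two models of `K` in the derived category. -/
noncomputable def derIso (K : CochainComplex C ℕ) : der K ≅ Q.obj (extendInt K) :=
  (quotientCompQhIso C).app (extendInt K)

theorem derMap_eq {K L : CochainComplex C ℕ} (φ : K ⟶ L) :
    derMap φ = (derIso K).hom ≫ Q.map (extendIntMap φ) ≫ (derIso L).inv := by
  have h := (quotientCompQhIso C).hom.naturality (extendIntMap φ)
  rw [← Category.assoc, Iso.eq_comp_inv]
  exact h

omit [HasDerivedCategory.{w} C] in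
theorem isZero_extendInt_X_of_neg (K : CochainComplex C ℕ) {i : ℤ} (hi : i < 0) :
    IsZero ((extendInt K).X i) :=
  K.isZero_extend_X _ _ (fun j hj => by
    have : (j : ℤ) = i := hj
    lia)

theorem isLE_der (K : CochainComplex C ℕ) (m : ℕ) (h : ∀ q, m < q → K.ExactAt q) :
    (der K).IsLE m := by
  have : (Q.obj (extendInt K)).IsLE m := by
    rw [isLE_Q_obj_iff, CochainComplex.isLE_iff]
    intro i hi
    obtain ⟨j, rfl⟩ := Int.eq_ofNat_of_zero_le (by lia : 0 ≤ i)
    exact (HomologicalComplex.extend_exactAt_iff K ComplexShape.embeddingUpNat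
      (j := j) rfl).mpr (h j (by lia))
  exact TStructure.t.isLE_of_iso (derIso K).symm m

theorem isLE_der_truncObj (m : ℕ) (K : CochainComplex C ℕ) : (der (truncObj m K)).IsLE m := by
  refine isLE_der _ m fun q hq => ?_
  exact ShortComplex.exact_of_isZero_X₂ _ (isZero_truncObj_X m K hq)

theorem isIso_homology_truncι (m : ℕ) (K : CochainComplex C ℕ) (i : ℤ) (hi : i ≤ m) :
    IsIso ((homologyFunctor C i).map (derMap (truncι m K))) := by
  have h1 : IsIso (HomologicalComplex.homologyMap (extendIntMap (truncι m K)) i) := by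
    rcases lt_or_ge i 0 with h | h
    · have hz : ∀ L : CochainComplex C ℕ, IsZero ((extendInt L).homology i) := fun L =>
        (HomologicalComplex.exactAt_iff_isZero_homology _ _).mp
          (ShortComplex.exact_of_isZero_X₂ _ (isZero_extendInt_X_of_neg L h))
      exact (hz _).isIso (hz _) _
    · obtain ⟨j, rfl⟩ := Int.eq_ofNat_of_zero_le h
      rw [← quasiIsoAt_iff_isIso_homologyMap]
      exact (HomologicalComplex.quasiIsoAt_extendMap_iff _ ComplexShape.embeddingUpNat
        (j := j) rfl).mpr (quasiIsoAt_truncι m K (by lia))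
  have h2 : IsIso ((homologyFunctor C i).map (Q.map (extendIntMap (truncι m K)))) :=
    (NatIso.isIso_map_iff (homologyFunctorFactors C i) _).mpr h1
  rw [derMap_eq, Functor.map_comp, Functor.map_comp]
  infer_instance

/-- Morphisms from objects that are `≤ m` factor through the truncation. -/
theorem exists_factor_truncι (m : ℕ) (K : CochainComplex C ℕ) {A : DerivedCategory C}
    [A.IsLE m] (b : A ⟶ der K) :
    ∃ b' : A ⟶ der (truncObj m K), b' ≫ derMap (truncι m K) = b := by
  obtain ⟨T, g, h, hT⟩ := distinguished_cocone_triangle (derMap (truncι m K))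
  -- By the long exact homology sequence the cone of the truncation inclusion is ≥ m+1. Morphisms to
  -- it from objects ≤ m vanish, which gives the factorization.
  have hTge : T.IsGE ((m : ℤ) + 1) := by
    rw [DerivedCategory.isGE_iff]
    intro i hi
    have hi' := isIso_homology_truncι m K i (by lia)
    have h1 : (homologyFunctor C i).map g = 0 :=
      (HomologySequence.epi_homologyMap_mor₁_iff _ hT i).mp (inferInstanceAs
        (Epi ((homologyFunctor C i).map (derMap (truncι m K)))))
    -- For i < m this is an isomorphism; at i = m the source vanishes in degree m+1.
    have hm : Mono ((homologyFunctor C (i + 1)).map (derMap (truncι m K))) := by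
      rcases lt_or_ge i (m : ℤ) with h2 | h2
      · have := isIso_homology_truncι m K (i + 1) (by lia)
        infer_instance
      · have := isLE_der_truncObj m K
        have hz := isZero_of_isLE (der (truncObj m K)) m (i + 1) (by lia)
        exact ⟨fun _ _ _ => hz.eq_of_tgt _ _⟩
    have h2 : HomologySequence.δ (Triangle.mk (derMap (truncι m K)) g h) i (i + 1) = 0 :=
      (HomologySequence.mono_homologyMap_mor₁_iff _ hT i (i + 1)).mp hm
    exact (HomologySequence.exact₃ _ hT i (i + 1)).isZero_of_both_zeros h1 h2
  obtain ⟨b', hb'⟩ := Triangle.coyoneda_exact₂ _ hT b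
    (TStructure.t.zero (b ≫ g) m ((m : ℤ) + 1))
  exact ⟨b', hb'.symm⟩

end TruncationInDerivedCategory

/-! ### The filtration as factorization through objects bounded above -/

section FiltrationOnCocycles

open CochainComplex DerivedCategory Pretriangulated Limits Family

universe v w

variable {C : Type u} [Category.{v} C] [Abelian C] {K : CochainComplex C ℕ}
  (R : CartanEilenbergResolution K)

theorem augmentFamily_self {I : CochainComplex (CochainComplex C ℕ) ℕ} (ι : K ⟶ I.X 0) {A : C}
    {n : ℕ} (x : A ⟶ K.X n) : augmentFamily ι x 0 n = x ≫ ι.f n := single_self _ _ _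

theorem augmentFamily_of_ne {I : CochainComplex (CochainComplex C ℕ) ℕ} (ι : K ⟶ I.X 0) {A : C}
    {n : ℕ} (x : A ⟶ K.X n) {p q : ℕ} (h : ¬ (0 = p ∧ n = q)) : augmentFamily ι x p q = 0 :=
  single_of_ne _ h

/-- The truncation of the members of a Cartan-Eilenberg resolution. -/
noncomputable abbrev CartanEilenbergResolution.truncI (m : ℕ) :
    CochainComplex (CochainComplex C ℕ) ℕ :=
  ((truncFunctor C m).mapHomologicalComplex _).obj R.I

/-- The inclusion of the truncated double complex. -/
noncomputable abbrev CartanEilenbergResolution.truncIncl (m : ℕ) : R.truncI m ⟶ R.I where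
  f p := truncι m (R.I.X p)
  comm' p p' _ := ((truncNatTrans C m).naturality (R.I.d p p')).symm

theorem CartanEilenbergResolution.rowExact : RowExact R.ι :=
  rowExact_of_isInjectiveResolutionUnder R.objects

theorem CartanEilenbergResolution.rowExact_trunc (m : ℕ) :
    RowExact (I := R.truncI m) ((truncFunctor C m).map R.ι) :=
  rowExact_of_isInjectiveResolutionUnder (R.isInjectiveResolutionUnder_trunc m)

theorem CartanEilenbergResolution.injective (p q : ℕ) : Injective ((R.I.X p).X q) :=
  (R.objects q).1 p

theorem CartanEilenbergResolution.injective_trunc (m p q : ℕ) :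
    Injective (((R.truncI m).X p).X q) :=
  (R.isInjectiveResolutionUnder_trunc m q).1 p

/-- The augmentation of the single complex. -/
noncomputable def CartanEilenbergResolution.aug : K ⟶ total R.I :=
  totalAugment R.rowExact.zero

/-- The augmentation of the single complex of the truncation. -/
noncomputable def CartanEilenbergResolution.augTrunc (m : ℕ) :
    truncObj m K ⟶ total (R.truncI m) :=
  totalAugment (R.rowExact_trunc m).zero

/-- The inclusion of the single complex of the truncation. -/
noncomputable def CartanEilenbergResolution.totalIncl (m : ℕ) :
    total (R.truncI m) ⟶ total R.I :=
  totalMap (R.truncIncl m)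

instance : QuasiIso R.aug := R.rowExact.quasiIso_totalAugment

instance (m : ℕ) : QuasiIso (R.augTrunc m) := (R.rowExact_trunc m).quasiIso_totalAugment

theorem CartanEilenbergResolution.ofTotal_aug {A : C} {n : ℕ} (x : A ⟶ K.X n) :
    ofTotal (x ≫ R.aug.f n) = augmentFamily R.ι x :=
  ofTotal_totalAugment R.rowExact.zero x

theorem CartanEilenbergResolution.ofTotal_totalIncl (m : ℕ) {A : C} {n : ℕ}
    (x : A ⟶ (total (R.truncI m)).X n) :
    ofTotal (x ≫ (R.totalIncl m).f n) = (ofTotal x).postcomp (R.truncIncl m) :=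
  ofTotal_totalMap ..

/-- Both augmentations are quasi-isomorphisms, so this square identifies `totalIncl` with the
inclusion of the truncation of K in the derived category. -/
theorem CartanEilenbergResolution.augTrunc_totalIncl (m : ℕ) :
    R.augTrunc m ≫ R.totalIncl m = truncι m K ≫ R.aug := by
  ext n
  apply ofTotal_injective
  rw [HomologicalComplex.comp_f, HomologicalComplex.comp_f, R.ofTotal_totalIncl, R.ofTotal_aug]
  have h1 : ofTotal ((R.augTrunc m).f n) =
      augmentFamily (I := R.truncI m) ((truncFunctor C m).map R.ι) (𝟙 ((truncObj m K).X n)) := by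
    refine Eq.trans ?_ (ofTotal_totalAugment (R.rowExact_trunc m).zero (𝟙 ((truncObj m K).X n)))
    exact congrArg ofTotal (Category.id_comp ((R.augTrunc m).f n)).symm
  rw [h1]
  funext p q
  by_cases h : 0 = p ∧ n = q
  · obtain ⟨rfl, rfl⟩ := h
    refine (congrArg (· ≫ (truncι m (R.I.X 0)).f n) ((augmentFamily_self
      (I := R.truncI m) ((truncFunctor C m).map R.ι) (𝟙 ((truncObj m K).X n))).trans
      (Category.id_comp _))).trans (Eq.trans ?_ (augmentFamily_self _ _).symm)
    exact truncMapHom_f_ι ..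
  · rw [postcomp_apply, augmentFamily_of_ne _ _ h]
    exact (congrArg (· ≫ (truncι m (R.I.X p)).f q) (augmentFamily_of_ne
      (I := R.truncI m) _ _ h)).trans zero_comp

/-- The cocycle `g` is cohomologous, in the single complex, to a cocycle in filtration `k`. -/
def CartanEilenbergResolution.MemFiltration {Z : C} {n : ℕ} (g : Z ⟶ K.X n) (k : ℕ) : Prop :=
  ∃ z w : Family R.I Z, z.HasDegree n ∧ (∀ p q, p < k → z p q = 0) ∧ z.D = 0 ∧
    w.HasPredDegree n ∧ w.D = z - augmentFamily R.ι g

variable {R}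
variable {Z : C} {n : ℕ} {g : Z ⟶ K.X n}

theorem CartanEilenbergResolution.memFiltration_zero (hg : g ≫ K.d n (n + 1) = 0) :
    R.MemFiltration g 0 := by
  refine ⟨augmentFamily R.ι g, 0, hasDegree_augmentFamily _ _, fun p q h => by lia, ?_,
    fun _ _ _ => rfl, by rw [D_zero, sub_self]⟩
  rw [D_augmentFamily R.rowExact.zero, hg]
  funext p q
  by_cases h : 0 = p ∧ n + 1 = q
  · obtain ⟨rfl, rfl⟩ := h
    rw [augmentFamily, single_self, zero_comp]; rfl
  · rw [augmentFamily, single_of_ne _ h]; rfl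

variable [HasDerivedCategory.{w} C]

theorem derMap_comp {K L M : CochainComplex C ℕ} (φ : K ⟶ L) (ψ : L ⟶ M) :
    derMap (φ ≫ ψ) = derMap φ ≫ derMap ψ := by
  rw [← Functor.map_comp, ← Functor.map_comp, ← HomologicalComplex.extendMap_comp]

/-- Cohomologous cocycles of the single complex have the same class. -/
theorem derClass_eq_of_D {I : CochainComplex (CochainComplex C ℕ) ℕ}
    {z z' : Z ⟶ (total I).X n} (hz : z ≫ (total I).d n (n + 1) = 0)
    (hz' : z' ≫ (total I).d n (n + 1) = 0) {w : Family I Z} (hw : w.HasPredDegree n)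
    (h : w.D = ofTotal z - ofTotal z') : derClass z hz = derClass z' hz' := by
  rw [← sub_eq_zero, ← derClass_sub z z' hz hz' (by rw [Preadditive.sub_comp, hz, hz', sub_zero])]
  apply derClass_eq_zero
  rcases n with _ | n
  · refine ⟨0, ?_⟩
    rw [zero_comp]
    apply ofTotal_injective
    rw [ofTotal_zero, ofTotal_sub, ← h, hw.eq_zero, D_zero]
  · refine ⟨toTotal n w, ?_⟩
    apply ofTotal_injective
    refine (ofTotal_d (n := n) (toTotal n w)).trans ?_
    rw [ofTotal_toTotal hw.hasDegree, h, ofTotal_sub]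

/-- A cocycle of degree n = k+m in filtration k lies in the single complex of the truncated
resolution, which is quasi-isomorphic to the truncation of K at m. That truncation is the object A.
-/
theorem CartanEilenbergResolution.MemFiltration.exists_factor {k m : ℕ} (hkm : k + m = n)
    (h : R.MemFiltration g k) (hg : g ≫ K.d n (n + 1) = 0) :
    ∃ (A : DerivedCategory C) (_ : A.IsLE m) (a : derSingle Z ⟶ A⟦(n : ℤ)⟧) (b : A ⟶ der K),
      derClass g hg = a ≫ b⟦(n : ℤ)⟧' := by
  obtain ⟨z, w, hz, hzk, hzD, hw, hwD⟩ := h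
  have hlift : ∀ p q, ∃ y : Z ⟶ ((R.truncI m).X p).X q,
      y ≫ ((R.truncIncl m).f p).f q = z p q := by
    intro p q
    by_cases hpq : p + q = n
    · have h₁ : m < q → z p q = 0 := fun hq => hzk p q (by lia)
      -- From q ≥ m and p+q = n follows p ≤ k, so the column p-1 contributes nothing to Dz at (p,
      -- q+1), and Dz = 0 leaves d''z = 0 up to sign.
      have h₂ : m ≤ q → z p q ≫ (R.I.X p).d q (q + 1) = 0 := by
        intro hq
        have hD := congr_fun (congr_fun hzD p) (q + 1)
        rw [D_apply] at hD
        have h3 : z (p - 1) (q + 1) ≫ (R.I.d (p - 1) p).f (q + 1) = 0 := by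
          rcases p with _ | p
          · simp
          · rw [hzk _ _ (by simp; lia), zero_comp]
        rw [h3, zero_add] at hD
        have h4 : (-1 : ℤ) ^ p • ((-1 : ℤ) ^ p • (z p q ≫ (R.I.X p).d q (q + 1))) = 0 := by
          have : z p q ≫ (R.I.X p).d q (q + 1) =
            z p (q + 1 - 1) ≫ (R.I.X p).d (q + 1 - 1) (q + 1) := rfl
          rw [this, hD]
          simp
        rwa [smul_smul, ← mul_pow, neg_mul_neg, one_mul, one_pow, one_smul] at h4
      exact ⟨truncObjLift (z p q) h₁ h₂, truncObjLift_ι _ _ _⟩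
    · exact ⟨0, by rw [hz p q hpq, zero_comp]⟩
  choose z' hz' using hlift
  have hm : ∀ p q, Mono (((R.truncIncl m).f p).f q) := fun p q =>
    inferInstanceAs (Mono ((truncι m (R.I.X p)).f q))
  have hz'n : HasDegree (I := R.truncI m) z' n := by
    intro p q hpq
    have := hm p q
    rw [← cancel_mono (((R.truncIncl m).f p).f q), hz', hz p q hpq, zero_comp]
  have hpost : postcomp (I := R.truncI m) z' (R.truncIncl m) = z := by
    funext p q; exact hz' p q
  have hz'D : Family.D (I := R.truncI m) z' = 0 := by
    have h1 : postcomp (D (I := R.truncI m) z') (R.truncIncl m) = 0 := by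
      rw [← D_postcomp, hpost, hzD]
    funext p q
    have := hm p q
    rw [← cancel_mono (((R.truncIncl m).f p).f q)]
    refine (congr_fun (congr_fun h1 p) q).trans ?_
    exact zero_comp.symm
  have hcoc : toTotal n z' ≫ (total (R.truncI m)).d n (n + 1) = 0 := by
    apply ofTotal_injective
    rw [ofTotal_d, ofTotal_toTotal hz'n, hz'D, ofTotal_zero]
  have i1 := isIso_derMap (R.augTrunc m)
  have i2 := isIso_derMap R.aug
  refine ⟨der (truncObj m K), isLE_der_truncObj m K, derClass (toTotal n z') hcoc ≫
    (inv (derMap (R.augTrunc m)))⟦(n : ℤ)⟧', derMap (truncι m K), ?_⟩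
  have hgt : (g ≫ R.aug.f n) ≫ (total R.I).d n (n + 1) = 0 := by
    rw [Category.assoc, HomologicalComplex.Hom.comm, reassoc_of% hg, zero_comp]
  have hzt : (toTotal n z' ≫ (R.totalIncl m).f n) ≫ (total R.I).d n (n + 1) = 0 := by
    rw [Category.assoc, HomologicalComplex.Hom.comm, reassoc_of% hcoc, zero_comp]
  rw [← cancel_mono ((derMap R.aug)⟦(n : ℤ)⟧'),
    derClass_postcomp g hg _ hgt, Category.assoc, Category.assoc, ← Functor.map_comp,
    ← Functor.map_comp]
  have hcomm : inv (derMap (R.augTrunc m)) ≫ derMap (truncι m K) ≫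
      derMap R.aug = derMap (R.totalIncl m) := by
    rw [IsIso.inv_comp_eq, ← derMap_comp, ← derMap_comp, R.augTrunc_totalIncl]
  rw [hcomm, derClass_postcomp _ hcoc _ hzt]
  refine (derClass_eq_of_D hzt hgt hw ?_).symm
  rw [hwD, R.ofTotal_totalIncl, ofTotal_toTotal hz'n, hpost, R.ofTotal_aug]

omit [HasDerivedCategory.{w} C] in
theorem exists_hasPredDegree {I : CochainComplex (CochainComplex C ℕ) ℕ}
    {z : Z ⟶ (total I).X n} (h : ∃ w : Z ⟶ (total I).X (n - 1), w ≫ (total I).d (n - 1) n = z) :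
    ∃ w : Family I Z, w.HasPredDegree n ∧ w.D = ofTotal z := by
  obtain ⟨w, rfl⟩ := h
  rcases n with _ | n
  · refine ⟨0, fun _ _ _ => rfl, ?_⟩
    have h0 : w ≫ (total I).d (0 - 1) 0 = 0 := by
      rw [(total I).shape _ _ (by simp), comp_zero]
    rw [D_zero, h0, ofTotal_zero]
  · exact ⟨ofTotal w, fun p q hpq => hasDegree_ofTotal w p q (by simp; lia),
      (ofTotal_d (n := n) w).symm⟩

/-- The factorization can be pushed through the truncation of K. Its truncated resolution has
injective terms, so the class comes from a cocycle f there, which has no entries in rows q > m and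
so lies in filtration k. Injectivity of `total R.I` turns equality of derived classes into a
cobounding family. -/
theorem CartanEilenbergResolution.memFiltration_of_factor {k m : ℕ} (hkm : k + m = n)
    (hg : g ≫ K.d n (n + 1) = 0) {A : DerivedCategory C} (hA : A.IsLE m)
    (a : derSingle Z ⟶ A⟦(n : ℤ)⟧) (b : A ⟶ der K) (h : derClass g hg = a ≫ b⟦(n : ℤ)⟧') :
    R.MemFiltration g k := by
  obtain ⟨b', rfl⟩ := exists_factor_truncι m K b
  have hinj := R.injective
  have hinj' := R.injective_trunc m
  obtain ⟨f, hf, hfa⟩ := derClass_surjective (K := total (R.truncI m))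
    (a ≫ (b' ≫ derMap (R.augTrunc m))⟦(n : ℤ)⟧')
  have hgt : (g ≫ R.aug.f n) ≫ (total R.I).d n (n + 1) = 0 := by
    rw [Category.assoc, HomologicalComplex.Hom.comm, reassoc_of% hg, zero_comp]
  have hft : (f ≫ (R.totalIncl m).f n) ≫ (total R.I).d n (n + 1) = 0 := by
    rw [Category.assoc, HomologicalComplex.Hom.comm, reassoc_of% hf, zero_comp]
  have hfg : (f ≫ (R.totalIncl m).f n - g ≫ R.aug.f n) ≫
      (total R.I).d n (n + 1) = 0 := by rw [Preadditive.sub_comp, hgt, hft, sub_zero]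
  have key : derClass _ hfg = 0 := by
    rw [derClass_sub _ _ hft hgt, sub_eq_zero, ← derClass_postcomp f hf, hfa,
      ← derClass_postcomp g hg, h]
    rw [Category.assoc, Category.assoc, ← Functor.map_comp, ← Functor.map_comp, Category.assoc,
      Category.assoc, ← derMap_comp, ← derMap_comp, R.augTrunc_totalIncl]
  obtain ⟨w, hw⟩ := (derClass_eq_zero_iff _ hfg).mp key
  have hfn : (ofTotal (f ≫ (R.totalIncl m).f n)).HasDegree n := hasDegree_ofTotal _
  refine ⟨ofTotal (f ≫ (R.totalIncl m).f n), ?_⟩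
  have hD : (ofTotal (f ≫ (R.totalIncl m).f n)).D = 0 := by
    rw [← ofTotal_d, hft, ofTotal_zero]
  have hlow : ∀ p q, p < k → ofTotal (f ≫ (R.totalIncl m).f n) p q = 0 := by
    intro p q hp
    by_cases hpq : p + q = n
    · rw [R.ofTotal_totalIncl, postcomp_apply]
      have hz : IsZero (((R.truncI m).X p).X q) := isZero_truncObj_X m (R.I.X p) (by lia)
      rw [hz.eq_of_tgt (ofTotal f p q) 0, zero_comp]
    · exact hfn p q hpq
  obtain ⟨w', hw', h'⟩ := exists_hasPredDegree ⟨w, hw⟩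
  refine ⟨w', hfn, hlow, hD, hw', ?_⟩
  rw [h', ofTotal_sub, R.ofTotal_aug]

theorem CartanEilenbergResolution.memFiltration_of_derClass_eq_zero (k : ℕ)
    (hg : g ≫ K.d n (n + 1) = 0) (h : derClass g hg = 0) :
    R.MemFiltration g k := by
  have hinj := R.injective
  have hgt : (g ≫ R.aug.f n) ≫ (total R.I).d n (n + 1) = 0 := by
    rw [Category.assoc, HomologicalComplex.Hom.comm, reassoc_of% hg, zero_comp]
  have hgt' : (-(g ≫ R.aug.f n)) ≫ (total R.I).d n (n + 1) = 0 := by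
    rw [Preadditive.neg_comp, hgt, neg_zero]
  have key : derClass _ hgt = 0 := by
    rw [← derClass_postcomp g hg, h, zero_comp]
  obtain ⟨w, hw⟩ := (derClass_eq_zero_iff _ hgt).mp key
  obtain ⟨w', hw', h'⟩ := exists_hasPredDegree
    (z := -(g ≫ R.aug.f n)) ⟨-w, by rw [Preadditive.neg_comp, hw]⟩
  refine ⟨0, w', fun _ _ _ => rfl, fun _ _ _ => rfl, D_zero, hw', ?_⟩
  rw [h', ← zero_sub (g ≫ R.aug.f n), ofTotal_sub, ofTotal_zero, R.ofTotal_aug]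

/-- For k > n no position of total degree n has p ≥ k, so the cocycle in filtration k is zero. -/
theorem CartanEilenbergResolution.MemFiltration.derClass_eq_zero {k : ℕ} (hk : n < k)
    (h : R.MemFiltration g k) (hg : g ≫ K.d n (n + 1) = 0) : derClass g hg = 0 := by
  obtain ⟨z, w, hz, hzk, hzD, hw, hwD⟩ := h
  have hgt : (g ≫ R.aug.f n) ≫ (total R.I).d n (n + 1) = 0 := by
    rw [Category.assoc, HomologicalComplex.Hom.comm, reassoc_of% hg, zero_comp]
  have hz0 : z = 0 := by
    funext p q
    by_cases hpq : p + q = n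
    · exact hzk p q (by lia)
    · exact hz p q hpq
  have i2 := isIso_derMap R.aug
  rw [← cancel_mono ((derMap R.aug)⟦(n : ℤ)⟧'),
    derClass_postcomp g hg _ hgt, zero_comp]
  have h0 : (0 : Z ⟶ (total R.I).X n) ≫ (total R.I).d n (n + 1) = 0 := zero_comp
  have h0' : derClass _ h0 = 0 := by
    rw [Leray.derClass_eq_zero _ h0]
    exact ⟨0, zero_comp⟩
  rw [← h0']
  refine (derClass_eq_of_D h0 hgt hw ?_).symm
  rw [hwD, hz0, ofTotal_zero, R.ofTotal_aug]

end FiltrationOnCocycles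

/-! ### Global sections as morphisms out of the constant sheaf -/

section Sections

variable {X Y : TopCat.{u}}

theorem homEquivSections_comp {F G : TopCat.Sheaf AddCommGrpCat.{u} X} (φ : constZ X ⟶ F)
    (g : F ⟶ G) : homEquivSections G (φ ≫ g) = (globalSections X).map g (homEquivSections F φ) := by
  rfl

theorem sectionsPushforward_map (f : X ⟶ Y) {F G : TopCat.Sheaf AddCommGrpCat.{u} X}
    (g : F ⟶ G) (s : (globalSections X).obj F) :
    sectionsPushforward f G ((globalSections X).map g s) =
      (globalSections Y).map ((TopCat.Sheaf.pushforward AddCommGrpCat.{u} f).map g)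
        (sectionsPushforward f F s) := rfl

/-- The morphism `ℤ ⟶ f_* F` with the same section as `φ : ℤ ⟶ F`. -/
noncomputable def pushHom (f : X ⟶ Y) {F : TopCat.Sheaf AddCommGrpCat.{u} X} (φ : constZ X ⟶ F) :
    constZ Y ⟶ (TopCat.Sheaf.pushforward AddCommGrpCat.{u} f).obj F :=
  (homEquivSections.{u} _).symm (sectionsPushforward f F (homEquivSections F φ))

theorem homEquivSections_pushHom (f : X ⟶ Y) {F : TopCat.Sheaf AddCommGrpCat.{u} X}
    (φ : constZ X ⟶ F) : homEquivSections _ (pushHom f φ) =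
      sectionsPushforward f F (homEquivSections F φ) :=
  AddEquiv.apply_symm_apply (homEquivSections.{u} _) _

theorem pushHom_comp (f : X ⟶ Y) {F G : TopCat.Sheaf AddCommGrpCat.{u} X} (φ : constZ X ⟶ F)
    (g : F ⟶ G) : pushHom f (φ ≫ g) =
      pushHom f φ ≫ (TopCat.Sheaf.pushforward AddCommGrpCat.{u} f).map g := by
  apply (homEquivSections.{u} _).injective
  rw [homEquivSections_comp, homEquivSections_pushHom, homEquivSections_pushHom,
    homEquivSections_comp, sectionsPushforward_map]

variable {f : X ⟶ Y} {A : TopCat.Sheaf AddCommGrpCat.{u} X} (L : LerayResolution f A)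

/-- The complex `f_* M` of a Leray resolution. -/
noncomputable abbrev LerayResolution.push :
    CochainComplex (TopCat.Sheaf AddCommGrpCat.{u} Y) ℕ :=
  ((TopCat.Sheaf.pushforward AddCommGrpCat.{u} f).mapHomologicalComplex _).obj L.M.cocomplex

/-- Families of morphisms out of the constant sheaf are families of sections. -/
noncomputable def LerayResolution.sections (c : Family L.CE.I (constZ Y)) :
    Bigraded L.doubleComplex := fun p q => homEquivSections _ (c p q)

theorem LerayResolution.sections_surjective (z : Bigraded L.doubleComplex) :
    ∃ c, L.sections c = z :=
  ⟨fun p q => (homEquivSections.{u} ((L.CE.I.X p).X q)).symm (z p q), funext fun p => funext fun q =>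
    (homEquivSections.{u} ((L.CE.I.X p).X q)).apply_symm_apply (z p q)⟩

theorem LerayResolution.sections_injective : Function.Injective L.sections := by
  intro c c' h
  funext p q
  exact (homEquivSections ((L.CE.I.X p).X q)).injective (congr_fun (congr_fun h p) q)

theorem LerayResolution.sections_eq_zero_iff (c : Family L.CE.I (constZ Y)) (p q : ℕ) :
    L.sections c p q = 0 ↔ c p q = 0 :=
  (homEquivSections ((L.CE.I.X p).X q)).map_eq_zero_iff

theorem LerayResolution.sections_zero : L.sections 0 = 0 := by
  funext p q
  exact (homEquivSections ((L.CE.I.X p).X q)).map_zero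

theorem LerayResolution.sections_sub (c c' : Family L.CE.I (constZ Y)) :
    L.sections (c - c') = L.sections c - L.sections c' := by
  funext p q
  exact (homEquivSections ((L.CE.I.X p).X q)).map_sub _ _

theorem LerayResolution.sections_D (c : Family L.CE.I (constZ Y)) :
    L.sections c.D = totalD L.doubleComplex (L.sections c) := by
  funext p q
  refine (congrArg (homEquivSections ((L.CE.I.X p).X q)) (Family.D_apply c p q)).trans ?_
  rw [map_add, map_zsmul, homEquivSections_comp, homEquivSections_comp]
  rfl

theorem LerayResolution.sections_augment {n : ℕ} (φ : constZ X ⟶ L.M.cocomplex.X n) :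
    L.sections (augmentFamily (K := L.push) L.CE.ι (pushHom f φ)) =
      L.augmentation n (homEquivSections _ φ) := by
  funext p q
  by_cases h : 0 = p ∧ n = q
  · obtain ⟨rfl, rfl⟩ := h
    refine (congrArg (homEquivSections ((L.CE.I.X 0).X n))
      (augmentFamily_self (K := L.push) L.CE.ι (pushHom f φ))).trans ?_
    refine (homEquivSections_comp (pushHom f φ) (L.CE.ι.f n)).trans ?_
    refine (congrArg ((globalSections Y).map (L.CE.ι.f n))
      (homEquivSections_pushHom f φ)).trans ?_
    simp [augmentation]
    rfl
  · refine (congrArg (homEquivSections ((L.CE.I.X p).X q))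
      (augmentFamily_of_ne (K := L.push) L.CE.ι (pushHom f φ) h)).trans ?_
    rw [map_zero]
    by_cases hp : p = 0
    · subst hp
      have hq : q ≠ n := by tauto
      simp [augmentation, hq]
      rfl
    · simp [augmentation, hp]
      rfl

/-- Sections of I^{p,q} are morphisms ℤ → I^{p,q}, compatibly with differentials and augmentation.
The filtration on H^n(X, A) is thereby expressed in the category of sheaves on Y, where derived
category arguments apply. -/
theorem LerayResolution.mem_filtration_iff {p n : ℕ} (x : Cohomology A n) :
    x ∈ L.filtration p n ↔ ∃ (φ : constZ X ⟶ L.M.cocomplex.X n)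
      (hφ : φ ≫ L.M.cocomplex.d n (n + 1) = 0), L.M.extMk φ (n + 1) rfl hφ = x ∧
        L.CE.MemFiltration (pushHom f φ) p := by
  constructor
  · rintro ⟨φ, hφ, z, h, hz, hzp, hzD, w, hw, hwD⟩
    obtain ⟨z, rfl⟩ := L.sections_surjective z
    obtain ⟨w, rfl⟩ := L.sections_surjective w
    refine ⟨φ, hφ, h, z, w, ?_, ?_, ?_, ?_, ?_⟩
    · exact fun a b hab => (L.sections_eq_zero_iff z a b).mp (hz a b hab)
    · exact fun a b hab => (L.sections_eq_zero_iff z a b).mp (hzp a b hab)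
    · apply L.sections_injective
      rw [L.sections_D, hzD, L.sections_zero]
    · exact fun a b hab => (L.sections_eq_zero_iff w a b).mp (hw a b hab)
    · apply L.sections_injective
      rw [L.sections_D, L.sections_sub, L.sections_augment, hwD]
  · rintro ⟨φ, hφ, h, z, w, hz, hzp, hzD, hw, hwD⟩
    refine ⟨φ, hφ, L.sections z, h, ?_, ?_, ?_, L.sections w, ?_, ?_⟩
    · exact fun a b hab => (L.sections_eq_zero_iff z a b).mpr (hz a b hab)
    · exact fun a b hab => (L.sections_eq_zero_iff z a b).mpr (hzp a b hab)
    · rw [← L.sections_D, hzD, L.sections_zero]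
    · exact fun a b hab => (L.sections_eq_zero_iff w a b).mpr (hw a b hab)
    · rw [← L.sections_D, hwD, L.sections_sub, L.sections_augment]

end Sections

/-! ### Lifting a factorization along a triangle with a t-structure -/

section Factorization

open Limits Pretriangulated Triangulated

variable {T : Type*} [Category T] [HasZeroObject T] [HasShift T ℤ] [Preadditive T]
  [∀ n : ℤ, (shiftFunctor T n).Additive] [Pretriangulated T]

/-- If `M ⟶ E ⟶ N ⟶ M⟦1⟧` is distinguished, `E ≤ 0`, and `ψ : Z ⟶ N` is such that the image of
`ψ` in `M⟦1⟧` factors through `L⟦1⟧` for some `L ⟶ M` with `L ≤ m + 1`, then `ψ` factors through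
an object `≤ m`, provided `Hom (Z, E) = 0`. -/
theorem exists_factor_of_comp_factor (t : TStructure T) (S : Triangle T) (hS : S ∈ distTriang T)
    {m : ℤ} (hm : 0 ≤ m) (hE : t.IsLE S.obj₂ 0) {Z L : T} (hZ : ∀ g : Z ⟶ S.obj₂, g = 0)
    (hL : t.IsLE L (m + 1)) (ψ : Z ⟶ S.obj₃) (a : Z ⟶ L⟦(1 : ℤ)⟧) (b : L ⟶ S.obj₁)
    (h : ψ ≫ S.mor₃ = a ≫ b⟦(1 : ℤ)⟧') :
    ∃ (P : T) (_ : t.IsLE P m) (c : Z ⟶ P) (d : P ⟶ S.obj₃), ψ = c ≫ d := by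
  -- P is the cone of L ⟶ M ⟶ E. The morphism of triangles that is b on L and the identity on E
  -- supplies c : P ⟶ N.
  obtain ⟨P, g, δ, hP⟩ := distinguished_cocone_triangle (b ≫ S.mor₁)
  obtain ⟨c, hc₁, hc₂⟩ := complete_distinguished_triangle_morphism _ _ hP hS b (𝟙 _)
    (Category.comp_id _)
  simp only [Triangle.mk_mor₂, Triangle.mk_mor₃] at hc₁ hc₂
  -- This composite is ψ followed by two consecutive maps of the triangle, so a lifts to some ψ' : Z
  -- ⟶ P.
  have ha : a ≫ (b ≫ S.mor₁)⟦(1 : ℤ)⟧' = 0 := by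
    rw [Functor.map_comp, ← reassoc_of% h, comp_distTriang_mor_zero₃₁ _ hS, comp_zero]
  obtain ⟨ψ', hψ'⟩ := Triangle.coyoneda_exact₁ _ hP a ha
  -- The two morphisms to N agree in M⟦1⟧, so they differ by something coming from Hom(Z, E) = 0.
  have hd : (ψ - ψ' ≫ c) ≫ S.mor₃ = 0 := by
    rw [Preadditive.sub_comp, h, Category.assoc, ← hc₂, hψ', sub_eq_zero]
    exact Category.assoc _ _ _
  obtain ⟨e, he⟩ := Triangle.coyoneda_exact₃ _ hS _ hd
  rw [hZ e, zero_comp, sub_eq_zero] at he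
  refine ⟨P, ?_, ψ', c, he⟩
  -- P is an extension of L⟦1⟧ by E, and both are ≤ m.
  have h1 : t.IsLE S.obj₂ m := t.isLE_of_le _ 0 m hm
  have h2 : t.IsLE (L⟦(1 : ℤ)⟧) m := t.isLE_shift L (m + 1) 1 m
  exact t.isLE₂ _ (rot_of_distTriang _ hP) m h1 h2

/-- Morphisms `Z ⟶ W⟦n⟧` are morphisms `Z⟦-n⟧ ⟶ W`. -/
noncomputable def desuspend {D : Type*} [Category D] [HasShift D ℤ] {Z : D} (n : ℤ) (W : D) :
    (Z ⟶ W⟦n⟧) ≃ (Z⟦-n⟧ ⟶ W) :=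
  ((shiftEquiv D n).symm.toAdjunction.homEquiv Z W).symm

theorem desuspend_comp {D : Type*} [Category D] [HasShift D ℤ] {Z : D} (n : ℤ) {W W' : D}
    (x : Z ⟶ W⟦n⟧) (y : W ⟶ W') :
    desuspend n W' (x ≫ y⟦n⟧') = desuspend n W x ≫ y :=
  (shiftEquiv D n).symm.toAdjunction.homEquiv_naturality_right_symm x y

/-- Replacing Z by Z⟦-n⟧ reduces this to n = 0. -/
theorem exists_factor_of_comp_factor_shift (t : TStructure T) (S : Triangle T)
    (hS : S ∈ distTriang T) {m : ℤ} (hm : 0 ≤ m) (hE : t.IsLE S.obj₂ 0) {Z L : T} (n n' : ℤ)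
    (hn : 1 + n = n')
    (hZ : ∀ g : Z ⟶ S.obj₂⟦n⟧, g = 0)
    (hL : t.IsLE L (m + 1)) (ψ : ShiftedHom Z S.obj₃ n) (a : Z ⟶ L⟦n'⟧) (b : L ⟶ S.obj₁)
    (h : ψ.comp (S.mor₃ : ShiftedHom S.obj₃ S.obj₁ (1 : ℤ)) hn = a ≫ b⟦n'⟧') :
    ∃ (P : T) (_ : t.IsLE P m) (c : Z ⟶ P⟦n⟧) (d : P ⟶ S.obj₃), ψ = c ≫ d⟦n⟧' := by
  obtain ⟨P, hP, c, d, hcd⟩ := exists_factor_of_comp_factor t S hS hm hE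
    (Z := Z⟦-n⟧) (fun g => by
      obtain ⟨g, rfl⟩ := (desuspend n S.obj₂).surjective g
      -- `desuspend` is only a bijection of sets; writing 0 as a composite with a zero morphism
      -- shows by naturality that it preserves 0.
      rw [hZ g, ← hZ ((0 : Z ⟶ S.obj₂⟦n⟧) ≫ (0 : S.obj₂ ⟶ S.obj₂)⟦n⟧'), desuspend_comp,
        comp_zero]) hL
    (desuspend n S.obj₃ ψ)
    (desuspend n (L⟦(1 : ℤ)⟧) (a ≫ (shiftFunctorAdd' T 1 n n' hn).hom.app L)) b (by
      rw [← desuspend_comp, ← desuspend_comp]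
      congr 1
      have h' := congrArg (· ≫ (shiftFunctorAdd' T 1 n n' hn).hom.app S.obj₁) h
      simp only [ShiftedHom.comp, Category.assoc, Iso.inv_hom_id_app, Functor.comp_obj,
        Category.comp_id] at h'
      rw [h', Category.assoc, NatTrans.naturality]
      rfl)
  obtain ⟨c, rfl⟩ := (desuspend n P).surjective c
  refine ⟨P, hP, c, d, ?_⟩
  apply (desuspend n S.obj₃).injective
  rw [desuspend_comp, hcd]

end Factorization

/-! ### Naturality of the composition of shifted morphisms -/

section ShiftedHomLemmas

variable {C : Type*} [Category C] {M : Type*} [AddMonoid M] [HasShift C M] {X X' Y Y' Z Z' : C}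

theorem shiftedHom_comp_map {a b c : M} (x : ShiftedHom X Y a) (e : Y ⟶ Y') (g : ShiftedHom Y' Z b)
    (h : b + a = c) :
    ShiftedHom.comp (Y := Y') (x ≫ e⟦a⟧') g h = x.comp (Y := Y) (e ≫ g) h := by
  simp [ShiftedHom.comp]

theorem shiftedHom_comp_shift {a b c : M} (x : ShiftedHom X Y a) (g : ShiftedHom Y Z b)
    (e : Z ⟶ Z') (h : b + a = c) :
    ShiftedHom.comp x (Z := Z') (g ≫ e⟦b⟧') h = x.comp g h ≫ e⟦c⟧' := by
  simp only [ShiftedHom.comp, Functor.map_comp, Category.assoc]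
  congr 2
  exact (shiftFunctorAdd' C b a c h).inv.naturality e

theorem shiftedHom_precomp {a b c : M} (f : X' ⟶ X) (x : ShiftedHom X Y a) (g : ShiftedHom Y Z b)
    (h : b + a = c) :
    ShiftedHom.comp (X := X') (f ≫ x) g h = f ≫ x.comp g h := by
  simp [ShiftedHom.comp]

end ShiftedHomLemmas

/-! ### A short exact sequence as a triangle of arbitrary injective resolutions -/

section ResolutionTriangle

open Limits Pretriangulated Triangulated DerivedCategory Abelian

universe v w w'

variable {C : Type u} [Category.{v} C] [Abelian C] [HasDerivedCategory.{w} C]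

/-- The comparison of the two models of `Z` in the derived category. -/
noncomputable def derSingleIso (Z : C) : derSingle Z ≅ (singleFunctor C 0).obj Z :=
  (quotientCompQhIso C).app ((CochainComplex.singleFunctor C 0).obj Z)

/-- The augmentation of an injective resolution. -/
noncomputable def resolutionAug {A : C} (M : InjectiveResolution A) :
    (CochainComplex.singleFunctor C 0).obj A ⟶ extendInt M.cocomplex := M.ι'

instance {A : C} (M : InjectiveResolution A) : IsIso (Q.map (resolutionAug M)) :=
  (isIso_Q_map_iff_quasiIso C _).mpr (inferInstanceAs (QuasiIso M.ι'))

/-- An injective resolution is isomorphic to the resolved object, in the derived category. -/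
noncomputable def resolutionIso {A : C} (M : InjectiveResolution A) :
    der M.cocomplex ≅ (singleFunctor C 0).obj A :=
  (quotientCompQhIso C).app (extendInt M.cocomplex) ≪≫ (asIso (Q.map (resolutionAug M))).symm

/-- `extMk` passes through `Q` and `derClass` through `Qh`; the two differ by `quotientCompQhIso`
and by the augmentation of the resolution. -/
theorem extMk_hom_eq [HasExt.{w'} C] {A Z : C} (M : InjectiveResolution A) {n : ℕ}
    (φ : Z ⟶ M.cocomplex.X n) (hφ : φ ≫ M.cocomplex.d n (n + 1) = 0) :
    (M.extMk φ (n + 1) rfl hφ).hom =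
      (derSingleIso Z).inv ≫ derClass φ hφ ≫ (resolutionIso M).hom⟦(n : ℤ)⟧' := by
  rw [InjectiveResolution.extMk_hom]
  have h1 := ShiftedHom.map_naturality_1 (CochainComplex.HomComplex.Cocycle.equivHomShift.symm
    (singleCocycle φ hφ)) (quotientCompQhIso C)
  rw [ShiftedHom.mk₀_comp, ShiftedHom.comp_mk₀, ShiftedHom.comp_map] at h1
  have h2 : (resolutionIso M).hom⟦(n : ℤ)⟧' =
      ((quotientCompQhIso C).hom.app (extendInt M.cocomplex))⟦(n : ℤ)⟧' ≫
        (inv (Q.map (resolutionAug M)))⟦(n : ℤ)⟧' := Functor.map_comp _ _ _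
  rw [ShiftedHom.mk₀_comp, ShiftedHom.comp_mk₀, h2]
  refine (Category.id_comp _).trans ?_
  refine (congrArg (fun y => ShiftedHom.map (CochainComplex.HomComplex.Cocycle.equivHomShift.symm
    (singleCocycle φ hφ)) Q ≫ y⟦(n : ℤ)⟧') (Category.comp_id (inv (Q.map (resolutionAug M))))).trans ?_
  rw [← h1, Category.assoc, Category.assoc]
  rfl

/-- The triangle is wanted in the homotopy category, where every additive functor acts on it, and
for unrelated resolutions M, J, N. The extension class lifts to u because M is K-injective. The
third vertex E of a triangle on u is isomorphic to S.X₂, hence to J, in the derived category, and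
this isomorphism lifts since E and J are both right orthogonal to acyclic complexes. -/
theorem exists_resolution_triangle [HasExt.{w'} C] {S : ShortComplex C} (hS : S.ShortExact)
    (M : InjectiveResolution S.X₁) (J : InjectiveResolution S.X₂) (N : InjectiveResolution S.X₃) :
    ∃ (i : htpy M.cocomplex ⟶ htpy J.cocomplex) (p : htpy J.cocomplex ⟶ htpy N.cocomplex)
      (u : htpy N.cocomplex ⟶ (htpy M.cocomplex)⟦(1 : ℤ)⟧),
      Triangle.mk i p u ∈ distTriang (HomotopyCategory C (ComplexShape.up ℤ)) ∧
      ShiftedHom.map u Qh = (resolutionIso N).hom ≫ hS.singleδ ≫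
        (resolutionIso M).inv⟦(1 : ℤ)⟧' := by
  obtain ⟨u, hu⟩ := (map_Qh_bijective (htpy N.cocomplex) (extendInt M.cocomplex) 1).surjective
    ((resolutionIso N).hom ≫ hS.singleδ ≫ (resolutionIso M).inv⟦(1 : ℤ)⟧')
  obtain ⟨E, i, p, hT⟩ := distinguished_cocone_triangle₂ u
  have hortho : ∀ {A : C} (I : InjectiveResolution A),
      (HomotopyCategory.subcategoryAcyclic C).rightOrthogonal (htpy I.cocomplex) := fun I =>
    CochainComplex.IsKInjective.rightOrthogonal (extendInt I.cocomplex)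
  -- Right orthogonality to acyclic complexes is inherited by the middle vertex of a triangle.
  have hE : (HomotopyCategory.subcategoryAcyclic C).rightOrthogonal E :=
    ObjectProperty.ext_of_isTriangulatedClosed₂ _ _ hT (hortho M) (hortho N)
  have hQT : Triangle.mk (Qh.map i) (Qh.map p) (ShiftedHom.map u Qh) ∈ distTriang _ :=
    Qh.map_distinguished _ hT
  have hST : Triangle.mk ((singleFunctor C 0).map S.f) ((singleFunctor C 0).map S.g) hS.singleδ ∈
    distTriang _ := hS.singleTriangle_distinguished
  have hcomm : ShiftedHom.map u Qh ≫ (resolutionIso M).hom⟦(1 : ℤ)⟧' =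
      (resolutionIso N).hom ≫ hS.singleδ := by
    have hu' : ShiftedHom.map u Qh = _ := hu
    rw [hu', Category.assoc, Category.assoc, ← Functor.map_comp, Iso.inv_hom_id,
      CategoryTheory.Functor.map_id, Category.comp_id]
  obtain ⟨e, he₁, he₂⟩ : ∃ e : Qh.obj E ⟶ (singleFunctor C 0).obj S.X₂,
      Qh.map i ≫ e = (resolutionIso M).hom ≫ (singleFunctor C 0).map S.f ∧
      Qh.map p ≫ (resolutionIso N).hom = e ≫ (singleFunctor C 0).map S.g :=
    complete_distinguished_triangle_morphism₂ _ _ hQT hST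
    (resolutionIso M).hom (resolutionIso N).hom hcomm
  let Φ : Triangle.mk (Qh.map i) (Qh.map p) (ShiftedHom.map u Qh) ⟶
      Triangle.mk ((singleFunctor C 0).map S.f) ((singleFunctor C 0).map S.g) hS.singleδ :=
    { hom₁ := (resolutionIso M).hom
      hom₂ := e
      hom₃ := (resolutionIso N).hom
      comm₁ := he₁
      comm₂ := he₂
      comm₃ := hcomm }
  have : IsIso e := isIso₂_of_isIso₁₃ Φ hQT hST
    (show IsIso (resolutionIso M).hom from inferInstance)
    (show IsIso (resolutionIso N).hom from inferInstance)
  -- Lifts of the isomorphism and of its inverse; faithfulness on morphisms into E and into J makes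
  -- them mutually inverse.
  obtain ⟨r, hr⟩ := (CochainComplex.IsKInjective.Qh_map_bijective E
    (extendInt J.cocomplex)).surjective (e ≫ (resolutionIso J).inv)
  obtain ⟨r', hr'⟩ := (ObjectProperty.rightOrthogonal.map_bijective_of_isTriangulated hE
    Qh (htpy J.cocomplex)).surjective ((resolutionIso J).hom ≫ inv e)
  have h1 : r ≫ r' = 𝟙 E := by
    apply (ObjectProperty.rightOrthogonal.map_bijective_of_isTriangulated hE Qh E).injective
    rw [Functor.map_comp, hr, hr', CategoryTheory.Functor.map_id]
    simp
  have h2 : r' ≫ r = 𝟙 _ := by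
    apply (CochainComplex.IsKInjective.Qh_map_bijective _ (extendInt J.cocomplex)).injective
    rw [Functor.map_comp, hr, hr', CategoryTheory.Functor.map_id]
    simp
  let ρ : E ≅ htpy J.cocomplex := ⟨r, r', h1, h2⟩
  refine ⟨i ≫ ρ.hom, ρ.inv ≫ p, u, ?_, hu⟩
  refine isomorphic_distinguished _ hT _ (Triangle.isoMk _ _ (Iso.refl _) ρ.symm (Iso.refl _)
    ?_ ?_ ?_)
  · change (i ≫ ρ.hom) ≫ ρ.inv = 𝟙 _ ≫ i
    rw [Category.assoc, Iso.hom_inv_id, Category.comp_id]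
    exact (Category.id_comp _).symm
  · exact Category.comp_id _
  · exact (congrArg (u ≫ ·) (CategoryTheory.Functor.map_id _ _)).trans
      ((Category.comp_id _).trans (Category.id_comp _).symm)

end ResolutionTriangle

/-! ### The coboundary as composition with u -/

section ConnectingHomomorphism

open Limits Pretriangulated Triangulated DerivedCategory Abelian

universe v w w'

variable {C : Type u} [Category.{v} C] [Abelian C] [HasDerivedCategory.{w} C]

/-- Since u maps to the extension class, conjugated by the resolutions, a cocycle ψ representing the
composite of φ and u represents the coboundary of the class of φ. -/
theorem extMk_comp_extClass [HasExt.{w'} C] {S : ShortComplex C} (hS : S.ShortExact)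
    (M : InjectiveResolution S.X₁) (N : InjectiveResolution S.X₃)
    (u : htpy N.cocomplex ⟶ (htpy M.cocomplex)⟦(1 : ℤ)⟧)
    (hu : ShiftedHom.map u Qh = (resolutionIso N).hom ≫ hS.singleδ ≫
      (resolutionIso M).inv⟦(1 : ℤ)⟧') {Z : C} {n : ℕ}
    (φ : Z ⟶ N.cocomplex.X n) (hφ : φ ≫ N.cocomplex.d n (n + 1) = 0)
    (ψ : Z ⟶ M.cocomplex.X (n + 1)) (hψ : ψ ≫ M.cocomplex.d (n + 1) (n + 1 + 1) = 0)
    (hn : (1 : ℤ) + (n : ℤ) = ((n + 1 : ℕ) : ℤ))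
    (h : htpyClass ψ hψ = ShiftedHom.comp (htpyClass φ hφ) u hn) :
    M.extMk ψ (n + 1 + 1) rfl hψ = (N.extMk φ (n + 1) rfl hφ).comp hS.extClass rfl := by
  apply Ext.ext
  rw [Ext.comp_hom, hS.extClass_hom, extMk_hom_eq, extMk_hom_eq]
  have h1 : derClass ψ hψ = ShiftedHom.comp (derClass φ hφ) ((resolutionIso N).hom ≫ hS.singleδ ≫
      (resolutionIso M).inv⟦(1 : ℤ)⟧') hn := by
    rw [← hu, derClass, h, ShiftedHom.map_comp]
    rfl
  rw [h1]
  have h2 : ShiftedHom.comp (derClass φ hφ) ((resolutionIso N).hom ≫ hS.singleδ ≫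
      (resolutionIso M).inv⟦(1 : ℤ)⟧') hn =
      ShiftedHom.comp (Z := der M.cocomplex) (derClass φ hφ)
        (((resolutionIso N).hom ≫ hS.singleδ) ≫ (resolutionIso M).inv⟦(1 : ℤ)⟧') hn := by
    rw [Category.assoc]
  rw [h2, shiftedHom_comp_shift, Category.assoc, ← Functor.map_comp, Iso.inv_hom_id,
    CategoryTheory.Functor.map_id, Category.comp_id]
  refine Eq.trans ?_ (shiftedHom_precomp _ _ _ _).symm
  congr 1
  exact (shiftedHom_comp_map _ _ _ _).symm

end ConnectingHomomorphism

/-! ### Additive functors and classes of cocycles -/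

section FunctorOnClasses

open Limits CochainComplex HomComplex

universe v u' v' w

variable {C : Type u} [Category.{v} C] [Abelian C] {D : Type u'} [Category.{v'} D] [Abelian D]
  (F : C ⥤ D) [F.Additive]

/-- The functor `F` on complexes indexed by `ℕ`. -/
noncomputable abbrev mapNat (K : CochainComplex C ℕ) : CochainComplex D ℕ :=
  (F.mapHomologicalComplex (ComplexShape.up ℕ)).obj K

/-- An additive functor commutes with extension by zero, in each degree. -/
noncomputable def extendXMap (K : CochainComplex C ℕ) : ∀ o : Option ℕ,
    HomologicalComplex.extend.X (mapNat F K) o ≅ F.obj (HomologicalComplex.extend.X K o)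
  | some _ => Iso.refl _
  | none => (isZero_zero D).iso (F.map_isZero (isZero_zero C))

theorem extendXMap_comm (K : CochainComplex C ℕ) (i j : Option ℕ) :
    (extendXMap F K i).hom ≫ F.map (HomologicalComplex.extend.d K i j) =
      HomologicalComplex.extend.d (mapNat F K) i j ≫ (extendXMap F K j).hom := by
  rcases i with _ | i
  · exact (isZero_zero D).eq_of_src _ _
  · rcases j with _ | j
    · exact (F.map_isZero (isZero_zero C)).eq_of_tgt _ _
    · exact (Category.id_comp _).trans (Category.comp_id _).symm

/-- An additive functor commutes with extension by zero. -/
noncomputable def extendIntMapIso (K : CochainComplex C ℕ) :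
    extendInt (mapNat F K) ≅ (F.mapHomologicalComplex (ComplexShape.up ℤ)).obj (extendInt K) :=
  HomologicalComplex.Hom.isoOfComponents
    (fun i => extendXMap F K (ComplexShape.embeddingUpNat.r i))
    (fun _ _ _ => extendXMap_comm F K _ _)

theorem extendXMap_XIso (K : CochainComplex C ℕ) {o : Option ℕ} {n : ℕ} (h : o = some n) :
    (HomologicalComplex.extend.XIso (mapNat F K) h).inv ≫ (extendXMap F K o).hom =
      F.map (HomologicalComplex.extend.XIso K h).inv := by
  subst h
  refine (Category.comp_id _).trans ?_
  exact (F.map_id _).symm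

theorem extendIntXIso_inv_comp (K : CochainComplex C ℕ) (n : ℕ) :
    (extendIntXIso (mapNat F K) n).inv ≫ (extendIntMapIso F K).hom.f (n : ℤ) =
      F.map (extendIntXIso K n).inv :=
  extendXMap_XIso F K (ComplexShape.embeddingUpNat.r_f n)

variable {Z : C} {K : CochainComplex C ℕ} {n : ℕ}

theorem equivHomShift_singleCocycle_f (f : Z ⟶ K.X n) (hf : f ≫ K.d n (n + 1) = 0) :
    (Cocycle.equivHomShift.symm (singleCocycle f hf)).f 0 =
      (HomologicalComplex.singleObjXSelf (ComplexShape.up ℤ) 0 Z).hom ≫ f ≫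
        (extendIntXIso K n).inv ≫ ((extendInt K).XIsoOfEq (zero_add (n : ℤ)).symm).hom := by
  rw [Cocycle.equivHomShift_symm_apply]
  simp [singleCocycle, Cochain.rightShift_v _ (n : ℤ) 0 (zero_add _) 0 0 (add_zero 0) (n : ℤ) (zero_add _)]
  exact (Category.assoc _ _ _).trans (congrArg (_ ≫ ·) (Category.assoc _ _ _))

theorem map_iso_inv_comp {C D : Type*} [Category C] [Category D] (F : C ⥤ D) {S' E E' : D}
    {S Z K K' : C} (s' : S' ⟶ F.obj Z) (s : S ≅ Z) (f : Z ⟶ K) (k : K ⟶ K') (e : F.obj K ⟶ E)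
    (e' : E ⟶ E') (κ : E' ⟶ F.obj K') (h : e ≫ e' ≫ κ = F.map k) :
    (s' ≫ F.map s.inv) ≫ F.map (s.hom ≫ f ≫ k) = (s' ≫ F.map f ≫ e ≫ e') ≫ κ := by
  simp only [Category.assoc, h, ← F.map_comp, Iso.inv_hom_id_assoc]

/-- The comparison of `F Z`, in degree zero, with the image under `F` of `Z` in degree zero. -/
noncomputable def singleMapIso (Z : C) :
    (CochainComplex.singleFunctor D 0).obj (F.obj Z) ≅
      (F.mapHomologicalComplex (ComplexShape.up ℤ)).obj ((CochainComplex.singleFunctor C 0).obj Z) :=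
  ((HomologicalComplex.singleMapHomologicalComplex F (ComplexShape.up ℤ) 0).app Z).symm

/-- A morphism out of a complex concentrated in degree 0 is determined in that degree, where the
claim is that F commutes with composition. -/
theorem singleMapIso_comp_map (f : Z ⟶ K.X n) (hf : f ≫ K.d n (n + 1) = 0)
    (hf' : F.map f ≫ (mapNat F K).d n (n + 1) = 0) :
    (singleMapIso F Z).hom ≫ ShiftedHom.map (Cocycle.equivHomShift.symm (singleCocycle f hf))
      (F.mapHomologicalComplex (ComplexShape.up ℤ)) =
    Cocycle.equivHomShift.symm (singleCocycle (K := mapNat F K) (F.map f) hf') ≫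
      (extendIntMapIso F K).hom⟦(n : ℤ)⟧' := by
  apply HomologicalComplex.from_single_hom_ext
  have h1 : (singleMapIso F Z).hom.f 0 =
      (HomologicalComplex.singleObjXSelf (ComplexShape.up ℤ) 0 (F.obj Z)).hom ≫
        F.map (HomologicalComplex.singleObjXSelf (ComplexShape.up ℤ) 0 Z).inv :=
    HomologicalComplex.singleMapHomologicalComplex_inv_app_self F _ _ _
  have h2 : ∀ (i : ℤ) (h : (n : ℤ) = i),
      (extendIntXIso (mapNat F K) n).inv ≫ ((extendInt (mapNat F K)).XIsoOfEq h).hom ≫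
        (extendIntMapIso F K).hom.f i =
      F.map (extendIntXIso K n).inv ≫ F.map ((extendInt K).XIsoOfEq h).hom := by
    rintro _ rfl
    simpa using extendIntXIso_inv_comp F K n
  refine (HomologicalComplex.comp_f _ _ _).trans (Eq.trans ?_ (HomologicalComplex.comp_f _ _ _).symm)
  have h4 : (ShiftedHom.map (Cocycle.equivHomShift.symm (singleCocycle f hf))
      (F.mapHomologicalComplex (ComplexShape.up ℤ))).f 0 =
      F.map ((Cocycle.equivHomShift.symm (singleCocycle f hf)).f 0) := Category.comp_id _
  have h5 : ((extendIntMapIso F K).hom⟦(n : ℤ)⟧').f 0 = (extendIntMapIso F K).hom.f (0 + n) := rfl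
  rw [equivHomShift_singleCocycle_f] at h4
  refine (congrArg₂ (· ≫ ·) h1 h4).trans (Eq.trans ?_
    (congrArg₂ (· ≫ ·) (equivHomShift_singleCocycle_f (K := mapNat F K) (F.map f) hf') h5).symm)
  exact map_iso_inv_comp F _ (HomologicalComplex.singleObjXSelf (ComplexShape.up ℤ) 0 Z) f
    ((extendIntXIso K n).inv ≫ ((extendInt K).XIsoOfEq (zero_add (n : ℤ)).symm).hom) _ _ _
    ((h2 _ _).trans (F.map_comp _ _).symm)

variable [HasDerivedCategory.{w} D]

/-- The functor induced by `F` from the homotopy category of `C` to the derived category of `D`. -/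
noncomputable abbrev htpyToDer : HomotopyCategory C (ComplexShape.up ℤ) ⥤ DerivedCategory D :=
  F.mapHomotopyCategory (ComplexShape.up ℤ) ⋙ DerivedCategory.Qh

/-- The comparison of the values of `htpyToDer F` on `htpy K` with `der (F K)`. -/
noncomputable def derMapNatIso (K : CochainComplex C ℕ) :
    der (mapNat F K) ≅ (htpyToDer F).obj (htpy K) :=
  DerivedCategory.Qh.mapIso ((HomotopyCategory.quotient D _).mapIso (extendIntMapIso F K))

/-- The comparison of the values of `htpyToDer F` on `htpySingle Z` with `derSingle (F Z)`. -/
noncomputable def derSingleMapIso (Z : C) :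
    derSingle (F.obj Z) ≅ (htpyToDer F).obj (htpySingle Z) :=
  DerivedCategory.Qh.mapIso ((HomotopyCategory.quotient D _).mapIso (singleMapIso F Z))

/-- This links the concrete cocycle F(f) with the functor `htpyToDer F`, which can be applied to
triangles in the homotopy category. -/
theorem derClass_map (f : Z ⟶ K.X n) (hf : f ≫ K.d n (n + 1) = 0)
    (hf' : F.map f ≫ (mapNat F K).d n (n + 1) = 0) :
    derClass (K := mapNat F K) (F.map f) hf' ≫ (derMapNatIso F K).hom⟦(n : ℤ)⟧' =
      (derSingleMapIso F Z).hom ≫ ShiftedHom.map (htpyClass f hf) (htpyToDer F) := by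
  let q := HomotopyCategory.quotient D (ComplexShape.up ℤ)
  let S := Cocycle.equivHomShift.symm (singleCocycle f hf)
  have h1 : ShiftedHom.map (htpyClass f hf) (F.mapHomotopyCategory (ComplexShape.up ℤ)) =
      ShiftedHom.map (ShiftedHom.map S (F.mapHomologicalComplex (ComplexShape.up ℤ))) q := by
    have h2 := ShiftedHom.map_naturality S
      (F.mapHomotopyCategoryFactors (ComplexShape.up ℤ)).hom
    rw [ShiftedHom.comp_mk₀, ShiftedHom.mk₀_comp, ShiftedHom.comp_map, ShiftedHom.comp_map] at h2
    refine Eq.trans ?_ (h2.trans (Category.id_comp _))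
    exact ((congrArg _ (CategoryTheory.Functor.map_id _ _)).trans (Category.comp_id _)).symm
  rw [ShiftedHom.comp_map, h1]
  have h3 : ShiftedHom.comp (ShiftedHom.mk₀ (0 : ℤ) rfl (singleMapIso F Z).hom)
      (ShiftedHom.map S (F.mapHomologicalComplex (ComplexShape.up ℤ))) (add_zero _) =
      ShiftedHom.comp (M := ℤ) (a := (n : ℤ))
        (Cocycle.equivHomShift.symm (singleCocycle (K := mapNat F K) (F.map f) hf'))
        (ShiftedHom.mk₀ (0 : ℤ) rfl (extendIntMapIso F K).hom) (zero_add _) := by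
    rw [ShiftedHom.comp_mk₀, ShiftedHom.mk₀_comp]
    exact singleMapIso_comp_map F f hf hf'
  have h4 := congrArg (fun x => ShiftedHom.map (ShiftedHom.map x q) DerivedCategory.Qh) h3
  simp only [ShiftedHom.map_comp, ShiftedHom.map_mk₀] at h4
  rw [ShiftedHom.mk₀_comp, ShiftedHom.comp_mk₀] at h4
  exact h4.symm

end FunctorOnClasses

/-- A morphism of degree 1 out of A ≅ A'⟦1⟧ is a shift of a morphism out of A', because the shift is
full. A factorization through A thus becomes one through A' in the next degree. -/
theorem exists_comp_eq {T : Type*} [Category T] [HasShift T ℤ] {Z A N M A' : T} {n n' : ℤ}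
    (a : Z ⟶ A⟦n⟧) (b : A ⟶ N) (w : ShiftedHom N M (1 : ℤ)) (e : A'⟦(1 : ℤ)⟧ ≅ A)
    (hn : 1 + n = n') :
    ∃ (a' : Z ⟶ A'⟦n'⟧) (b' : A' ⟶ M),
      ShiftedHom.comp (Y := N) (a ≫ b⟦n⟧') w hn = a' ≫ b'⟦n'⟧' := by
  obtain ⟨b', hb'⟩ := (shiftFunctor T (1 : ℤ)).map_surjective (e.hom ≫ b ≫ w)
  refine ⟨a ≫ e.inv⟦n⟧' ≫ (shiftFunctorAdd' T 1 n n' hn).inv.app A', b', ?_⟩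
  have h1 := (shiftFunctorAdd' T 1 n n' hn).inv.naturality b'
  dsimp only [Functor.comp_map] at h1
  rw [Category.assoc, Category.assoc, ← h1, hb', ← Functor.map_comp_assoc, Iso.inv_hom_id_assoc]
  simp [ShiftedHom.comp]

theorem eq_comp_shift_of_comp_hom {T : Type*} [Category T] [HasShift T ℤ] {Z A B P : T} {n : ℤ}
    {x : Z ⟶ A⟦n⟧} (e : A ≅ B) {c : Z ⟶ P⟦n⟧} {d : P ⟶ B} (h : x ≫ e.hom⟦n⟧' = c ≫ d⟦n⟧') :
    x = c ≫ (d ≫ e.inv)⟦n⟧' := by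
  rw [Functor.map_comp, ← Category.assoc, ← h, Category.assoc, ← Functor.map_comp,
    Iso.hom_inv_id, CategoryTheory.Functor.map_id, Category.comp_id]

/-! ### The connecting morphism preserves and reflects the filtration -/

section FiltrationOfConnecting

open Limits Pretriangulated Triangulated CochainComplex

universe v u' v' w

variable {C : Type u} [Category.{v} C] [Abelian C] {D : Type u'} [Category.{v'} D] [Abelian D]
  (F : C ⥤ D) [F.Additive] {Z : C} {Z' : D} (j : Z' ⟶ F.obj Z)

/-- The map `j ≫ F.map f` with values in the complex `F K`. -/
noncomputable def compMap {K : CochainComplex C ℕ} {n : ℕ} (f : Z ⟶ K.X n) : Z' ⟶ (mapNat F K).X n :=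
  j ≫ F.map f

theorem compMap_d {K : CochainComplex C ℕ} {n : ℕ} {f : Z ⟶ K.X n}
    (hf : f ≫ K.d n (n + 1) = 0) : compMap F j f ≫ (mapNat F K).d n (n + 1) = 0 := by
  refine (Category.assoc _ _ _).trans ?_
  refine (congrArg (j ≫ ·) ((F.map_comp _ _).symm.trans (congrArg F.map hf))).trans ?_
  exact (congrArg (j ≫ ·) (F.map_zero _ _)).trans comp_zero

variable [HasDerivedCategory.{w} D]

/-- The map `j`, in the derived category. -/
noncomputable def derSingleTo : derSingle Z' ⟶ (htpyToDer F).obj (htpySingle Z) :=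
  DerivedCategory.Qh.map ((HomotopyCategory.quotient D (ComplexShape.up ℤ)).map
    ((CochainComplex.singleFunctor D 0).map j)) ≫ (derSingleMapIso F Z).hom

theorem derClass_comp_map {K : CochainComplex C ℕ} {n : ℕ} {f : Z ⟶ K.X n}
    (hf : f ≫ K.d n (n + 1) = 0) :
    derClass (compMap F j f) (compMap_d F j hf) ≫
      (derMapNatIso F K).hom⟦(n : ℤ)⟧' =
      derSingleTo F j ≫ ShiftedHom.map (htpyClass f hf) (htpyToDer F) := by
  have hf' : F.map f ≫ (mapNat F K).d n (n + 1) = 0 :=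
    ((F.map_comp _ _).symm.trans (congrArg F.map hf)).trans (F.map_zero _ _)
  rw [derSingleTo, Category.assoc, ← derClass_map F f hf hf']
  have h1 : ShiftedHom.comp (ShiftedHom.mk₀ (0 : ℤ) rfl
      ((HomotopyCategory.quotient D (ComplexShape.up ℤ)).map
        ((CochainComplex.singleFunctor D 0).map j))) (htpyClass (K := mapNat F K) (F.map f) hf')
      (add_zero _) = htpyClass (compMap F j f) (compMap_d F j hf) :=
    htpyClass_precomp j (K := mapNat F K) (F.map f) hf' (compMap_d F j hf)
  rw [derClass, ← h1, ShiftedHom.map_comp, ShiftedHom.map_mk₀, ShiftedHom.mk₀_comp, Category.assoc]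
  rfl

variable {M J N : CochainComplex C ℕ} (u : htpy N ⟶ (htpy M)⟦(1 : ℤ)⟧) {n : ℕ}
  {φ : Z ⟶ N.X n} (hφ : φ ≫ N.d n (n + 1) = 0)
  {ψ : Z ⟶ M.X (n + 1)} (hψ : ψ ≫ M.d (n + 1) (n + 1 + 1) = 0)
  (hn : (1 : ℤ) + (n : ℤ) = ((n + 1 : ℕ) : ℤ))
  (h : htpyClass ψ hψ = ShiftedHom.comp (htpyClass φ hφ) u hn)

include h

theorem derClass_comp_map_connecting :
    derClass (compMap F j ψ) (compMap_d F j hψ) ≫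
      (derMapNatIso F M).hom⟦((n + 1 : ℕ) : ℤ)⟧' =
      ShiftedHom.comp (derClass (compMap F j φ) (compMap_d F j hφ))
        ((derMapNatIso F N).hom ≫ ShiftedHom.map u (htpyToDer F)) hn := by
  rw [derClass_comp_map F j hψ, h, ShiftedHom.map_comp, ← shiftedHom_precomp, ← derClass_comp_map,
    shiftedHom_comp_map]

variable (RM : CartanEilenbergResolution (mapNat F M)) (RN : CartanEilenbergResolution (mapNat F N))

/-- With k+m = n, a factorization through A ≤ m becomes one through A⟦-1⟧ ≤ m+1, and k+(m+1) = n+1.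
For k > n the class is zero. -/
theorem memFiltration_connecting {k : ℕ}
    (hk : RN.MemFiltration (compMap F j φ) k) : RM.MemFiltration (compMap F j ψ) k := by
  have h1 := derClass_comp_map_connecting F j u hφ hψ hn h
  rcases le_or_gt k n with hkn | hkn
  · obtain ⟨m, rfl⟩ := Nat.exists_eq_add_of_le hkn
    obtain ⟨A, hA, a, b, hab⟩ := hk.exists_factor rfl (compMap_d F j hφ)
    have hA' : DerivedCategory.TStructure.t.IsLE (A⟦(-1 : ℤ)⟧) ((m + 1 : ℕ) : ℤ) :=
      DerivedCategory.TStructure.t.isLE_shift A m (-1) ((m + 1 : ℕ) : ℤ) (by push_cast; ring)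
    obtain ⟨a', b', h2⟩ := exists_comp_eq a b
      ((derMapNatIso F N).hom ≫ ShiftedHom.map u (htpyToDer F))
      ((shiftFunctorCompIsoId (DerivedCategory D) (-1 : ℤ) 1 (by simp)).app A) hn
    rw [← hab, ← h1] at h2
    refine RM.memFiltration_of_factor (m := m + 1) (by lia) (compMap_d F j hψ) hA' a'
      (b' ≫ (derMapNatIso F M).inv) ?_
    exact eq_comp_shift_of_comp_hom (derMapNatIso F M) h2
  · refine RM.memFiltration_of_derClass_eq_zero k (compMap_d F j hψ) ?_
    rwa [hk.derClass_eq_zero hkn (compMap_d F j hφ), ShiftedHom.zero_comp,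
      Preadditive.IsIso.comp_right_eq_zero] at h1

/-- This is `exists_factor_of_comp_factor_shift` for the image under F of the triangle on M, J, N.
The bound k ≤ n makes m = n-k nonnegative, so that FJ ≤ 0 is also ≤ m. -/
theorem memFiltration_of_connecting (hJ : (der (mapNat F J)).IsLE 0)
    (hZ : ∀ x : ShiftedHom (derSingle Z') (der (mapNat F J)) (n : ℤ), x = 0)
    {i : htpy M ⟶ htpy J} {p : htpy J ⟶ htpy N} 
    (hT : Triangle.mk i p u ∈ distTriang (HomotopyCategory C (ComplexShape.up ℤ)))
    {k : ℕ} (hk : RM.MemFiltration (compMap F j ψ) k) (hkn : k ≤ n) :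
    RN.MemFiltration (compMap F j φ) k := by
  have h1 := derClass_comp_map_connecting F j u hφ hψ hn h
  obtain ⟨m, rfl⟩ := Nat.exists_eq_add_of_le hkn
  obtain ⟨L, hL, a, b, hab⟩ := hk.exists_factor (m := m + 1) (by lia) (compMap_d F j hψ)
  have hS := (htpyToDer F).map_distinguished _ hT
  obtain ⟨P, hP, c, d, hcd⟩ := exists_factor_of_comp_factor_shift DerivedCategory.TStructure.t
    ((htpyToDer F).mapTriangle.obj (Triangle.mk i p u)) hS (m := m) (by simp) 
    (DerivedCategory.TStructure.t.isLE_of_iso (derMapNatIso F J) 0) _ _ hn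
    (fun g => by
      refine (eq_comp_shift_of_comp_hom (derMapNatIso F J).symm (P := der (mapNat F J)) (c := 0)
        (d := 0) ((hZ _).trans zero_comp.symm)).trans zero_comp)
    (by exact_mod_cast hL)
    (derClass (compMap F j φ) (compMap_d F j hφ) ≫
      (derMapNatIso F N).hom⟦((k + m : ℕ) : ℤ)⟧') a (b ≫ (derMapNatIso F M).hom) (by
      rw [hab, Category.assoc, ← Functor.map_comp] at h1
      refine Eq.trans ?_ h1.symm
      exact shiftedHom_comp_map (Y' := (htpyToDer F).obj (htpy N)) _ _ _ _)
  refine RN.memFiltration_of_factor rfl (compMap_d F j hφ) hP c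
    (d ≫ (derMapNatIso F N).inv) ?_
  exact eq_comp_shift_of_comp_hom (derMapNatIso F N) hcd

end FiltrationOfConnecting

/-! ### Continuous additive cocycles split -/

section PartitionOfUnityCousin

/-- Take h_i = Σ_k ρ_k c_{ik}, extended by zero outside V_k. The cocycle identity gives h_i - h_j =
Σ_k ρ_k c_{ij} = c_{ij}. -/
theorem exists_cochain_of_cocycle {X : Type*} [TopologicalSpace X] (U : Opens X) [T2Space U]
    [ParacompactSpace U] {ι : Type*} (V : ι → Opens X) (hVU : ∀ i, V i ≤ U) (hUV : U ≤ iSup V)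
    (c : ∀ i j, C((V i ⊓ V j : Opens X), ℂ))
    (hc : ∀ (i j k : ι) (x : X) (hi : x ∈ V i) (hj : x ∈ V j) (hk : x ∈ V k),
      c i j ⟨x, hi, hj⟩ + c j k ⟨x, hj, hk⟩ = c i k ⟨x, hi, hk⟩) :
    ∃ h : ∀ i, C(V i, ℂ), ∀ (i j : ι) (x : X) (hi : x ∈ V i) (hj : x ∈ V j),
      h i ⟨x, hi⟩ - h j ⟨x, hj⟩ = c i j ⟨x, hi, hj⟩ := by
  classical
  obtain ⟨ρ, hρ⟩ := PartitionOfUnity.exists_isSubordinate (X := U) isClosed_univ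
    (fun i => (Subtype.val ⁻¹' (V i : Set X) : Set U))
    (fun i => (V i).isOpen.preimage continuous_subtype_val)
    (fun x _ => by
      obtain ⟨i, hi⟩ := Opens.mem_iSup.mp (hUV x.2)
      exact Set.mem_iUnion.mpr ⟨i, hi⟩)
  let e : ∀ i k, V i → ℂ := fun i k y =>
    if h : y.1 ∈ V k then c i k ⟨y.1, y.2, h⟩ else 0
  let t : ∀ i k, V i → ℂ := fun i k y => ρ k ⟨y.1, hVU i y.2⟩ • e i k y
  have ht : ∀ i k, Continuous (t i k) := by
    intro i k
    rw [continuous_iff_continuousAt]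
    intro y
    by_cases hy : y.1 ∈ V k
    · have hρc : Continuous fun z : V i => ρ k ⟨z.1, hVU i z.2⟩ :=
        (ρ k).continuous.comp (continuous_subtype_val.subtype_mk _)
      refine hρc.continuousAt.smul ?_
      have ho : IsOpen {z : V i | z.1 ∈ V k} := (V k).isOpen.preimage continuous_subtype_val
      apply ContinuousOn.continuousAt (s := {z : V i | z.1 ∈ V k}) _ (ho.mem_nhds hy)
      rw [continuousOn_iff_continuous_domRestrict]
      have : Continuous (fun z : {z : V i | z.1 ∈ V k} => c i k ⟨z.1.1, z.1.2, z.2⟩) :=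
        (c i k).continuous.comp (by fun_prop)
      convert this using 2 with z
      exact dif_pos z.2
    -- Outside V_k the function ρ_k vanishes in a whole neighbourhood, because its closed support
    -- lies in V_k; so extension by zero is continuous.
    · have hy' : (⟨y.1, hVU i y.2⟩ : U) ∉ tsupport (ρ k) := fun h => hy (hρ k h)
      have h1 : ρ k =ᶠ[nhds (⟨y.1, hVU i y.2⟩ : U)] 0 := notMem_tsupport_iff_eventuallyEq.mp hy'
      have hcont : Filter.Tendsto (fun z : V i => (⟨z.1, hVU i z.2⟩ : U)) (nhds y)
          (nhds ⟨y.1, hVU i y.2⟩) :=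
        Continuous.tendsto (f := fun z : V i => (⟨z.1, hVU i z.2⟩ : U)) (by fun_prop) y
      have h2 : t i k =ᶠ[nhds y] fun _ => 0 := by
        filter_upwards [hcont.eventually h1] with z hz
        simp only [t]
        rw [hz]
        simp
      exact continuousAt_const.congr h2.symm
  have hfin : ∀ i, LocallyFinite fun k => Function.support (t i k) := by
    intro i
    have := ρ.locallyFinite.preimage_continuous
      (g := fun z : V i => (⟨z.1, hVU i z.2⟩ : U)) (by fun_prop)
    refine this.subset fun k z hz => ?_
    simp only [Function.mem_support, t] at hz
    exact left_ne_zero_of_smul hz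
  refine ⟨fun i => ⟨fun y => ∑ᶠ k, t i k y, continuous_finsum (ht i) (hfin i)⟩, ?_⟩
  intro i j x hi hj
  change (∑ᶠ k, t i k ⟨x, hi⟩) - (∑ᶠ k, t j k ⟨x, hj⟩) = _
  rw [← finsum_sub_distrib ((hfin i).point_finite _) ((hfin j).point_finite _)]
  have h1 : ∀ k, t i k ⟨x, hi⟩ - t j k ⟨x, hj⟩ =
      ρ k ⟨x, hVU i hi⟩ • c i j ⟨x, hi, hj⟩ := by
    intro k
    by_cases hk : x ∈ V k
    · simp only [t, e, dif_pos hk]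
      rw [← smul_sub, ← hc i j k x hi hj hk, add_sub_cancel_right]
    · have : ρ k ⟨x, hVU i hi⟩ = 0 := by
        by_contra hne
        exact hk (hρ k (subset_tsupport _ hne))
      simp [t, this]
  simp_rw [h1]
  rw [← finsum_smul' (ρ.locallyFinite.point_finite _), ρ.sum_eq_one (Set.mem_univ _), one_smul]

end PartitionOfUnityCousin

/-! ### Injective sheaves are flasque; lifting sections modulo the sheaf ℂ -/

section InjectiveSheaves

open Limits

variable {X : TopCat.{u}}

/-- A section over V is a morphism from the free abelian presheaf on V. For V ⊆ U this presheaf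
embeds in the one on U, and F is also injective as a presheaf, sheafification being an exact left
adjoint; so the morphism extends. -/
theorem isFlasque_of_injective (F : TopCat.Sheaf AddCommGrpCat.{u} X) [Injective F] :
    F.IsFlasque where
  epi {U V} i := by
    have hF' : Injective (C := CategoryTheory.Sheaf (Opens.grothendieckTopology X)
      AddCommGrpCat.{u}) F := ‹Injective F›
    have hF : Injective F.obj := Injective.injective_of_adjoint
      (sheafificationAdjunction (Opens.grothendieckTopology X) AddCommGrpCat.{u}) F
    let m : yoneda.obj V.unop ⋙ AddCommGrpCat.free.{u} ⟶ yoneda.obj U.unop ⋙ AddCommGrpCat.free :=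
      Functor.whiskerRight (yoneda.map i.unop) _
    have hm : Mono m := by
      have : ∀ W, Mono (m.app W) := by
        intro W
        have : Mono ((yoneda.map i.unop).app W) := by
          rw [mono_iff_injective]
          intro a b _
          exact Subsingleton.elim (α := W.unop ⟶ V.unop) a b
        exact inferInstanceAs (Mono (AddCommGrpCat.free.map ((yoneda.map i.unop).app W)))
      exact NatTrans.mono_of_mono_app _
    rw [AddCommGrpCat.epi_iff_surjective]
    intro s
    let q : yoneda.obj V.unop ⋙ AddCommGrpCat.free.{u} ⟶ F.obj :=
      { app := fun W => AddCommGrpCat.ofHom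
          (FreeAbelianGroup.lift fun k : W.unop ⟶ V.unop => F.obj.map k.op s)
        naturality := by
          intro W W' k
          ext : 1
          apply FreeAbelianGroup.lift_ext
          intro l
          change FreeAbelianGroup.lift _ (FreeAbelianGroup.map _ (FreeAbelianGroup.of l)) =
            F.obj.map k (FreeAbelianGroup.lift _ (FreeAbelianGroup.of l))
          rw [FreeAbelianGroup.map_of_apply, FreeAbelianGroup.lift_apply_of,
            FreeAbelianGroup.lift_apply_of]
          exact congrArg (fun g => g s) (F.obj.map_comp (Quiver.Hom.op l) k) }
    let r := Injective.factorThru q m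
    have hr : m ≫ r = q := Injective.comp_factorThru q m
    refine ⟨r.app U (FreeAbelianGroup.of (𝟙 U.unop)), ?_⟩
    have h1 : r.app V (m.app V (FreeAbelianGroup.of (𝟙 V.unop))) = s := by
      have h2 := congrArg (fun a => a.app V (FreeAbelianGroup.of (𝟙 V.unop))) hr
      refine Eq.trans h2 ((FreeAbelianGroup.lift_apply_of _ _).trans ?_)
      exact congrArg (fun g => g s) (F.obj.map_id V)
    have h2 : r.app V ((yoneda.obj U.unop ⋙ AddCommGrpCat.free).map i
        (FreeAbelianGroup.of (𝟙 U.unop))) =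
        F.obj.map i (r.app U (FreeAbelianGroup.of (𝟙 U.unop))) :=
      congrArg (fun a => a (FreeAbelianGroup.of (𝟙 U.unop))) (r.naturality i)
    refine h2.symm.trans (Eq.trans (congrArg _ ?_) h1)
    refine (FreeAbelianGroup.map_of_apply _).trans (Eq.trans ?_ (FreeAbelianGroup.map_of_apply _).symm)
    exact congrArg FreeAbelianGroup.of (Subsingleton.elim (α := V.unop ⟶ U.unop) _ _)

/-- Local lifts of s differ on overlaps by a cocycle of continuous functions. The cocycle splits by
`exists_cochain_of_cocycle`, and the corrected lifts glue. -/
theorem sections_surjective_of_shortExact {U : Opens X} [T2Space U] [ParacompactSpace U]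
    {J G : TopCat.Sheaf AddCommGrpCat.{u} X} (f : contSheaf X ℂ ⟶ J) (g : J ⟶ G) (w : f ≫ g = 0)
    (hS : (ShortComplex.mk f g w).ShortExact) : Function.Surjective (g.hom.app (op U)) := by
  intro s
  have hg : Epi g := hS.epi_g
  have hl := (TopCat.Presheaf.isLocallySurjective_iff g.hom).mp
    ((TopCat.Sheaf.isLocallySurjective_iff_epi g).mpr hg)
  choose V hVU hV hxV using fun x : U => hl U s x.1 x.2
  choose t ht using hV
  have hfg : ∀ (W : Opens X) (x : C(W, ℂ)), g.hom.app (op W) (f.hom.app (op W) x) = 0 :=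
    fun W x => congrArg (fun a : contSheaf X ℂ ⟶ G => a.hom.app (op W) x) w
  have hinj : ∀ W : Opens X, Function.Injective (f.hom.app (op W)) := by
    intro W
    have hf : Mono f := hS.mono_f
    have hf' : Mono f.hom := inferInstanceAs (Mono ((TopCat.Sheaf.forget AddCommGrpCat X).map f))
    rw [NatTrans.mono_iff_mono_app] at hf'
    exact (AddCommGrpCat.mono_iff_injective _).mp (hf' (op W))
  have hres : ∀ {F : TopCat.Sheaf AddCommGrpCat.{u} X} {W₁ W₂ W₃ : Opens X} (a : W₁ ⟶ W₂)
      (b : W₂ ⟶ W₃) (c : W₁ ⟶ W₃) (x : F.obj.obj (op W₃)),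
      F.obj.map a.op (F.obj.map b.op x) = F.obj.map c.op x := by
    intro F W₁ W₂ W₃ a b c x
    rw [Subsingleton.elim c (a ≫ b), op_comp, F.obj.map_comp]
    rfl
  have hnat : ∀ {F F' : TopCat.Sheaf AddCommGrpCat.{u} X} (k : F ⟶ F') {W W' : Opens X}
      (a : W' ⟶ W) (x : F.obj.obj (op W)),
      k.hom.app (op W') (F.obj.map a.op x) = F'.obj.map a.op (k.hom.app (op W) x) :=
    fun k _ _ a x => congrArg (fun b => b x) (k.hom.naturality a.op)
  have ht' : ∀ i, g.hom.app (op (V i)) (t i) = G.obj.map (homOfLE (hVU i)).op s := ht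
  have hc : ∀ i j : U, ∃ c : C((V i ⊓ V j : Opens X), ℂ),
      f.hom.app (op (V i ⊓ V j)) c = J.obj.map (homOfLE inf_le_left : V i ⊓ V j ⟶ V i).op (t i) -
        J.obj.map (homOfLE inf_le_right : V i ⊓ V j ⟶ V j).op (t j) := by
    intro i j
    refine TopCat.Sheaf.sections_exact_of_left_exact hS.exact hS.mono_f _ ?_
    refine (map_sub (g.hom.app _).hom _ _).trans (sub_eq_zero.mpr ?_)
    refine (hnat g _ _).trans (Eq.trans ?_ (hnat g _ _).symm)
    rw [ht', ht', hres _ _ (homOfLE (inf_le_left.trans (hVU i))),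
      hres _ _ (homOfLE (inf_le_left.trans (hVU i)))]
  choose c hc using hc
  have hcW : ∀ (i j : U) (W : Opens X) (h₁ : W ≤ V i) (h₂ : W ≤ V j),
      f.hom.app (op W) ((contPresheaf X ℂ).map (homOfLE (le_inf h₁ h₂)).op (c i j)) =
        J.obj.map (homOfLE h₁).op (t i) - J.obj.map (homOfLE h₂).op (t j) := by
    intro i j W h₁ h₂
    refine (hnat f _ _).trans ?_
    rw [hc, map_sub, hres _ _ (homOfLE h₁), hres _ _ (homOfLE h₂)]
  obtain ⟨h, hh⟩ := exists_cochain_of_cocycle U V hVU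
    (fun x hx => Opens.mem_iSup.mpr ⟨⟨x, hx⟩, hxV _⟩) c (by
      intro i j k x hi hj hk
      let W : Opens X := V i ⊓ (V j ⊓ V k)
      have h₁ : W ≤ V i := inf_le_left
      have h₂ : W ≤ V j := inf_le_right.trans inf_le_left
      have h₃ : W ≤ V k := inf_le_right.trans inf_le_right
      have key := hinj W (a₁ := (contPresheaf X ℂ).map (homOfLE (le_inf h₁ h₂)).op (c i j) +
          (contPresheaf X ℂ).map (homOfLE (le_inf h₂ h₃)).op (c j k))
        (a₂ := (contPresheaf X ℂ).map (homOfLE (le_inf h₁ h₃)).op (c i k)) (by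
          rw [hcW i k W h₁ h₃]
          refine (map_add (f.hom.app _).hom _ _).trans ?_
          refine (congrArg₂ (· + ·) (hcW i j W h₁ h₂) (hcW j k W h₂ h₃)).trans ?_
          exact sub_add_sub_cancel _ _ _)
      exact DFunLike.congr_fun (F := C(W, ℂ)) key ⟨x, hi, hj, hk⟩)
  let t' : ∀ i, J.obj.obj (op (V i)) := fun i => t i - f.hom.app (op (V i)) (h i)
  obtain ⟨r, hr, -⟩ := J.existsUnique_gluing' V U (fun i => homOfLE (hVU i))
    (fun x hx => Opens.mem_iSup.mpr ⟨⟨x, hx⟩, hxV _⟩) t' (by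
      intro i j
      change J.obj.map (homOfLE inf_le_left : V i ⊓ V j ⟶ V i).op
          (t i - f.hom.app (op (V i)) (h i)) =
        J.obj.map (homOfLE inf_le_right : V i ⊓ V j ⟶ V j).op (t j - f.hom.app (op (V j)) (h j))
      rw [map_sub, map_sub, sub_eq_sub_iff_sub_eq_sub, ← hc]
      refine Eq.trans ?_ (congrArg₂ (· - ·) (hnat f _ (h i)) (hnat f _ (h j)))
      refine Eq.trans ?_ (map_sub (f.hom.app (op (V i ⊓ V j))).hom _ _)
      refine congrArg (f.hom.app (op (V i ⊓ V j))).hom (ContinuousMap.ext fun y => ?_)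
      exact (hh i j y.1 y.2.1 y.2.2).symm)
  refine ⟨r, ?_⟩
  refine G.eq_of_locally_eq' V U (fun i => homOfLE (hVU i)) 
    (fun x hx => Opens.mem_iSup.mpr ⟨⟨x, hx⟩, hxV _⟩) _ _ fun i => ?_
  refine (hnat g _ _).symm.trans ((congrArg _ (hr i)).trans ?_)
  refine (map_sub (g.hom.app _).hom _ _).trans ?_
  refine (congrArg₂ (· - ·) (ht' i) (hfg _ (h i))).trans (sub_zero _)

end InjectiveSheaves

/-! ### Splitting an injective resolution into short exact sequences -/

section ResolutionCycles

open Limits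

universe v

variable {C : Type u} [Category.{v} C] [Abelian C] {A : C} (J : InjectiveResolution A)

/-- The factorization of `J^q ⟶ J^(q+1)` through the cocycles. -/
noncomputable def toCocycles (q : ℕ) :
    J.cocomplex.X q ⟶ kernel (J.cocomplex.d (q + 1) (q + 2)) :=
  kernel.lift _ (J.cocomplex.d q (q + 1)) (J.cocomplex.d_comp_d _ _ _)

theorem toCocycles_ι (q : ℕ) :
    toCocycles J q ≫ kernel.ι (J.cocomplex.d (q + 1) (q + 2)) = J.cocomplex.d q (q + 1) :=
  kernel.lift_ι _ _ _

instance epi_toCocycles (q : ℕ) : Epi (toCocycles J q) :=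
  (ShortComplex.exact_iff_epi_kernel_lift _).mp (J.exact_succ q)

theorem exact_toCocycles {B : C} {q : ℕ} (f : B ⟶ J.cocomplex.X q) (w : f ≫ toCocycles J q = 0)
    (w' : f ≫ J.cocomplex.d q (q + 1) = 0) (h : (ShortComplex.mk f _ w').Exact) :
    (ShortComplex.mk f (toCocycles J q) w).Exact := by
  let φ : ShortComplex.mk f (toCocycles J q) w ⟶ ShortComplex.mk f _ w' :=
    { τ₁ := 𝟙 _
      τ₂ := 𝟙 _
      τ₃ := kernel.ι _
      comm₂₃ := by
        refine (Category.id_comp _).trans (toCocycles_ι J q).symm }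
  have h1 : Epi φ.τ₁ := inferInstanceAs (Epi (𝟙 _))
  have h2 : IsIso φ.τ₂ := inferInstanceAs (IsIso (𝟙 _))
  have h3 : Mono φ.τ₃ := inferInstanceAs (Mono (kernel.ι _))
  exact (ShortComplex.exact_iff_of_epi_of_isIso_of_mono φ).mpr h

theorem comp_toCocycles_eq_zero {B : C} {q : ℕ} (f : B ⟶ J.cocomplex.X q)
    (w' : f ≫ J.cocomplex.d q (q + 1) = 0) : f ≫ toCocycles J q = 0 := by
  rw [← cancel_mono (kernel.ι _), Category.assoc, toCocycles_ι, w', zero_comp]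

theorem shortExact_toCocycles_zero (w : J.ι.f 0 ≫ toCocycles J 0 = 0) :
    (ShortComplex.mk (J.ι.f 0) (toCocycles J 0) w).ShortExact where
  exact := exact_toCocycles J _ w J.ι_f_zero_comp_complex_d J.exact₀
  mono_f := inferInstanceAs (Mono (J.ι.f 0))
  epi_g := epi_toCocycles J 0

theorem shortExact_toCocycles_succ (q : ℕ)
    (w : kernel.ι (J.cocomplex.d (q + 1) (q + 2)) ≫ toCocycles J (q + 1) = 0) :
    (ShortComplex.mk (kernel.ι _) (toCocycles J (q + 1)) w).ShortExact where
  exact := exact_toCocycles J _ w (kernel.condition _) (ShortComplex.exact_kernel _)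
  mono_f := inferInstanceAs (Mono (kernel.ι _))
  epi_g := epi_toCocycles J (q + 1)

end ResolutionCycles

/-! ### Acyclicity of ℂ on all open subsets -/

section SectionsOfResolutions

open Limits

variable {X : TopCat.{u}}

theorem isFlasque_of_surjective {F G : TopCat.Sheaf AddCommGrpCat.{u} X} (hF : F.IsFlasque)
    (g : F ⟶ G) (hg : ∀ U : Opens X, Function.Surjective (g.hom.app (op U))) : G.IsFlasque where
  epi {U V} i := by
    have h1 : Epi (F.obj.map i) := hF.epi i
    rw [AddCommGrpCat.epi_iff_surjective] at h1 ⊢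
    intro s
    obtain ⟨t, rfl⟩ := hg V.unop s
    obtain ⟨t, rfl⟩ := h1 t
    exact ⟨g.hom.app U t, (congrArg (fun a => a t) (g.hom.naturality i)).symm⟩

variable [T2Space X] (hX : ∀ s : Set X, ParacompactSpace s)
  (J : InjectiveResolution (contSheaf X ℂ))

include hX

theorem toCocycles_surjective (q : ℕ) (U : Opens X) :
    Function.Surjective ((toCocycles J q).hom.app (op U)) := by
  -- Flasqueness of the cocycles is carried through the induction: sections surjecting from a
  -- flasque sheaf make the cocycles flasque, and flasque cocycles give surjectivity at the next
  -- stage. Only the first stage uses partitions of unity.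
  suffices h : (∀ U : Opens X, Function.Surjective ((toCocycles J q).hom.app (op U))) ∧
      (kernel (J.cocomplex.d (q + 1) (q + 2))).IsFlasque from h.1 U
  have hJ : ∀ q, (J.cocomplex.X q).IsFlasque := fun q => isFlasque_of_injective _
  induction q with
  | zero =>
    have h : ∀ U : Opens X, Function.Surjective ((toCocycles J 0).hom.app (op U)) := fun U =>
      have : ParacompactSpace U := hX (U : Set X)
      sections_surjective_of_shortExact _ _ _ (shortExact_toCocycles_zero J
        (comp_toCocycles_eq_zero J _ J.ι_f_zero_comp_complex_d))
    exact ⟨h, isFlasque_of_surjective (hJ 0) _ h⟩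
  | succ q ih =>
    have h : ∀ U : Opens X, Function.Surjective ((toCocycles J (q + 1)).hom.app (op U)) := by
      intro U
      have hk := ih.2
      have hS := shortExact_toCocycles_succ J q
        (comp_toCocycles_eq_zero J _ (kernel.condition _))
      have := TopCat.Sheaf.IsFlasque.epi_of_shortExact (U := U) hS
      exact (AddCommGrpCat.epi_iff_surjective _).mp this
    exact ⟨h, isFlasque_of_surjective (hJ _) _ h⟩

theorem exists_d_eq_of_d_eq_zero (q : ℕ) (U : Opens X)
    (s : (J.cocomplex.X (q + 1)).obj.obj (op U))
    (hs : (J.cocomplex.d (q + 1) (q + 2)).hom.app (op U) s = 0) :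
    ∃ t : (J.cocomplex.X q).obj.obj (op U), (J.cocomplex.d q (q + 1)).hom.app (op U) t = s := by
  obtain ⟨k, rfl⟩ := TopCat.Sheaf.sections_exact_of_left_exact
    (ShortComplex.exact_kernel (J.cocomplex.d (q + 1) (q + 2)))
    (inferInstanceAs (Mono (kernel.ι _))) s hs
  obtain ⟨t, rfl⟩ := toCocycles_surjective hX J q U k
  exact ⟨t, (congrArg (fun a : J.cocomplex.X q ⟶ J.cocomplex.X (q + 1) => a.hom.app (op U) t)
    (toCocycles_ι J q)).symm⟩

theorem exists_comp_d_eq {q : ℕ} (φ : constZ X ⟶ J.cocomplex.X (q + 1))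
    (hφ : φ ≫ J.cocomplex.d (q + 1) (q + 2) = 0) :
    ∃ ψ : constZ X ⟶ J.cocomplex.X q, ψ ≫ J.cocomplex.d q (q + 1) = φ := by
  obtain ⟨t, ht⟩ := exists_d_eq_of_d_eq_zero hX J q ⊤ (homEquivSections.{u} _ φ)
    ((homEquivSections_comp φ _).symm.trans (by rw [hφ]; exact map_zero _))
  refine ⟨(homEquivSections.{u} _).symm t, (homEquivSections.{u} _).injective ?_⟩
  refine (homEquivSections_comp _ _).trans (Eq.trans ?_ ht)
  exact congrArg _ ((homEquivSections.{u} _).apply_symm_apply t)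

theorem cohomology_contSheaf_complex_eq_zero {n : ℕ} (x : Cohomology (contSheaf X ℂ) (n + 1)) :
    x = 0 := by
  obtain ⟨J⟩ : Nonempty (InjectiveResolution (contSheaf X ℂ)) := ⟨injectiveResolution _⟩
  obtain ⟨φ, hφ, rfl⟩ := J.extMk_surjective x (n + 2) rfl
  exact (J.extMk_eq_zero_iff φ _ rfl hφ n rfl).mpr (exists_comp_d_eq hX J φ hφ)

end SectionsOfResolutions

/-! ### The direct image of a resolution of ℂ -/

section Pushforward

open Limits

variable {X Y : TopCat.{u}}

theorem exact_of_sections {S : ShortComplex (TopCat.Sheaf AddCommGrpCat.{u} X)}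
    (h : ∀ (U : Opens X) (s : S.X₂.obj.obj (op U)), S.g.hom.app (op U) s = 0 →
      ∃ t, S.f.hom.app (op U) t = s) : S.Exact := by
  rw [TopCat.Sheaf.exact_iff_stalkFunctor_map_exact]
  intro x
  rw [ShortComplex.ab_exact_iff]
  intro t ht
  obtain ⟨U, hxU, s, rfl⟩ := TopCat.Presheaf.exists_germ_eq S.X₂.obj t
  have h0 : TopCat.Presheaf.germ S.X₃.obj U x hxU (S.g.hom.app (op U) s) = TopCat.Presheaf.germ S.X₃.obj U x hxU 0 := by
    refine Eq.trans (Eq.trans ?_ ht) (map_zero (TopCat.Presheaf.germ S.X₃.obj U x hxU).hom).symm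
    exact (TopCat.Presheaf.stalkFunctor_map_germ_apply U x hxU S.g.hom s).symm
  obtain ⟨W, hxW, i, j, hW⟩ := TopCat.Presheaf.germ_eq _ x hxU hxU _ _ h0
  obtain ⟨r, hr⟩ := h W (S.X₂.obj.map i.op s)
    ((congrArg (fun a => a s) (S.g.hom.naturality i.op)).trans (hW.trans (map_zero _)))
  refine ⟨TopCat.Presheaf.germ S.X₁.obj W x hxW r, ?_⟩
  refine (TopCat.Presheaf.stalkFunctor_map_germ_apply W x hxW S.f.hom r).trans ?_
  rw [hr]
  exact TopCat.Presheaf.germ_res_apply S.X₂.obj i x hxW s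

/-- Direct image is right adjoint to the exact inverse image. -/
theorem injective_pushforward (f : X ⟶ Y) (F : TopCat.Sheaf AddCommGrpCat.{u} X) [Injective F] :
    Injective ((TopCat.Sheaf.pushforward AddCommGrpCat.{u} f).obj F) := by
  have : PreservesFiniteLimits (TopCat.Sheaf.pullback AddCommGrpCat.{u} f) :=
    Functor.sheafPullbackConstruction.preservesFiniteLimits (Opens.map f) AddCommGrpCat.{u}
      (Opens.grothendieckTopology Y) (Opens.grothendieckTopology X)
  exact Injective.injective_of_adjoint (TopCat.Sheaf.pullbackPushforwardAdjunction _ f) F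

variable [T2Space X] (hX : ∀ s : Set X, ParacompactSpace s)
  (J : InjectiveResolution (contSheaf X ℂ)) (f : X ⟶ Y)

include hX

/-- Sections of f_*J over U are sections of J over the preimage of U, where the complex is exact in
positive degrees. -/
theorem exactAt_pushforward (q : ℕ) (hq : 0 < q) :
    (mapNat (TopCat.Sheaf.pushforward AddCommGrpCat.{u} f) J.cocomplex).ExactAt q := by
  obtain ⟨q, rfl⟩ := Nat.exists_eq_succ_of_ne_zero hq.ne'
  rw [HomologicalComplex.exactAt_iff' _ q (q + 1) (q + 2) (by simp) (by simp)]
  refine exact_of_sections fun U s hs => ?_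
  exact exists_d_eq_of_d_eq_zero hX J q ((Opens.map f).obj U) s hs

universe w

variable [HasDerivedCategory.{w} (TopCat.Sheaf AddCommGrpCat.{u} Y)]

theorem isLE_der_pushforward :
    (der (mapNat (TopCat.Sheaf.pushforward AddCommGrpCat.{u} f) J.cocomplex)).IsLE 0 :=
  isLE_der _ 0 (exactAt_pushforward hX J f)

/-- As f_*J has injective terms, such a morphism is a cocycle of global sections of J, that is, a
class in H^n(X, ℂ). -/
theorem shiftedHom_der_pushforward_eq_zero {n : ℕ} (hn : 1 ≤ n) (x : ShiftedHom
    (derSingle (constZ Y))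
    (der (mapNat (TopCat.Sheaf.pushforward AddCommGrpCat.{u} f) J.cocomplex)) (n : ℤ)) :
    x = 0 := by
  obtain ⟨n, rfl⟩ := Nat.exists_eq_succ_of_ne_zero (by lia : n ≠ 0)
  have : ∀ q, Injective
      ((mapNat (TopCat.Sheaf.pushforward AddCommGrpCat.{u} f) J.cocomplex).X q) :=
    fun q => injective_pushforward f (J.cocomplex.X q)
  obtain ⟨φ, hφ, rfl⟩ := derClass_surjective x
  refine derClass_eq_zero _ _ ?_
  let K := mapNat (TopCat.Sheaf.pushforward AddCommGrpCat.{u} f) J.cocomplex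
  obtain ⟨t, ht⟩ := exists_d_eq_of_d_eq_zero hX J n ⊤ (homEquivSections.{u} (K.X (n + 1)) φ)
    ((homEquivSections_comp φ (K.d (n + 1) (n + 2))).symm.trans
      ((congrArg _ hφ).trans (map_zero (homEquivSections.{u} (K.X (n + 2))))))
  refine ⟨(homEquivSections.{u} (K.X n)).symm t, (homEquivSections.{u} _).injective ?_⟩
  refine (homEquivSections_comp _ _).trans (Eq.trans ?_ ht)
  exact congrArg ((globalSections Y).map (K.d n (n + 1)))
    ((homEquivSections.{u} (K.X n)).apply_symm_apply t)

end Pushforward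

section ExtClasses

open Limits Abelian

universe v w

variable {C : Type u} [Category.{v} C] [Abelian C] [HasExt.{w} C] {A Z : C}
  (M : InjectiveResolution A) {n : ℕ}

theorem htpyClass_eq_of_extMk_eq (f g : Z ⟶ M.cocomplex.X (n + 1))
    (hf : f ≫ M.cocomplex.d (n + 1) (n + 2) = 0) (hg : g ≫ M.cocomplex.d (n + 1) (n + 2) = 0)
    (h : M.extMk f (n + 2) rfl hf = M.extMk g (n + 2) rfl hg) : htpyClass f hf = htpyClass g hg := by
  have hfg : (f - g) ≫ M.cocomplex.d (n + 1) (n + 2) = 0 := by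
    rw [Preadditive.sub_comp, hf, hg, sub_zero]
  rw [← sub_eq_zero, ← htpyClass_sub f g hf hg hfg, htpyClass_eq_zero_iff]
  rw [← sub_eq_zero, M.sub_extMk] at h
  exact (M.extMk_eq_zero_iff _ _ rfl hfg n rfl).mp h

end ExtClasses

/-! ### The exponential coboundary and the Leray filtration -/

section CoboundaryOfExponentialSequence

open Limits Abelian Pretriangulated

variable {X Y : TopCat.{u}}

/-- Every `pushHom f φ` is f_*φ preceded by one fixed morphism ℤ → f_*ℤ, which is the form required
for the general results on additive functors. -/
theorem pushHom_eq_compMap (f : X ⟶ Y) {K : CochainComplex (TopCat.Sheaf AddCommGrpCat.{u} X) ℕ}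
    {n : ℕ} (φ : constZ X ⟶ K.X n) :
    pushHom f φ = compMap (TopCat.Sheaf.pushforward AddCommGrpCat.{u} f) (pushHom f (𝟙 _)) φ := by
  rw [← Category.id_comp φ, pushHom_comp, Category.id_comp]
  rfl

variable {f : X ⟶ Y} (LC : LerayResolution f (contSheaf X (Additive ℂˣ)))
  (LZ : LerayResolution f (contSheaf X ℤ))

theorem LerayResolution.filtration_zero {A : TopCat.Sheaf AddCommGrpCat.{u} X}
    (L : LerayResolution f A) (n : ℕ) (x : Cohomology A n) : x ∈ L.filtration 0 n := by
  let _ : HasDerivedCategory (TopCat.Sheaf AddCommGrpCat.{u} X) := HasDerivedCategory.standard _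
  let _ : HasDerivedCategory (TopCat.Sheaf AddCommGrpCat.{u} Y) := HasDerivedCategory.standard _
  obtain ⟨φ, hφ, rfl⟩ := L.M.extMk_surjective x (n + 1) rfl
  refine (L.mem_filtration_iff _).mpr ⟨φ, hφ, rfl, ?_⟩
  rw [pushHom_eq_compMap]
  exact L.CE.memFiltration_zero (compMap_d _ _ hφ)

theorem expCoboundary_mem (p n : ℕ) {x : Cohomology (contSheaf X (Additive ℂˣ)) n}
    (hx : x ∈ LC.filtration p n) : expCoboundary X n x ∈ LZ.filtration p (n + 1) := by
  let _ : HasDerivedCategory (TopCat.Sheaf AddCommGrpCat.{u} X) := HasDerivedCategory.standard _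
  let _ : HasDerivedCategory (TopCat.Sheaf AddCommGrpCat.{u} Y) := HasDerivedCategory.standard _
  obtain ⟨φ, hφ, rfl, hp⟩ := (LC.mem_filtration_iff _).mp hx
  obtain ⟨J⟩ : Nonempty (InjectiveResolution (contSheaf X ℂ)) := ⟨injectiveResolution _⟩
  obtain ⟨i, j, u, hT, hu⟩ := exists_resolution_triangle (expSeq_shortExact X) LZ.M J LC.M
  have hn : (1 : ℤ) + (n : ℤ) = ((n + 1 : ℕ) : ℤ) := by push_cast; ring
  obtain ⟨ψ, hψ, h⟩ := htpyClass_surjective (ShiftedHom.comp (htpyClass φ hφ) u hn)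
  refine (LZ.mem_filtration_iff _).mpr ⟨ψ, hψ,
    extMk_comp_extClass (expSeq_shortExact X) LZ.M LC.M u hu φ hφ ψ hψ hn h, ?_⟩
  rw [pushHom_eq_compMap] at hp ⊢
  exact memFiltration_connecting _ _ u hφ hψ hn h LZ.CE LC.CE hp

/-- Strictness of δ. The cocycle ψ₀ witnessing membership need not be the one produced by u, but
both have the same Ext class and hence the same class in the homotopy category. -/
theorem mem_of_expCoboundary_mem [T2Space X] (hX : ∀ s : Set X, ParacompactSpace s) {p n : ℕ}
    (hn1 : 1 ≤ n) (hpn : p ≤ n) {x : Cohomology (contSheaf X (Additive ℂˣ)) n}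
    (hx : expCoboundary X n x ∈ LZ.filtration p (n + 1)) : x ∈ LC.filtration p n := by
  let _ : HasDerivedCategory (TopCat.Sheaf AddCommGrpCat.{u} X) := HasDerivedCategory.standard _
  let _ : HasDerivedCategory (TopCat.Sheaf AddCommGrpCat.{u} Y) := HasDerivedCategory.standard _
  obtain ⟨φ, hφ, rfl⟩ := LC.M.extMk_surjective x (n + 1) rfl
  obtain ⟨ψ₀, hψ₀, hψ₀x, hp⟩ := (LZ.mem_filtration_iff _).mp hx
  obtain ⟨J⟩ : Nonempty (InjectiveResolution (contSheaf X ℂ)) := ⟨injectiveResolution _⟩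
  obtain ⟨i, j, u, hT, hu⟩ := exists_resolution_triangle (expSeq_shortExact X) LZ.M J LC.M
  have hn : (1 : ℤ) + (n : ℤ) = ((n + 1 : ℕ) : ℤ) := by push_cast; ring
  obtain ⟨ψ, hψ, h⟩ := htpyClass_surjective (ShiftedHom.comp (htpyClass φ hφ) u hn)
  have h1 := extMk_comp_extClass (expSeq_shortExact X) LZ.M LC.M u hu φ hφ ψ hψ hn h
  have h2 : htpyClass ψ₀ hψ₀ = ShiftedHom.comp (htpyClass φ hφ) u hn :=
    (htpyClass_eq_of_extMk_eq LZ.M ψ₀ ψ hψ₀ hψ (hψ₀x.trans h1.symm)).trans h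
  refine (LC.mem_filtration_iff _).mpr ⟨φ, hφ, rfl, ?_⟩
  rw [pushHom_eq_compMap] at hp ⊢
  exact memFiltration_of_connecting _ _ u hφ hψ₀ hn h2 LZ.CE LC.CE
    (isLE_der_pushforward hX J f) (shiftedHom_der_pushforward_eq_zero hX J f hn1) hT hp hpn

theorem expCoboundary_surjective [T2Space X] (hX : ∀ s : Set X, ParacompactSpace s) (n : ℕ) :
    Function.Surjective (expCoboundary X n) := fun y =>
  Ext.covariant_sequence_exact₁ (constZ X) (expSeq_shortExact X) y
    (cohomology_contSheaf_complex_eq_zero hX _) rfl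

theorem expCoboundary_injective [T2Space X] (hX : ∀ s : Set X, ParacompactSpace s) {n : ℕ}
    (hn : 1 ≤ n) : Function.Injective (expCoboundary X n) := by
  obtain ⟨n, rfl⟩ := Nat.exists_eq_succ_of_ne_zero (by lia : n ≠ 0)
  refine (injective_iff_map_eq_zero _).mpr fun x hx => ?_
  obtain ⟨y, rfl⟩ := Ext.covariant_sequence_exact₃ (constZ X) (expSeq_shortExact X) x rfl hx
  have hy : y = 0 := cohomology_contSheaf_complex_eq_zero hX y
  rw [hy, Ext.zero_comp]
  rfl

theorem exists_expCoboundary_eq [T2Space X] (hX : ∀ s : Set X, ParacompactSpace s) {p n : ℕ}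
    (hpn : p ≤ n) {y : Cohomology (contSheaf X ℤ) (n + 1)} (hy : y ∈ LZ.filtration p (n + 1)) :
    ∃ x ∈ LC.filtration p n, expCoboundary X n x = y := by
  obtain ⟨x, rfl⟩ := expCoboundary_surjective hX n y
  refine ⟨x, ?_, rfl⟩
  -- In degree 0 strictness is not available, but there p = 0 and F^0 is the whole group.
  rcases Nat.eq_zero_or_pos n with rfl | hn
  · obtain rfl := Nat.le_zero.mp hpn
    exact LC.filtration_zero 0 x
  · exact mem_of_expCoboundary_mem LC LZ hX hn hpn hy

end CoboundaryOfExponentialSequence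

end Leray

theorem theorem5p2 {X Y : TopCat.{u}} [T2Space X] [ParacompactSpace X] [ParacompactSpace Y]
    (hX : ∀ s : Set X, ParacompactSpace s) (f : X ⟶ Y)
    (LC : Leray.LerayResolution f (Leray.contSheaf X (Additive ℂˣ)))
    (LZ : Leray.LerayResolution f (Leray.contSheaf X ℤ)) :
    ∃ h : Leray.CoboundaryPreservesFiltration LC LZ,
      (∀ p q : ℕ, 1 ≤ p + q → Function.Bijective (Leray.filtrationCoboundary h p (p + q))) ∧
      Function.Surjective (Leray.filtrationCoboundary h 0 0) ∧
      (∀ p q : ℕ, 1 ≤ q → Function.Bijective (Leray.eInftyCoboundary h p q)) ∧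
      ∀ p : ℕ, Function.Surjective (Leray.eInftyCoboundary h p 0) := by
  have h : Leray.CoboundaryPreservesFiltration LC LZ :=
    fun p n _ hx => Leray.expCoboundary_mem LC LZ p n hx
  have hsurj : ∀ p n : ℕ, p ≤ n → Function.Surjective (Leray.filtrationCoboundary h p n) := by
    rintro p n hpn ⟨y, hy⟩
    obtain ⟨x, hx, rfl⟩ := Leray.exists_expCoboundary_eq LC LZ hX hpn hy
    exact ⟨⟨x, hx⟩, rfl⟩
  have hE : ∀ p q : ℕ, Function.Surjective (Leray.eInftyCoboundary h p q) := by
    intro p q y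
    obtain ⟨y, rfl⟩ := QuotientAddGroup.mk_surjective y
    obtain ⟨x, rfl⟩ := hsurj p (p + q) (Nat.le_add_right p q) y
    exact ⟨QuotientAddGroup.mk x, rfl⟩
  refine ⟨h, fun p q hpq => ⟨fun x x' hxx' => ?_, hsurj _ _ (Nat.le_add_right p q)⟩,
    hsurj 0 0 le_rfl, fun p q hq => ⟨?_, hE p q⟩, fun p => hE p 0⟩
  · exact Subtype.ext (Leray.expCoboundary_injective hX hpq (congrArg Subtype.val hxx'))
  · refine (injective_iff_map_eq_zero _).mpr fun x hx => ?_
    obtain ⟨⟨x, hxF⟩, rfl⟩ := QuotientAddGroup.mk_surjective x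
    have hx' : Leray.expCoboundary X (p + q) x ∈ LZ.filtration (p + 1) (p + q + 1) :=
      (QuotientAddGroup.eq_zero_iff (Leray.filtrationCoboundary h p (p + q) ⟨x, hxF⟩)).mp hx
    -- Strictness is applied to F^{p+1} in degree p+q; its condition p+1 ≤ p+q is exactly q ≥ 1.
    exact (QuotientAddGroup.eq_zero_iff _).mpr
      (Leray.mem_of_expCoboundary_mem LC LZ hX (by lia) (by lia) hx')
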